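/- **Setting.** Let $K$ be a finite geometric simplicial complex in $\mathbb R^d$, let $n_j$ be the number of its $j$-simplices, $K_j$ the set of its $j$-simplices, and assume that every set of at most $d+1$ vertices of $K$ is affinely independent. For a unit vector $s$, the height of a simplex $\tau$ in direction $s$ is $h_s(\tau)=\max_{u\in\operatorname{verts}(\tau)} s\cdot u$. Homology is taken with coefficients in an arbitrary field. The augmented persistence diagram of $K$ in direction $s$ consists, in each dimension $j$, of the points $(h_s(\sigma_a),h_s(\sigma_b))$, with $h_s(\sigma_b)$ replaced by $\infty$ if $b=\infty$, where $(a,b)$ runs through the $j$-dimensional persistence diagram (with multiplicities) of a filtration of $K$ that adds the simplices $\sigma_1,\sigma_2,\dots$ one at a time, faces before cofaces and in order of non-decreasing $h_s$. An oracle returns, for a direction $s$, the diagram in direction $s$ (all dimensions together count as one diagram); one query takes time at most $\Pi\ge 0$. The $k$-indegree of $\sigma\in K$ in a direction $s$ perpendicular to $\operatorname{aff}(\sigma)$ is the number of $k$-dimensional cofaces $\tau$ of $\sigma$ with $h_s(\tau)=h_s(\sigma)$. The wedge at $\sigma$ between two directions $s,s'$ perpendicular to $\operatorname{aff}(\sigma)$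 is the closure of the symmetric difference of the half-spaces $\{x: s\cdot x\le h_s(\sigma)\}$ and $\{x: s'\cdot x\le h_{s'}(\sigma)\}$. The tilt of $s$ towards $s'$ is the normalization of $(1-\varepsilon)s+\varepsilon s'$ for an $\varepsilon>0$, computed from the heights of the vertices, so small that no two vertices with different heights in direction $s$ exchange their order. **Algorithm `indegree`$(\sigma,s,k,T)$** ($T$ a memoization table, initially empty). Query the diagram in direction $s$, and let $\delta$ be the number of deaths in dimension $k-1$ plus the number of births in dimension $k$ at the height of $\sigma$. For each nonempty proper face $\tau$ of $\sigma$, in non-descending order of dimension, if $T[\tau]$ is not known, find a direction $s'$ orthogonal to $\operatorname{aff}(\tau)$ in which the other vertices of $\sigma$ are above $\tau$, let $s_t$ be the tilt of $s$ towards $s'$, and set $T[\tau]$ to be the result of `indegree`$(\tau,s_t,k,T)$. Return $\delta-\sum_{\tau\prec\sigma}T[\tau]$. **Algorithm `is-simplex`$(\sigma,v)$** (it knows the vertices of $K$, $\sigma$ and $v$, and has access to the oracle). Put $k=\dim\sigma+1$ and $\Sigma=\operatorname{verts}(\sigma)\cup\{v\}$. Find a direction $s_1$ orthogonal to $\operatorname{aff}(\Sigma)$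 and a direction $s_2$ orthogonal to $\operatorname{aff}(\Sigma)$ in which no vertex of $K$ outside $\Sigma$ has the height of $\Sigma$; let $s_*$ be the tilt of $s_1$ towards $s_2$; find a direction $s_3$ orthogonal to $\operatorname{aff}(\sigma)$ in which $v$ is above $\sigma$; let $s_L$ be the tilt of $s_*$ towards $s_3$ and $s_U$ the tilt of $s_*$ towards $-s_3$. Return True iff $|\,\texttt{indegree}(\sigma,s_U,k)-\texttt{indegree}(\sigma,s_L,k)|=1$. **Theorem (Correctness of Simplex Predicate).** The two algorithms can be implemented, with elementary real-number operations as unit steps, so that the following holds with an absolute constant $C$. Let $d$, $K$ and the oracle be as above, let $1\le k<d$, let $\sigma\in K_{k-1}$, and let $v\in K_0\setminus\operatorname{verts}(\sigma)$. 1. `is-simplex`$(\sigma,v)$ returns True if and only if $\operatorname{verts}(\sigma)\cup\{v\}$ is the vertex set of a $k$-simplex of $K$. 2. It uses exactly $2(2^k-1)$ diagrams. 3. Its running time is at most $$C\Big(d\,n_0+2^k\big(n_0n_{k-1}+n_0\log n_0+d^2+2^{k-1}+\Pi\big)\Big).$$ 4. The directions $s_L$ and $s_U$ are unit vectors in each of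 which all vertices of $\sigma$ have the same height, the two numbers compared are the $k$-indegrees of $\sigma$ in these two directions, and $v$ is the only vertex of $K$ outside $\sigma$ in the wedge at $\sigma$ between $s_L$ and $s_U$. -/

import Mathlib

universe u

set_option maxSynthPendingDepth 3

namespace SimplexPredicate

noncomputable section

/-- The ambient Euclidean space `ℝ^d`. -/
abbrev Pt (d : ℕ) := EuclideanSpace ℝ (Fin d)

/-! ### Simplicial homology with field coefficients

A simplex is represented by its vertex set.  Chains live in the free vector space on all finite
vertex sets; simplices are oriented by the lexicographic order of their vertices. -/

/-- The sign of the facet of `s` opposite to `x`: `(-1)` to the position of `x` in `s`. -/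
def facetSign (𝔽 : Type u) [Field 𝔽] {d : ℕ} (s : Finset (Pt d)) (x : Pt d) : 𝔽 :=
  open Classical in
  (-1) ^ (s.filter fun y => toLex (y.ofLp) < toLex (x.ofLp)).card

/-- The boundary of a single simplex (zero for a vertex: homology is not reduced). -/
def simplexBoundary (𝔽 : Type u) [Field 𝔽] {d : ℕ} (s : Finset (Pt d)) : Finset (Pt d) →₀ 𝔽 :=
  open Classical in
  if s.card ≤ 1 then 0 else ∑ x ∈ s, Finsupp.single (s.erase x) (facetSign 𝔽 s x)

/-- The simplicial boundary operator. -/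
def boundary (𝔽 : Type u) [Field 𝔽] (d : ℕ) :
    (Finset (Pt d) →₀ 𝔽) →ₗ[𝔽] (Finset (Pt d) →₀ 𝔽) :=
  Finsupp.linearCombination 𝔽 (simplexBoundary 𝔽)

/-- The `k`-chains of a family `F` of simplices. -/
def chains (𝔽 : Type u) [Field 𝔽] {d : ℕ} (F : Set (Finset (Pt d))) (k : ℕ) :
    Submodule 𝔽 (Finset (Pt d) →₀ 𝔽) :=
  Finsupp.supported 𝔽 𝔽 {s | s ∈ F ∧ s.card = k + 1}

/-- The `k`-cycles of `F`. -/
def cycles (𝔽 : Type u) [Field 𝔽] {d : ℕ} (F : Set (Finset (Pt d))) (k : ℕ) :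
    Submodule 𝔽 (Finset (Pt d) →₀ 𝔽) :=
  chains 𝔽 F k ⊓ LinearMap.ker (boundary 𝔽 d)

/-- The `k`-boundaries of `F`. -/
def boundaries (𝔽 : Type u) [Field 𝔽] {d : ℕ} (F : Set (Finset (Pt d))) (k : ℕ) :
    Submodule 𝔽 (Finset (Pt d) →₀ 𝔽) :=
  (chains 𝔽 F (k + 1)).map (boundary 𝔽 d)

/-- The homology `H_k(F)` with coefficients in `𝔽`. -/
abbrev Homology (𝔽 : Type u) [Field 𝔽] {d : ℕ} (F : Set (Finset (Pt d))) (k : ℕ) :=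
  (cycles 𝔽 F k) ⧸ (boundaries 𝔽 F k).submoduleOf (cycles 𝔽 F k)

theorem chains_mono (𝔽 : Type u) [Field 𝔽] {d : ℕ} {F G : Set (Finset (Pt d))} (h : F ⊆ G)
    (k : ℕ) : chains 𝔽 F k ≤ chains 𝔽 G k :=
  Finsupp.supported_mono fun _ hs => ⟨h hs.1, hs.2⟩

theorem cycles_mono (𝔽 : Type u) [Field 𝔽] {d : ℕ} {F G : Set (Finset (Pt d))} (h : F ⊆ G)
    (k : ℕ) : cycles 𝔽 F k ≤ cycles 𝔽 G k :=
  inf_le_inf_right _ (chains_mono 𝔽 h k)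

theorem boundaries_mono (𝔽 : Type u) [Field 𝔽] {d : ℕ} {F G : Set (Finset (Pt d))} (h : F ⊆ G)
    (k : ℕ) : boundaries 𝔽 F k ≤ boundaries 𝔽 G k :=
  Submodule.map_mono (chains_mono 𝔽 h (k + 1))

/-- The map `H_k(F) → H_k(G)` induced by an inclusion `F ⊆ G`. -/
def homologyMap (𝔽 : Type u) [Field 𝔽] {d : ℕ} {F G : Set (Finset (Pt d))} (h : F ⊆ G) (k : ℕ) :
    Homology 𝔽 F k →ₗ[𝔽] Homology 𝔽 G k :=
  Submodule.mapQ _ _ (Submodule.inclusion (cycles_mono 𝔽 h k))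
    (fun _ hx => boundaries_mono 𝔽 h k hx)

/-- The persistent Betti number of `F ⊆ G`: the rank of `H_k(F) → H_k(G)`. -/
def persistentBetti (𝔽 : Type u) [Field 𝔽] {d : ℕ} {F G : Set (Finset (Pt d))} (h : F ⊆ G)
    (k : ℕ) : ℕ :=
  Module.finrank 𝔽 (LinearMap.range (homologyMap 𝔽 h k))

/-! ### Augmented persistence diagrams of lower-star filtrations -/

/-- The lower-star filter function in direction `dir`: the height of the highest vertex. -/
def height {d : ℕ} (dir : Pt d) (s : Finset (Pt d)) : ℝ :=
  if h : s.Nonempty then s.sup' h (fun x => inner ℝ dir x) else 0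

/-- An index filtration of `K` compatible with `f`: an enumeration of the simplices of `K` in
which proper faces come first and along which `f` does not decrease. -/
structure IndexFiltration {d : ℕ} (K : Geometry.SimplicialComplex ℝ (Pt d))
    (f : Finset (Pt d) → ℝ) where
  size : ℕ
  simplex : Fin size ≃ K.faces
  face_lt : ∀ i j, (simplex i : Finset (Pt d)) ⊂ simplex j → i < j
  mono : ∀ i j, i ≤ j → f (simplex i) ≤ f (simplex j)

namespace IndexFiltration

variable {d : ℕ} {K : Geometry.SimplicialComplex ℝ (Pt d)} {f : Finset (Pt d) → ℝ}

/-- The subcomplex formed by the first `m` simplices. -/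
def sublevel (e : IndexFiltration K f) (m : ℕ) : Set (Finset (Pt d)) :=
  {s | ∃ i : Fin e.size, (i : ℕ) < m ∧ (e.simplex i : Finset (Pt d)) = s}

theorem sublevel_mono (e : IndexFiltration K f) {a b : ℕ} (h : a ≤ b) :
    e.sublevel a ⊆ e.sublevel b :=
  fun _ ⟨i, hi, hs⟩ => ⟨i, lt_of_lt_of_le hi h, hs⟩

/-- The persistent Betti number `β_k^{a,b}` of the index filtration. -/
def betti (𝔽 : Type u) [Field 𝔽] (e : IndexFiltration K f) (k : ℕ) {a b : ℕ} (h : a ≤ b) : ℤ :=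
  persistentBetti 𝔽 (e.sublevel_mono h) k

/-- The multiplicity of the point born with the simplex `i` and dying with the simplex `j`.
The simplex `i : Fin e.size` is the `(i+1)`-st one, so `sublevel (i + 1)` is the first subcomplex
that contains it. -/
def multiplicity (𝔽 : Type u) [Field 𝔽] (e : IndexFiltration K f) (k : ℕ) (i j : Fin e.size) : ℕ :=
  if h : (i : ℕ) < (j : ℕ) then
    (e.betti 𝔽 k (a := i + 1) (b := j) (by omega)
      - e.betti 𝔽 k (a := i + 1) (b := j + 1) (by omega)
      - e.betti 𝔽 k (a := i) (b := j) (by omega)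
      + e.betti 𝔽 k (a := i) (b := j + 1) (by omega)).toNat
  else 0

/-- The multiplicity of the point born with the simplex `i` that never dies. -/
def multiplicityTop (𝔽 : Type u) [Field 𝔽] (e : IndexFiltration K f) (k : ℕ) (i : Fin e.size) : ℕ :=
  (e.betti 𝔽 k (a := i + 1) (b := e.size) (by omega)
    - e.betti 𝔽 k (a := i) (b := e.size) (by omega)).toNat

/-- The `k`-dimensional augmented persistence diagram: the points `(f σ_i, f σ_j)` for the points
`(i, j)` of the persistence diagram of the index filtration. -/
def apd (𝔽 : Type u) [Field 𝔽] (e : IndexFiltration K f) (k : ℕ) : Multiset (ℝ × EReal) :=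
  ∑ i : Fin e.size,
    ((∑ j : Fin e.size, Multiset.replicate (e.multiplicity 𝔽 k i j)
        (f (e.simplex i), ((f (e.simplex j) : ℝ) : EReal)))
      + Multiset.replicate (e.multiplicityTop 𝔽 k i) (f (e.simplex i), (⊤ : EReal)))

end IndexFiltration

/-- An answer of the oracle to one query: a list of points in each dimension. -/
abbrev Diagram := ℕ → List (ℝ × EReal)

/-- `O` is an oracle for `K`: for each direction it returns the augmented persistence diagram of
the lower-star filtration of `K` (its points in any order). -/
def IsOracle (𝔽 : Type u) [Field 𝔽] {d : ℕ} (K : Geometry.SimplicialComplex ℝ (Pt d))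
    (O : Pt d → Diagram) : Prop :=
  ∀ dir : Pt d, ‖dir‖ = 1 → ∃ e : IndexFiltration K (height dir),
    ∀ k, (O dir k : Multiset (ℝ × EReal)) = e.apd 𝔽 k

/-! ### Geometry of the complex -/

/-- At most `d + 1` vertices are always affinely independent. -/
def AffineGeneralPosition {d : ℕ} (A : Set (Pt d)) : Prop :=
  ∀ S : Finset (Pt d), (S : Set (Pt d)) ⊆ A → S.card ≤ d + 1 →
    AffineIndependent ℝ ((↑) : S → Pt d)

/-- The number `n_j` of `j`-simplices. -/
def simplexCount {d : ℕ} (K : Geometry.SimplicialComplex ℝ (Pt d)) (j : ℕ) : ℕ :=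
  Set.ncard {s | s ∈ K.faces ∧ s.card = j + 1}

/-- The `k`-indegree of `σ` in direction `dir`: the number of `k`-dimensional cofaces of `σ` at the
height of `σ`. -/
def kIndegree {d : ℕ} (K : Geometry.SimplicialComplex ℝ (Pt d)) (k : ℕ) (σ : Finset (Pt d))
    (dir : Pt d) : ℕ :=
  Set.ncard {τ | τ ∈ K.faces ∧ τ.card = k + 1 ∧ σ ⊆ τ ∧ height dir τ = height dir σ}

/-- The closed half-space at or below height `c` in direction `dir`. -/
def lowerHalfSpace {d : ℕ} (dir : Pt d) (c : ℝ) : Set (Pt d) := {x | inner ℝ dir x ≤ c}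

/-- The wedge between two directions. -/
def wedge {d : ℕ} (dir₁ : Pt d) (c₁ : ℝ) (dir₂ : Pt d) (c₂ : ℝ) : Set (Pt d) :=
  closure (symmDiff (lowerHalfSpace dir₁ c₁) (lowerHalfSpace dir₂ c₂))

/-- The vertex set given by a list of points. -/
def vertexSet {d : ℕ} (l : List (Pt d)) : Finset (Pt d) :=
  open Classical in l.toFinset

/-! ### A real random access machine with an oracle

A computation carries its result, the number of elementary steps and the number of diagrams that
it asks for.  One step is an arithmetic operation on reals or integers, a square root, a
comparison of two reals or of two vertex labels, or the reading or writing of a cell. -/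

structure Cost (α : Type) where
  val : α
  steps : ℕ
  diagrams : ℕ

instance : Monad Cost where
  pure a := ⟨a, 0, 0⟩
  bind x f := ⟨(f x.val).val, x.steps + (f x.val).steps, x.diagrams + (f x.val).diagrams⟩

/-- The running time, if each query to the oracle takes time `Θ`. -/
def Cost.time {α : Type} (Θ : ℝ) (x : Cost α) : ℝ := x.steps + Θ * x.diagrams

/-- The value `a`, obtained by `n` elementary steps. -/
def op {α : Type} (n : ℕ) (a : α) : Cost α := ⟨a, n, 0⟩

/-- One query to the oracle; writing down the direction takes `d` steps. -/
def query {d : ℕ} (O : Pt d → Diagram) (dir : Pt d) : Cost Diagram := ⟨O dir, d, 1⟩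

section Vectors

variable {d : ℕ}

def dot (x y : Pt d) : Cost ℝ := op (2 * d) (inner ℝ x y)

def sub (x y : Pt d) : Cost (Pt d) := op d (x - y)

/-- `y + a x`. -/
def axpy (a : ℝ) (x y : Pt d) : Cost (Pt d) := op (2 * d) (y + a • x)

/-- `x / ‖x‖`. -/
def toUnit (x : Pt d) : Cost (Pt d) := op (3 * d + 2) (‖x‖⁻¹ • x)

/-- Subtract from `y` its projections to the pairwise orthogonal vectors in the list. -/
def residual : List (Pt d) → Pt d → Cost (Pt d)
  | [], y => op d y
  | b :: B, y => do
    let p ← dot y b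
    let q ← dot b b
    let a ← op 2 (-(p / q))
    let z ← axpy a b y
    residual B z

/-- Gram-Schmidt (without normalization): extends the orthogonal list `B` by the differences
`y - w` for `y` in the list. -/
def gramSchmidtFrom (w : Pt d) : List (Pt d) → List (Pt d) → Cost (List (Pt d))
  | B, [] => pure B
  | B, y :: ys => do
    let z ← sub y w
    let r ← residual B z
    gramSchmidtFrom w (r :: B) ys

/-- The normalized residual of the first vector in the list whose residual is not zero. -/
def firstResidual (B : List (Pt d)) : List (Pt d) → Cost (Pt d)
  | [] => pure 0
  | y :: ys => do
    let r ← residual B y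
    let n ← dot r r
    let isZero ← op 1 (decide (n = 0))
    if isZero then firstResidual B ys else toUnit r

/-- A direction orthogonal to all vectors in the orthogonal list `B`, found by projecting the
standard basis vectors one after the other. -/
def orthogonalDirection (B : List (Pt d)) : Cost (Pt d) :=
  firstResidual B ((List.finRange d).map fun i => EuclideanSpace.single i (1 : ℝ))

/-- Inner loop of `directionAbove`. -/
def raise (w : Pt d) : List (Pt d) → Pt d → List (Pt d) → Cost (Pt d)
  | _, s, [] => pure s
  | B, s, x :: xs => do
    let z ← sub x w
    let r ← residual B z
    let a ← dot s z
    let n ← dot r r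
    let c ← op 2 ((1 - a) / n)
    let s' ← axpy c r s
    raise w (r :: B) s' xs

/-- A direction orthogonal to the affine hull of the points in `W` in which the points in `X` are
above those in `W`. -/
def directionAbove (W X : List (Pt d)) : Cost (Pt d) :=
  match W with
  | [] => pure 0
  | w :: ws => do
    let B ← gramSchmidtFrom w [] ws
    let s ← raise w B 0 X
    toUnit s

/-- The largest squared distance of a point in the list to `w`. -/
def radiusSq (w : Pt d) : List (Pt d) → Cost ℝ
  | [] => op 1 0
  | q :: qs => do
    let m ← radiusSq w qs
    let z ← sub q w
    let n ← dot z z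
    op 1 (max m n)

/-- An upper bound for the spread of the heights of the vertices in any direction. -/
def spreadBound (w : Pt d) (V : List (Pt d)) : Cost ℝ := do
  let m ← radiusSq w V
  op 2 (2 * Real.sqrt m)

/-- The list `l` without the points of `m`. -/
def without (l m : List (Pt d)) : Cost (List (Pt d)) :=
  open Classical in op (l.length * (m.length + 1)) (l.filter fun x => x ∉ m)

/-! #### Tilts -/

/-- The list of heights. -/
def heights (dir : Pt d) : List (Pt d) → Cost (List ℝ)
  | [] => op 1 []
  | q :: qs => do
    let h ← dot dir q
    let H ← heights dir qs
    op 1 (h :: H)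

/-- Merge two sorted lists. -/
def merge : List ℝ → List ℝ → Cost (List ℝ)
  | [], l => op 1 l
  | l, [] => op 1 l
  | a :: l, b :: r =>
    if a ≤ b then do
      let m ← merge l (b :: r)
      op 2 (a :: m)
    else do
      let m ← merge (a :: l) r
      op 2 (b :: m)
termination_by l r => l.length + r.length

/-- Merge sort; the first argument bounds the recursion depth. -/
def mergeSort : ℕ → List ℝ → Cost (List ℝ)
  | 0, l => op 1 l
  | n + 1, l =>
    if l.length ≤ 1 then op 1 l else do
      let p ← op (l.length + 1) (l.splitAt (l.length / 2))
      let a ← mergeSort n p.1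
      let b ← mergeSort n p.2
      merge a b

/-- The smallest distance between distinct consecutive entries, or `1` if that is smaller. -/
def smallestGap : List ℝ → Cost ℝ
  | a :: b :: l => do
    let g ← smallestGap (b :: l)
    op 3 (if a < b then min g (b - a) else g)
  | _ => op 1 1

/-- A positive lower bound for the distance between distinct heights of vertices. -/
def heightGap (dir : Pt d) (V : List (Pt d)) : Cost ℝ := do
  let H ← heights dir V
  let S ← mergeSort H.length H
  smallestGap S

/-- The tilt `(1 - ε) s + ε s'` (normalized) of `s` towards `s'`.  Here `g` bounds the distances
between distinct heights in direction `s` from below and `D` bounds the spread of the heights in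
direction `s'` from above, so that no two vertices exchange their order before `g / (g + D)`;
`ε` is half of that. -/
def tilt (g D : ℝ) (s s' : Pt d) : Cost (Pt d) := do
  let ε ← op 3 (g / (2 * (g + D)))
  let a ← op 1 (1 - ε)
  let x ← axpy a s 0
  let y ← axpy ε s' x
  toUnit y

/-! #### Computing `k`-indegrees -/

/-- The number of points in the list that satisfy the condition. -/
def countPoints (p : ℝ × EReal → Prop) [DecidablePred p] : List (ℝ × EReal) → Cost ℤ
  | [] => op 1 0
  | a :: l => do
    let n ← countPoints p l
    op 2 (if p a then n + 1 else n)

/-- The nonempty proper faces of the simplex with vertex list `σ`, in non-descending order of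
dimension. -/
def properFaces (σ : List (Pt d)) : List (List (Pt d)) :=
  (List.range' 1 (σ.length - 1)).flatMap fun m => List.sublistsLen m σ

/-- A memoization table; one cell for each face of a fixed simplex. -/
abbrev Table (d : ℕ) := List (Pt d) → Option ℤ

/-- Write `n` into the cell of `τ`. -/
def store (T : Table d) (τ : List (Pt d)) (n : ℤ) : Cost (Table d) :=
  open Classical in op 1 (Function.update T τ (some n))

/-- The recursive computation of the `k`-indegree of `σ` in direction `dir`.  `V` lists the
vertices of the complex, `D` bounds the spread of their heights, `T` is the memoization table, and
the first argument bounds the recursion depth. -/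
def indegree (O : Pt d → Diagram) (V : List (Pt d)) (D : ℝ) (k : ℕ) :
    ℕ → List (Pt d) → Pt d → Table d → Cost (ℤ × Table d)
  | 0, _, _, T => pure (0, T)
  | depth + 1, σ, dir, T => do
    let dgm ← query O dir
    let c ← dot dir (σ.headD 0)
    let numDeaths ← countPoints (fun p => p.2 = (c : EReal)) (dgm (k - 1))
    let numBirths ← countPoints (fun p => p.1 = c) (dgm k)
    let faces ← op (2 ^ σ.length) (properFaces σ)
    -- the gap of the heights is needed only if some face is missing from the table
    let missing ← op (2 ^ σ.length) (faces.any fun τ => (T τ).isNone)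
    let g ← if missing then heightGap dir V else pure 1
    let out ← faces.foldlM (fun (acc : ℤ × Table d) τ => do
      let T' ← match acc.2 τ with
        | some _ => op 1 acc.2
        | none => do
          let rest ← without σ τ
          let dir' ← directionAbove τ rest
          let dirT ← tilt g D dir dir'
          let r ← indegree O V D k depth τ dirT acc.2
          store r.2 τ r.1
      op 2 (acc.1 + (T' τ).getD 0, T')) (0, T)
    op 2 (numDeaths + numBirths - out.1, out.2)

/-- The `k`-indegree of `σ` in direction `dir`, computed with an initially empty table. -/
def computeIndegree (O : Pt d → Diagram) (V : List (Pt d)) (k : ℕ) (σ : List (Pt d))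
    (dir : Pt d) : Cost ℤ := do
  let D ← spreadBound (σ.headD 0) V
  let r ← indegree O V D k σ.length σ dir (fun _ => none)
  pure r.1

/-! #### The simplex predicate -/

/-- The smallest nonzero distance of a height to the height of `w`, or `1` if that is smaller. -/
def gapAt (w dir : Pt d) : List (Pt d) → Cost ℝ
  | [] => op 1 1
  | q :: qs => do
    let m ← gapAt w dir qs
    let z ← sub q w
    let a ← dot dir z
    op 3 (if a = 0 then m else min m |a|)

/-- Inner loop of `separatingDirection`: `m` bounds from below the distance to the height of `w` of
each point that was not at that height initially or that has been treated already. -/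
def separate (B : List (Pt d)) (w : Pt d) (D : ℝ) : ℝ → Pt d → List (Pt d) → Cost (Pt d)
  | _, s, [] => pure s
  | m, s, q :: qs => do
    let z ← sub q w
    let a ← dot s z
    let isZero ← op 1 (decide (a = 0))
    if isZero then do
      let r ← residual B z
      let n ← dot r r
      let δ ← op 3 (m / (2 * D ^ 2))
      let s' ← axpy δ r s
      let m' ← op 3 (min (m / 2) (δ * n))
      separate B w D m' s' qs
    else do
      let m' ← op 2 (min m |a|)
      separate B w D m' s qs

/-- A direction that is orthogonal to the vectors in `B`, like `s`, and in which no point of `Q`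
is at the height of `w`. -/
def separatingDirection (B : List (Pt d)) (w : Pt d) (D : ℝ) (s : Pt d) (Q : List (Pt d)) :
    Cost (Pt d) := do
  let m ← gapAt w s Q
  let s' ← separate B w D m s Q
  toUnit s'

/-- The directions `s_L` and `s_U` that bound the wedge at `σ`, with `v` above `σ` in
direction `s_L` and below `σ` in direction `s_U`. -/
def wedgeDirections (V σ : List (Pt d)) (v : Pt d) : Cost (Pt d × Pt d) :=
  match σ with
  | [] => pure (0, 0)
  | w :: ws => do
    let B ← gramSchmidtFrom w [] (ws ++ [v])
    let s₁ ← orthogonalDirection B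
    let D ← spreadBound w V
    let Q ← without V (v :: w :: ws)
    let s₂ ← separatingDirection B w D s₁ Q
    let g₁ ← heightGap s₁ V
    let s ← tilt g₁ D s₁ s₂
    let s₃ ← directionAbove (w :: ws) [v]
    let g ← heightGap s V
    let sL ← tilt g D s s₃
    let s₃' ← op d (-s₃)
    let sU ← tilt g D s s₃'
    pure (sL, sU)

/-- The simplex predicate.  It knows the vertices `V` of the complex and can ask for augmented
persistence diagrams; `σ` lists the vertices of a `(k-1)`-simplex. -/
def isSimplex (O : Pt d → Diagram) (V σ : List (Pt d)) (v : Pt d) : Cost Bool := do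
  let k ← op 1 σ.length
  let dirs ← wedgeDirections V σ v
  let upper ← computeIndegree O V k σ dirs.2
  let lower ← computeIndegree O V k σ dirs.1
  op 3 (decide (|upper - lower| = 1))

end Vectors

end

end SimplexPredicate

open SimplexPredicate

namespace SimplexPredicate

/-! ### The boundary operator squares to zero -/

section BoundarySquared

variable (𝔽 : Type u) [Field 𝔽] {d : ℕ}

/-! Adding a k-simplex to a filtration raises either the dimension of the k-cycles (a birth in
dimension k) or the dimension of the (k-1)-boundaries (a death in dimension k-1) by one. The
augmented diagram keeps each of these events at the height of its simplex, even when the birth and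
death heights agree. So the deaths in dimension k-1 and the births in dimension k at height c
together count the k-simplices at height c (`countP_death_add_countP_birth`).

Let σ be level in a direction that has no other vertex at that level, and let P single out the
vertices below it. A simplex at the height of σ consists of a nonempty face ρ of σ and vertices
satisfying P. The number `faceCount` of those that meet σ exactly in ρ depends on σ, P and ρ, but
not on the direction. For a proper face τ, the tilt lifts the rest of σ above τ while no vertex
outside σ changes sides (`IsAdapted.tilt`). The k-simplices at the height of τ are then counted by
the sum of `faceCount` over the nonempty ρ ⊆ τ (`IsAdapted.ncard_level`). The algorithm solves this
triangular system; table entries computed in different directions fit together because P is the same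
for all of them. The entry for σ itself is its k-indegree.

For the predicate, Σ is made level with every other vertex off that level, and the direction is then
tilted both ways along a direction that separates v from σ. Only v changes sides
(`isWedge_wedgeDirections`). The k-cofaces counted in the upper but not in the lower direction are
those containing v, and by cardinality the only candidate is Σ
(`IsWedge.abs_kIndegree_sub_eq_one_iff`).

For the cost, faces are treated by increasing dimension, so each recursive call finds its own faces
in the table: it asks for one diagram, does not recurse and does not sort. One indegree thus takes
2^k - 1 diagrams and one sort. In `separate`, general position leaves at most d vertices that need
an expensive correction. -/

theorem facetSign_mul_swap_of_lt (s : Finset (Pt d)) {x y : Pt d}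
    (hx : x ∈ s) (h : toLex x.ofLp < toLex y.ofLp) :
    open Classical in
    facetSign 𝔽 s x * facetSign 𝔽 (s.erase x) y
      = -(facetSign 𝔽 s y * facetSign 𝔽 (s.erase y) x) := by
  classical
  let below (t : Finset (Pt d)) (w : Pt d) : Finset (Pt d) :=
    @Finset.filter _ (fun z => toLex z.ofLp < toLex w.ofLp) (fun _ => Classical.propDecidable _) t
  -- Erasing the lower vertex x shifts the position of y by one, while erasing y leaves the position
  -- of x alone: this yields the opposite sign.
  have h1 : below s y = insert x (below (s.erase x) y) := by
    ext z
    simp only [below, Finset.mem_filter, Finset.mem_insert, Finset.mem_erase]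
    by_cases hz : z = x
    · subst hz; simp [hx, h]
    · simp [hz]
  have h2 : below (s.erase y) x = below s x := by
    ext z
    simp only [below, Finset.mem_filter, Finset.mem_erase]
    constructor
    · rintro ⟨⟨-, a⟩, b⟩; exact ⟨a, b⟩
    · rintro ⟨a, b⟩
      refine ⟨⟨?_, a⟩, b⟩
      rintro rfl
      exact lt_asymm b h
  have h3 : (below s y).card = (below (s.erase x) y).card + 1 := by
    rw [h1, Finset.card_insert_of_notMem (by simp [below])]
  change (-1 : 𝔽) ^ (below s x).card * (-1 : 𝔽) ^ (below (s.erase x) y).card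
    = -((-1 : 𝔽) ^ (below s y).card * (-1 : 𝔽) ^ (below (s.erase y) x).card)
  rw [h3, h2]
  ring

theorem facetSign_mul_swap (s : Finset (Pt d)) {x y : Pt d}
    (hx : x ∈ s) (hy : y ∈ s) (hxy : x ≠ y) :
    open Classical in
    facetSign 𝔽 s x * facetSign 𝔽 (s.erase x) y
      = -(facetSign 𝔽 s y * facetSign 𝔽 (s.erase y) x) := by
  classical
  have hne : toLex x.ofLp ≠ toLex y.ofLp := by
    intro h
    exact hxy (WithLp.ofLp_injective 2 (toLex.injective h))
  rcases lt_or_gt_of_ne hne with h | h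
  · convert facetSign_mul_swap_of_lt 𝔽 s hx h
  · have := facetSign_mul_swap_of_lt 𝔽 s hy h
    rw [eq_neg_iff_add_eq_zero] at this ⊢
    rw [add_comm]
    convert this

theorem boundary_single (s : Finset (Pt d)) (a : 𝔽) :
    boundary 𝔽 d (Finsupp.single s a) = a • simplexBoundary 𝔽 s := by
  simp [boundary]

/-- Erasing x and then y cancels against erasing y and then x, so swapping the pair is a
sign-reversing involution. -/
theorem boundary_simplexBoundary (s : Finset (Pt d)) :
    boundary 𝔽 d (simplexBoundary 𝔽 s) = 0 := by
  classical
  by_cases h : s.card ≤ 1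
  · simp [simplexBoundary, h]
  have e0 : simplexBoundary 𝔽 s = ∑ x ∈ s, Finsupp.single (s.erase x) (facetSign 𝔽 s x) := by
    unfold simplexBoundary
    rw [if_neg h]
  rw [e0, map_sum]
  simp only [boundary_single]
  -- Edges are separate: homology is unreduced, so their vertices have boundary zero and there is no
  -- inner sum.
  by_cases h2 : s.card = 2
  · refine Finset.sum_eq_zero fun x hx => ?_
    have : (s.erase x).card ≤ 1 := by rw [Finset.card_erase_of_mem hx]; omega
    simp [simplexBoundary, this]
  have e1 : ∀ x ∈ s, facetSign 𝔽 s x • simplexBoundary 𝔽 (s.erase x)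
      = ∑ y ∈ s.erase x, Finsupp.single ((s.erase x).erase y)
          (facetSign 𝔽 s x * facetSign 𝔽 (s.erase x) y) := by
    intro x hx
    have : ¬ (s.erase x).card ≤ 1 := by rw [Finset.card_erase_of_mem hx]; omega
    unfold simplexBoundary
    rw [if_neg this, Finset.smul_sum]
    refine Finset.sum_congr rfl fun y _ => ?_
    rw [Finsupp.smul_single, smul_eq_mul]
  rw [Finset.sum_congr rfl e1, Finset.sum_sigma']
  refine Finset.sum_involution (fun p _ => ⟨p.2, p.1⟩) ?_ ?_ ?_ ?_
  · rintro ⟨x, y⟩ hp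
    simp only [Finset.mem_sigma, Finset.mem_erase] at hp
    simp only
    rw [Finset.erase_right_comm, ← Finsupp.single_add]
    have := facetSign_mul_swap 𝔽 s hp.1 hp.2.2 hp.2.1.symm
    rw [Finsupp.single_eq_zero, ← eq_neg_iff_add_eq_zero]
    convert this
  · rintro ⟨x, y⟩ hp _ heq
    simp only [Finset.mem_sigma, Finset.mem_erase] at hp
    simp only [Sigma.mk.injEq] at heq
    exact hp.2.1 heq.1
  · rintro ⟨x, y⟩ hp
    simp only [Finset.mem_sigma, Finset.mem_erase] at hp ⊢
    exact ⟨hp.2.2, hp.2.1.symm, hp.1⟩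
  · rintro ⟨x, y⟩ hp
    rfl

end BoundarySquared

/-! ### Dimensions of chains, cycles and boundaries -/

section Ranks

variable (𝔽 : Type u) [Field 𝔽] {d : ℕ}

theorem finrank_chains {F : Set (Finset (Pt d))} (hF : F.Finite) (k : ℕ) :
    Module.finrank 𝔽 (chains 𝔽 F k) = {s | s ∈ F ∧ s.card = k + 1}.ncard := by
  classical
  have hfin : {s | s ∈ F ∧ s.card = k + 1}.Finite := hF.subset fun _ h => h.1
  have := hfin.fintype
  unfold chains
  rw [(Finsupp.supportedEquivFinsupp (M := 𝔽) (R := 𝔽) _).finrank_eq,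
    Module.finrank_finsupp_self, Set.ncard_eq_toFinset_card', Set.toFinset_card]

theorem finiteDimensional_chains {F : Set (Finset (Pt d))} (hF : F.Finite) (k : ℕ) :
    FiniteDimensional 𝔽 (chains 𝔽 F k) := by
  classical
  have hfin : {s | s ∈ F ∧ s.card = k + 1}.Finite := hF.subset fun _ h => h.1
  have := hfin.fintype
  unfold chains
  exact Module.Finite.equiv (Finsupp.supportedEquivFinsupp (M := 𝔽) (R := 𝔽) _).symm

theorem finiteDimensional_cycles {F : Set (Finset (Pt d))} (hF : F.Finite) (k : ℕ) :
    FiniteDimensional 𝔽 (cycles 𝔽 F k) :=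
  have := finiteDimensional_chains 𝔽 hF k
  Submodule.finiteDimensional_of_le (inf_le_left : cycles 𝔽 F k ≤ chains 𝔽 F k)

/-- Rank-nullity for the map from the cycles of F to the homology of G; its kernel consists of the
cycles of F that bound in G. -/
theorem persistentBetti_add {F G : Set (Finset (Pt d))} (h : F ⊆ G) (hF : F.Finite) (k : ℕ) :
    persistentBetti 𝔽 h k + Module.finrank 𝔽 (cycles 𝔽 F k ⊓ boundaries 𝔽 G k : Submodule 𝔽 _)
      = Module.finrank 𝔽 (cycles 𝔽 F k) := by
  have := finiteDimensional_cycles 𝔽 hF k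
  let φ := (homologyMap 𝔽 h k).comp ((boundaries 𝔽 F k).submoduleOf (cycles 𝔽 F k)).mkQ
  have hr : LinearMap.range φ = LinearMap.range (homologyMap 𝔽 h k) := by
    rw [LinearMap.range_comp, Submodule.range_mkQ, Submodule.map_top]
  have hk : LinearMap.ker φ = (boundaries 𝔽 G k).submoduleOf (cycles 𝔽 F k) := by
    ext x
    exact Submodule.Quotient.mk_eq_zero _
  have e := LinearMap.finrank_range_add_finrank_ker φ
  rw [hr, hk] at e
  rw [← e]
  unfold persistentBetti
  congr 1
  rw [Submodule.submoduleOf, ← Submodule.map_comap_subtype, Submodule.finrank_map_subtype_eq]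

theorem finrank_cycles_add_boundaries {F : Set (Finset (Pt d))} (hF : F.Finite) (k : ℕ) :
    Module.finrank 𝔽 (cycles 𝔽 F (k + 1)) + Module.finrank 𝔽 (boundaries 𝔽 F k)
      = Module.finrank 𝔽 (chains 𝔽 F (k + 1)) := by
  have := finiteDimensional_chains 𝔽 hF (k + 1)
  have e := LinearMap.finrank_range_add_finrank_ker ((boundary 𝔽 d).domRestrict (chains 𝔽 F (k + 1)))
  rw [← e, add_comm]
  congr 1
  · rw [LinearMap.range_domRestrict]; rfl
  · rw [LinearMap.ker_domRestrict]
    rw [← Submodule.finrank_map_subtype_eq, Submodule.map_comap_subtype]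
    rfl

end Ranks
theorem sum_range_ite_lt_telescope (G : ℕ → ℤ) (n j : ℕ) :
    ∑ i ∈ Finset.range n, (if i < j then G (i + 1) - G i else 0) = G (min n j) - G 0 := by
  induction n with
  | zero => simp
  | succ n ih =>
    rw [Finset.sum_range_succ, ih]
    split_ifs with h
    · rw [min_eq_left h.le, min_eq_left (Nat.succ_le_of_lt h)]; ring
    · rw [min_eq_right (by omega), min_eq_right (by omega)]; ring

theorem sum_range_ite_gt_telescope (H : ℕ → ℤ) (n i : ℕ) :
    ∑ j ∈ Finset.range n, (if i < j then H (j + 1) - H j else 0)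
      = H (max n (i + 1)) - H (i + 1) := by
  induction n with
  | zero => simp
  | succ n ih =>
    rw [Finset.sum_range_succ, ih]
    split_ifs with h
    · rw [max_eq_left (by omega), max_eq_left (by omega)]; ring
    · rw [max_eq_right (by omega), max_eq_right (by omega)]; ring

/-- The modular law for dimensions. It gives nonnegativity of the multiplicities and the bound of
one birth per simplex. -/
theorem finrank_add_le_of_sup_le {𝔽 : Type u} [Field 𝔽] {W : Type*} [AddCommGroup W] [Module 𝔽 W]
    {P Q U : Submodule 𝔽 W} [FiniteDimensional 𝔽 U] (hP : P ≤ U) (hQ : Q ≤ U) :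
    Module.finrank 𝔽 P + Module.finrank 𝔽 Q
      ≤ Module.finrank 𝔽 U + Module.finrank 𝔽 (P ⊓ Q : Submodule 𝔽 W) := by
  have := Submodule.finiteDimensional_of_le hP
  have := Submodule.finiteDimensional_of_le hQ
  rw [← Submodule.finrank_sup_add_finrank_inf_eq]
  exact Nat.add_le_add_right (Submodule.finrank_mono (sup_le hP hQ)) _

/-! ### Births and deaths in an index filtration -/

namespace IndexFiltration

variable {d : ℕ} {K : Geometry.SimplicialComplex ℝ (Pt d)} {f : Finset (Pt d) → ℝ}
variable (𝔽 : Type u) [Field 𝔽] (e : IndexFiltration K f)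

theorem finite_sublevel (m : ℕ) : (e.sublevel m).Finite :=
  (Set.finite_range fun i : Fin e.size => (e.simplex i : Finset (Pt d))).subset
    fun _ ⟨i, _, hi⟩ => ⟨i, hi⟩

theorem sublevel_zero : e.sublevel 0 = ∅ := by
  ext s; simp [sublevel]

theorem erase_mem_sublevel {s : Finset (Pt d)} {j : ℕ} (hs : s ∈ e.sublevel (j + 1))
    {x : Pt d} (hx : x ∈ s) (hcard : 2 ≤ s.card) :
    open Classical in s.erase x ∈ e.sublevel j := by
  classical
  obtain ⟨i, hi, rfl⟩ := hs
  have hne : ((e.simplex i : Finset (Pt d)).erase x).Nonempty := by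
    rw [← Finset.card_pos, Finset.card_erase_of_mem hx]; omega
  have hface := K.down_closed (e.simplex i).2 (Finset.erase_subset x _) hne
  obtain ⟨i', hi'⟩ := e.simplex.surjective ⟨_, hface⟩
  have hi'' : (e.simplex i' : Finset (Pt d)) = (e.simplex i : Finset (Pt d)).erase x := by rw [hi']
  refine ⟨i', ?_, by rw [hi'']⟩
  have : i' < i := e.face_lt i' i (by rw [hi'']; exact Finset.erase_ssubset hx)
  have := Fin.lt_def.1 this
  omega

/-- Facets enter strictly before their simplex and boundaries are cycles, so a boundary is already a
cycle one stage earlier. -/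
theorem boundaries_le_cycles (j k : ℕ) :
    boundaries 𝔽 (e.sublevel (j + 1)) k ≤ cycles 𝔽 (e.sublevel j) k := by
  classical
  unfold boundaries
  rw [Submodule.map_le_iff_le_comap, chains, Finsupp.supported_eq_span_single, Submodule.span_le]
  rintro _ ⟨s, ⟨hs, hcard⟩, rfl⟩
  change boundary 𝔽 d _ ∈ cycles 𝔽 (e.sublevel j) k
  rw [boundary_single, one_smul]
  refine ⟨?_, boundary_simplexBoundary 𝔽 s⟩
  unfold simplexBoundary
  rw [if_neg (by omega)]
  refine Submodule.sum_mem _ fun x hx => ?_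
  refine Finsupp.single_mem_supported 𝔽 _ ⟨e.erase_mem_sublevel hs hx (by omega), ?_⟩
  rw [Finset.card_erase_of_mem hx, hcard]; omega

/-- The dimension of the space of cycles of one subcomplex that bound in another one. -/
noncomputable def boundingDim (k a b : ℕ) : ℤ :=
  Module.finrank 𝔽 (cycles 𝔽 (e.sublevel a) k ⊓ boundaries 𝔽 (e.sublevel b) k : Submodule 𝔽 _)

/-- The dimension of the space of cycles. -/
noncomputable def cycleDim (k a : ℕ) : ℤ := Module.finrank 𝔽 (cycles 𝔽 (e.sublevel a) k)

/-- The dimension of the space of boundaries. -/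
noncomputable def boundaryDim (k a : ℕ) : ℤ := Module.finrank 𝔽 (boundaries 𝔽 (e.sublevel a) k)

theorem betti_eq (k : ℕ) {a b : ℕ} (h : a ≤ b) :
    e.betti 𝔽 k h = e.cycleDim 𝔽 k a - e.boundingDim 𝔽 k a b := by
  have := persistentBetti_add 𝔽 (e.sublevel_mono h) (e.finite_sublevel a) k
  unfold betti cycleDim boundingDim
  omega

theorem boundingDim_zero (k b : ℕ) : e.boundingDim 𝔽 k 0 b = 0 := by
  have : cycles 𝔽 (e.sublevel 0) k = ⊥ := by
    rw [sublevel_zero, eq_bot_iff]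
    refine inf_le_left.trans ?_
    simp [chains]
  unfold boundingDim
  rw [this]; simp

/-- The slack of one stage evaluates the end terms of both telescoping sums below. -/
theorem boundingDim_of_le (k : ℕ) {a b : ℕ} (h : b ≤ a + 1) :
    e.boundingDim 𝔽 k a b = e.boundaryDim 𝔽 k b := by
  unfold boundingDim boundaryDim
  rw [inf_eq_right.2]
  exact (boundaries_mono 𝔽 (e.sublevel_mono h) k).trans (e.boundaries_le_cycles 𝔽 a k)

/-- The cycle dimensions cancel in the alternating sum of Betti numbers. What remains is nonnegative
by the modular law, so `toNat` truncates nothing. -/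
theorem multiplicity_eq (k : ℕ) (i j : Fin e.size) :
    (e.multiplicity 𝔽 k i j : ℤ) = if (i : ℕ) < j then
      (e.boundingDim 𝔽 k (i + 1) (j + 1) - e.boundingDim 𝔽 k (i + 1) j)
        - (e.boundingDim 𝔽 k i (j + 1) - e.boundingDim 𝔽 k i j) else 0 := by
  unfold multiplicity
  split_ifs with h
  · simp only [betti_eq]
    rw [Int.toNat_of_nonneg]
    · ring
    · have := finiteDimensional_cycles 𝔽 (e.finite_sublevel (i + 1)) k
      have : FiniteDimensional 𝔽 (cycles 𝔽 (e.sublevel (i + 1)) k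
          ⊓ boundaries 𝔽 (e.sublevel (j + 1)) k : Submodule 𝔽 _) :=
        Submodule.finiteDimensional_of_le inf_le_left
      have hz := cycles_mono 𝔽 (e.sublevel_mono (Nat.le_succ i)) k
      have hb := boundaries_mono 𝔽 (e.sublevel_mono (Nat.le_succ j)) k
      have key := finrank_add_le_of_sup_le (𝔽 := 𝔽)
        (inf_le_inf_right (boundaries 𝔽 (e.sublevel (j + 1)) k) hz)
        (inf_le_inf_left (cycles 𝔽 (e.sublevel (i + 1)) k) hb)
      have hinf : (cycles 𝔽 (e.sublevel i) k ⊓ boundaries 𝔽 (e.sublevel (j + 1)) k)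
          ⊓ (cycles 𝔽 (e.sublevel (i + 1)) k ⊓ boundaries 𝔽 (e.sublevel j) k)
          = cycles 𝔽 (e.sublevel i) k ⊓ boundaries 𝔽 (e.sublevel j) k := by
        rw [inf_inf_inf_comm, inf_eq_left.2 hz, inf_eq_right.2 hb]
      rw [hinf] at key
      unfold boundingDim
      simp only [Nat.succ_eq_add_one] at key
      omega
  · simp

theorem multiplicityTop_eq (k : ℕ) (i : Fin e.size) :
    (e.multiplicityTop 𝔽 k i : ℤ) = e.cycleDim 𝔽 k (i + 1) - e.cycleDim 𝔽 k i
      - (e.boundingDim 𝔽 k (i + 1) e.size - e.boundingDim 𝔽 k i e.size) := by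
  unfold multiplicityTop
  simp only [betti_eq]
  rw [Int.toNat_of_nonneg]
  · ring
  · have := finiteDimensional_cycles 𝔽 (e.finite_sublevel (i + 1)) k
    have hz := cycles_mono 𝔽 (e.sublevel_mono (Nat.le_succ i)) k
    have key := finrank_add_le_of_sup_le (𝔽 := 𝔽) hz
      (inf_le_left (b := boundaries 𝔽 (e.sublevel e.size) k))
    rw [← inf_assoc, inf_eq_left.2 hz] at key
    unfold cycleDim boundingDim
    simp only [Nat.succ_eq_add_one] at key
    omega

/-- Telescoping over the birth index: the simplex j kills as many classes as the boundary space
gains dimensions. -/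
theorem sum_multiplicity_left (k : ℕ) (j : Fin e.size) :
    ∑ i, (e.multiplicity 𝔽 k i j : ℤ) = e.boundaryDim 𝔽 k (j + 1) - e.boundaryDim 𝔽 k j := by
  simp only [multiplicity_eq]
  have := sum_range_ite_lt_telescope
    (fun i => e.boundingDim 𝔽 k i (j + 1) - e.boundingDim 𝔽 k i j) e.size j
  rw [min_eq_right j.2.le] at this
  rw [Fin.sum_univ_eq_sum_range (fun i => if i < (j : ℕ) then
      (e.boundingDim 𝔽 k (i + 1) (j + 1) - e.boundingDim 𝔽 k (i + 1) j)
        - (e.boundingDim 𝔽 k i (j + 1) - e.boundingDim 𝔽 k i j) else 0) e.size, this,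
    boundingDim_of_le _ _ _ le_rfl, boundingDim_of_le _ _ _ (Nat.le_succ _)]
  simp [boundingDim_zero]

/-- Telescoping over the death index: the term at the end of the filtration cancels against
`multiplicityTop`, and the other end vanishes because both boundary spaces agree there. -/
theorem sum_multiplicity_right (k : ℕ) (i : Fin e.size) :
    ∑ j, (e.multiplicity 𝔽 k i j : ℤ) + e.multiplicityTop 𝔽 k i
      = e.cycleDim 𝔽 k (i + 1) - e.cycleDim 𝔽 k i := by
  simp only [multiplicity_eq, multiplicityTop_eq]
  have := sum_range_ite_gt_telescope
    (fun j => e.boundingDim 𝔽 k (i + 1) j - e.boundingDim 𝔽 k i j) e.size i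
  rw [max_eq_left i.2] at this
  have hs : ∑ j : Fin e.size, (if (i : ℕ) < j then
      (e.boundingDim 𝔽 k (i + 1) (j + 1) - e.boundingDim 𝔽 k (i + 1) j)
        - (e.boundingDim 𝔽 k i (j + 1) - e.boundingDim 𝔽 k i j) else 0)
      = ∑ j ∈ Finset.range e.size, (if (i : ℕ) < j then
        (e.boundingDim 𝔽 k (i + 1) (j + 1) - e.boundingDim 𝔽 k i (j + 1))
        - (e.boundingDim 𝔽 k (i + 1) j - e.boundingDim 𝔽 k i j) else 0) := by
    rw [← Fin.sum_univ_eq_sum_range (fun j => if (i : ℕ) < j then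
        (e.boundingDim 𝔽 k (i + 1) (j + 1) - e.boundingDim 𝔽 k i (j + 1))
        - (e.boundingDim 𝔽 k (i + 1) j - e.boundingDim 𝔽 k i j) else 0)]
    refine Finset.sum_congr rfl fun j _ => ?_
    split_ifs <;> ring
  rw [hs, this, boundingDim_of_le _ _ _ (Nat.le_succ _), boundingDim_of_le _ _ _ le_rfl]
  ring

theorem sublevel_succ (i : Fin e.size) :
    e.sublevel (i + 1) = insert (e.simplex i : Finset (Pt d)) (e.sublevel i) := by
  ext s
  simp only [sublevel, Set.mem_ofPred_eq, Set.mem_insert_iff]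
  constructor
  · rintro ⟨j, hj, rfl⟩
    rcases Nat.lt_succ_iff_lt_or_eq.1 hj with h | h
    · exact Or.inr ⟨j, h, rfl⟩
    · left; rw [Fin.ext h]
  · rintro (rfl | ⟨j, hj, rfl⟩)
    · exact ⟨i, Nat.lt_succ_self _, rfl⟩
    · exact ⟨j, by omega, rfl⟩

theorem simplex_notMem_sublevel (i : Fin e.size) :
    (e.simplex i : Finset (Pt d)) ∉ e.sublevel i := by
  rintro ⟨j, hj, h⟩
  have := e.simplex.injective (Subtype.ext h)
  subst this
  omega

theorem finrank_chains_succ (k : ℕ) (i : Fin e.size) :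
    (Module.finrank 𝔽 (chains 𝔽 (e.sublevel (i + 1)) k) : ℤ)
        - Module.finrank 𝔽 (chains 𝔽 (e.sublevel i) k)
      = if (e.simplex i : Finset (Pt d)).card = k + 1 then 1 else 0 := by
  rw [finrank_chains 𝔽 (e.finite_sublevel _), finrank_chains 𝔽 (e.finite_sublevel _),
    sublevel_succ]
  split_ifs with h
  · have : {s | s ∈ insert (e.simplex i : Finset (Pt d)) (e.sublevel i) ∧ s.card = k + 1}
        = insert (e.simplex i : Finset (Pt d)) {s | s ∈ e.sublevel i ∧ s.card = k + 1} := by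
      ext s
      simp only [Set.mem_insert_iff, Set.mem_ofPred_eq]
      constructor
      · rintro ⟨rfl | h1, h2⟩
        · exact Or.inl rfl
        · exact Or.inr ⟨h1, h2⟩
      · rintro (rfl | ⟨h1, h2⟩)
        · exact ⟨Or.inl rfl, h⟩
        · exact ⟨Or.inr h1, h2⟩
    rw [this, Set.ncard_insert_of_notMem (fun hm => e.simplex_notMem_sublevel i hm.1)
      ((e.finite_sublevel i).subset fun _ hs => hs.1)]
    push_cast; ring
  · have : {s | s ∈ insert (e.simplex i : Finset (Pt d)) (e.sublevel i) ∧ s.card = k + 1}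
        = {s | s ∈ e.sublevel i ∧ s.card = k + 1} := by
      ext s
      simp only [Set.mem_insert_iff, Set.mem_ofPred_eq]
      constructor
      · rintro ⟨rfl | h1, h2⟩
        · exact absurd h2 h
        · exact ⟨h1, h2⟩
      · rintro ⟨h1, h2⟩
        exact ⟨Or.inr h1, h2⟩
    rw [this]; ring

/-- The difference of rank-nullity at two consecutive stages: every simplex causes exactly one birth
or one death. -/
theorem cycleDim_succ_sub_add (k : ℕ) (i : Fin e.size) :
    (e.boundaryDim 𝔽 k (i + 1) - e.boundaryDim 𝔽 k i)
        + (e.cycleDim 𝔽 (k + 1) (i + 1) - e.cycleDim 𝔽 (k + 1) i)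
      = if (e.simplex i : Finset (Pt d)).card = k + 2 then 1 else 0 := by
  rw [← e.finrank_chains_succ 𝔽 (k + 1) i]
  have h1 := finrank_cycles_add_boundaries 𝔽 (e.finite_sublevel i) k
  have h2 := finrank_cycles_add_boundaries 𝔽 (e.finite_sublevel (i + 1)) k
  unfold cycleDim boundaryDim
  omega

/-- The old cycles are the new cycles supported on old chains, so their codimension is at most that
of the old chains. -/
theorem cycleDim_succ_sub_le (k : ℕ) (i : Fin e.size) :
    e.cycleDim 𝔽 k (i + 1) - e.cycleDim 𝔽 k i
      ≤ if (e.simplex i : Finset (Pt d)).card = k + 1 then 1 else 0 := by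
  rw [← e.finrank_chains_succ 𝔽 k i]
  have := finiteDimensional_chains 𝔽 (e.finite_sublevel (i + 1)) k
  have hc := chains_mono 𝔽 (e.sublevel_mono (Nat.le_succ i)) k
  have key := finrank_add_le_of_sup_le (𝔽 := 𝔽) hc
    (inf_le_left (b := LinearMap.ker (boundary 𝔽 d)))
  rw [← inf_assoc, inf_eq_left.2 hc] at key
  unfold cycleDim cycles
  simp only [Nat.succ_eq_add_one] at key
  omega

theorem sum_simplex_ite (p : Finset (Pt d) → Prop) [DecidablePred p] :
    ∑ i : Fin e.size, (if p (e.simplex i) then (1 : ℤ) else 0) = {s | s ∈ K.faces ∧ p s}.ncard := by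
  classical
  rw [Finset.sum_boole]
  congr 1
  rw [← Set.ncard_coe_finset, ← Set.ncard_image_of_injective _
    (f := fun i => (e.simplex i : Finset (Pt d))) (fun i j h => e.simplex.injective (Subtype.ext h))]
  congr 1
  ext s
  simp only [Set.mem_image, Finset.coe_filter, Finset.mem_univ, true_and, Set.mem_ofPred_eq]
  constructor
  · rintro ⟨i, hi, rfl⟩; exact ⟨(e.simplex i).2, hi⟩
  · rintro ⟨hs, hp⟩
    obtain ⟨i, hi⟩ := e.simplex.surjective ⟨s, hs⟩
    exact ⟨i, by rw [hi]; exact hp, by rw [hi]⟩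

theorem countP_apd (k : ℕ) (p : ℝ × EReal → Prop) [DecidablePred p] :
    ((e.apd 𝔽 k).countP p : ℤ) = ∑ i : Fin e.size,
      ((∑ j : Fin e.size, if p (f (e.simplex i), ((f (e.simplex j) : ℝ) : EReal))
          then (e.multiplicity 𝔽 k i j : ℤ) else 0)
        + if p (f (e.simplex i), ⊤) then (e.multiplicityTop 𝔽 k i : ℤ) else 0) := by
  have hr : ∀ (n : ℕ) (x : ℝ × EReal),
      (Multiset.replicate n x).countP p = if p x then n else 0 := by
    intro n x
    split_ifs with h
    · exact (Multiset.countP_eq_card.2 fun a ha => by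
        rw [Multiset.eq_of_mem_replicate ha]; exact h).trans (Multiset.card_replicate _ _)
    · exact Multiset.countP_eq_zero.2 fun a ha => by
        rw [Multiset.eq_of_mem_replicate ha]; exact h
  unfold apd
  rw [← Multiset.coe_countPAddMonoidHom, map_sum]
  push_cast
  refine Finset.sum_congr rfl fun i _ => ?_
  rw [map_add, map_sum]
  simp only [Multiset.coe_countPAddMonoidHom, hr]
  push_cast
  rfl

/-- Grouping deaths by the dying simplex and births by the creating one turns both counts into sums
over simplices; each (k+1)-simplex at height c then contributes one. -/
theorem countP_death_add_countP_birth (k : ℕ) (c : ℝ) :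
    open Classical in
    (((e.apd 𝔽 k).countP (fun q => q.2 = (c : EReal)) : ℕ) : ℤ)
        + ((e.apd 𝔽 (k + 1)).countP (fun q => q.1 = c) : ℕ)
      = {s | s ∈ K.faces ∧ s.card = k + 2 ∧ f s = c}.ncard := by
  classical
  rw [countP_apd, countP_apd]
  have h1 : ∑ i : Fin e.size,
      ((∑ j : Fin e.size, if ((f (e.simplex j) : ℝ) : EReal) = (c : EReal)
          then (e.multiplicity 𝔽 k i j : ℤ) else 0)
        + if (⊤ : EReal) = (c : EReal) then (e.multiplicityTop 𝔽 k i : ℤ) else 0)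
      = ∑ j : Fin e.size, if f (e.simplex j) = c then
          e.boundaryDim 𝔽 k (j + 1) - e.boundaryDim 𝔽 k j else 0 := by
    -- Points at infinity are no deaths at a finite height.
    simp only [EReal.coe_eq_coe_iff, (EReal.coe_ne_top c).symm, if_false, add_zero]
    rw [Finset.sum_comm]
    refine Finset.sum_congr rfl fun j _ => ?_
    split_ifs
    · exact e.sum_multiplicity_left 𝔽 k j
    · simp
  have h2 : ∑ i : Fin e.size,
      ((∑ j : Fin e.size, if f (e.simplex i) = c
          then (e.multiplicity 𝔽 (k + 1) i j : ℤ) else 0)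
        + if f (e.simplex i) = c then (e.multiplicityTop 𝔽 (k + 1) i : ℤ) else 0)
      = ∑ i : Fin e.size, if f (e.simplex i) = c then
          e.cycleDim 𝔽 (k + 1) (i + 1) - e.cycleDim 𝔽 (k + 1) i else 0 := by
    refine Finset.sum_congr rfl fun i _ => ?_
    split_ifs
    · exact e.sum_multiplicity_right 𝔽 (k + 1) i
    · simp
  simp only at h1 h2 ⊢
  rw [h1, h2, ← Finset.sum_add_distrib, ← e.sum_simplex_ite]
  refine Finset.sum_congr rfl fun i _ => ?_
  have := e.cycleDim_succ_sub_add 𝔽 k i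
  by_cases h : f (e.simplex i) = c
  · simp only [h, if_true, and_true, this]
  · simp [h]

/-- Each k-simplex gives at most one birth. This bounds the time for scanning a diagram. -/
theorem card_apd_le (k : ℕ) : (e.apd 𝔽 k).card ≤ simplexCount K k := by
  classical
  have h := e.countP_apd 𝔽 k (fun _ => True)
  rw [Multiset.countP_eq_card.2 fun _ _ => trivial] at h
  simp only [if_true, e.sum_multiplicity_right 𝔽] at h
  have := Finset.sum_le_sum fun i (_ : i ∈ Finset.univ) => e.cycleDim_succ_sub_le 𝔽 k i
  rw [← h, e.sum_simplex_ite (fun s => s.card = k + 1)] at this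
  exact_mod_cast this

end IndexFiltration
-- Values and costs of the elementary operations
section CostLemmas

variable {α β : Type}

@[simp] theorem bind_val (x : Cost α) (f : α → Cost β) : (x >>= f).val = (f x.val).val := rfl
@[simp] theorem bind_steps (x : Cost α) (f : α → Cost β) :
    (x >>= f).steps = x.steps + (f x.val).steps := rfl
@[simp] theorem bind_diagrams (x : Cost α) (f : α → Cost β) :
    (x >>= f).diagrams = x.diagrams + (f x.val).diagrams := rfl
@[simp] theorem pure_val (a : α) : (pure a : Cost α).val = a := rfl
@[simp] theorem pure_steps (a : α) : (pure a : Cost α).steps = 0 := rfl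
@[simp] theorem pure_diagrams (a : α) : (pure a : Cost α).diagrams = 0 := rfl
@[simp] theorem op_val (n : ℕ) (a : α) : (op n a).val = a := rfl
@[simp] theorem op_steps (n : ℕ) (a : α) : (op n a).steps = n := rfl
@[simp] theorem op_diagrams (n : ℕ) (a : α) : (op n a).diagrams = 0 := rfl

end CostLemmas

variable {d : ℕ}

@[simp] theorem dot_val (x y : Pt d) : (dot x y).val = inner ℝ x y := rfl
@[simp] theorem dot_steps (x y : Pt d) : (dot x y).steps = 2 * d := rfl
@[simp] theorem dot_diagrams (x y : Pt d) : (dot x y).diagrams = 0 := rfl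
@[simp] theorem sub_val (x y : Pt d) : (sub x y).val = x - y := rfl
@[simp] theorem sub_steps (x y : Pt d) : (sub x y).steps = d := rfl
@[simp] theorem sub_diagrams (x y : Pt d) : (sub x y).diagrams = 0 := rfl
@[simp] theorem axpy_val (a : ℝ) (x y : Pt d) : (axpy a x y).val = y + a • x := rfl
@[simp] theorem axpy_steps (a : ℝ) (x y : Pt d) : (axpy a x y).steps = 2 * d := rfl
@[simp] theorem axpy_diagrams (a : ℝ) (x y : Pt d) : (axpy a x y).diagrams = 0 := rfl
@[simp] theorem toUnit_val (x : Pt d) : (toUnit x).val = ‖x‖⁻¹ • x := rfl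
@[simp] theorem toUnit_steps (x : Pt d) : (toUnit x).steps = 3 * d + 2 := rfl
@[simp] theorem toUnit_diagrams (x : Pt d) : (toUnit x).diagrams = 0 := rfl
@[simp] theorem query_val (O : Pt d → Diagram) (s : Pt d) : (query O s).val = O s := rfl
@[simp] theorem query_steps (O : Pt d → Diagram) (s : Pt d) : (query O s).steps = d := rfl
@[simp] theorem query_diagrams (O : Pt d → Diagram) (s : Pt d) : (query O s).diagrams = 1 := rfl

/-- The span of the vectors in a list. -/
abbrev listSpan (B : List (Pt d)) : Submodule ℝ (Pt d) := Submodule.span ℝ {x | x ∈ B}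

/-- The vectors in the list are pairwise orthogonal. -/
abbrev Orthog (B : List (Pt d)) : Prop := B.Pairwise fun x y => inner ℝ x y = 0

theorem listSpan_cons (b : Pt d) (B : List (Pt d)) :
    listSpan (b :: B) = Submodule.span ℝ {b} ⊔ listSpan B := by
  have : {x | x ∈ b :: B} = {b} ∪ {x | x ∈ B} := by ext; simp
  rw [listSpan, this, Submodule.span_union]

theorem inner_eq_zero_of_mem_listSpan {B : List (Pt d)} {s x : Pt d}
    (h : ∀ b ∈ B, inner ℝ s b = 0) (hx : x ∈ listSpan B) : inner ℝ s x = 0 := by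
  induction hx using Submodule.span_induction with
  | mem x hx => exact h x hx
  | zero => simp
  | add x y _ _ hx hy => rw [inner_add_right, hx, hy, add_zero]
  | smul a x _ hx => rw [inner_smul_right, hx, mul_zero]

/-! ### Orthogonal projection -/

section Residual

@[simp] theorem residual_steps (B : List (Pt d)) (y : Pt d) :
    (residual B y).steps = d + B.length * (6 * d + 2) := by
  induction B generalizing y with
  | nil => simp [residual]
  | cons b B ih => simp [residual, ih]; ring

@[simp] theorem residual_diagrams (B : List (Pt d)) (y : Pt d) :
    (residual B y).diagrams = 0 := by
  induction B generalizing y with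
  | nil => simp [residual]
  | cons b B ih => simp [residual, ih]

theorem sub_residual_mem (B : List (Pt d)) (y : Pt d) : y - (residual B y).val ∈ listSpan B := by
  induction B generalizing y with
  | nil => simp [residual]
  | cons b B ih =>
    simp only [residual, bind_val, dot_val, op_val, axpy_val]
    generalize -(inner ℝ y b / inner ℝ b b) = a
    have h := ih (y + a • b)
    rw [listSpan_cons]
    have : y - (residual B (y + a • b)).val
        = (-a) • b + (y + a • b - (residual B (y + a • b)).val) := by
      module
    rw [this]
    exact Submodule.add_mem_sup (Submodule.smul_mem _ _ (Submodule.mem_span_singleton_self b)) h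

/-- After the component along b is removed, only vectors orthogonal to b are subtracted, so
orthogonality to b survives. -/
theorem inner_residual_eq_zero {B : List (Pt d)} (hB : Orthog B) (y : Pt d) :
    ∀ b ∈ B, inner ℝ (residual B y).val b = 0 := by
  induction B generalizing y with
  | nil => simp
  | cons b B ih =>
    simp only [residual, bind_val, dot_val, op_val, axpy_val]
    set a := -(inner ℝ y b / inner ℝ b b)
    obtain ⟨h1, h2⟩ := List.pairwise_cons.1 hB
    intro x hx
    rcases List.mem_cons.1 hx with rfl | hx
    · have h3 : inner ℝ x (y + a • x - (residual B (y + a • x)).val) = 0 :=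
        inner_eq_zero_of_mem_listSpan h1 (sub_residual_mem B _)
      rw [inner_sub_right, inner_add_right, inner_smul_right, real_inner_comm y x] at h3
      rw [real_inner_comm]
      have h4 : inner ℝ y x + a * inner ℝ x x = 0 := by
        -- The list may contain zero vectors; the quotient is then 0 / 0 = 0 and nothing is
        -- subtracted.
        by_cases hz : x = 0
        · simp [hz]
        · have : inner ℝ x x ≠ 0 := by simpa using hz
          simp only [a]
          field_simp
          ring
      linarith
    · exact ih h2 _ x hx

theorem inner_residual_of_mem_listSpan {B : List (Pt d)} (hB : Orthog B) (y : Pt d) {x : Pt d}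
    (hx : x ∈ listSpan B) : inner ℝ (residual B y).val x = 0 :=
  inner_eq_zero_of_mem_listSpan (inner_residual_eq_zero hB y) hx

theorem inner_residual_self {B : List (Pt d)} (hB : Orthog B) (y : Pt d) :
    inner ℝ (residual B y).val y = inner ℝ (residual B y).val (residual B y).val := by
  have := inner_residual_of_mem_listSpan hB y (sub_residual_mem B y)
  rw [inner_sub_right] at this
  linarith

theorem residual_eq_zero_iff {B : List (Pt d)} (hB : Orthog B) (y : Pt d) :
    (residual B y).val = 0 ↔ y ∈ listSpan B := by
  constructor
  · intro h
    have := sub_residual_mem B y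
    rwa [h, sub_zero] at this
  · intro h
    rw [← inner_self_eq_zero (𝕜 := ℝ), ← inner_residual_self hB]
    exact inner_residual_of_mem_listSpan hB y h

theorem norm_residual_le {B : List (Pt d)} (hB : Orthog B) (y : Pt d) :
    ‖(residual B y).val‖ ≤ ‖y‖ := by
  set r := (residual B y).val with hr
  by_cases h : r = 0
  · rw [h]; simp
  have h1 := inner_residual_self hB y
  rw [← hr, real_inner_self_eq_norm_sq] at h1
  have h2 := real_inner_le_norm r y
  have h3 : 0 < ‖r‖ := norm_pos_iff.2 h
  nlinarith

theorem orthog_residual_cons {B : List (Pt d)} (hB : Orthog B) (y : Pt d) :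
    Orthog ((residual B y).val :: B) :=
  List.pairwise_cons.2 ⟨inner_residual_eq_zero hB y, hB⟩

theorem listSpan_residual_cons (B : List (Pt d)) (y : Pt d) :
    listSpan ((residual B y).val :: B) = Submodule.span ℝ {y} ⊔ listSpan B := by
  have h := sub_residual_mem B y
  rw [listSpan_cons]
  set r := (residual B y).val
  apply le_antisymm
  · refine sup_le ?_ le_sup_right
    rw [Submodule.span_singleton_le_iff_mem]
    have : r = y - (y - r) := by abel
    rw [this]
    exact Submodule.sub_mem _ (Submodule.mem_sup_left (Submodule.mem_span_singleton_self y))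
      (Submodule.mem_sup_right h)
  · refine sup_le ?_ le_sup_right
    rw [Submodule.span_singleton_le_iff_mem]
    have : y = r + (y - r) := by abel
    rw [this]
    exact Submodule.add_mem_sup (Submodule.mem_span_singleton_self r) h

end Residual

/-! ### Gram-Schmidt orthogonalization -/

section GramSchmidt

theorem orthog_gramSchmidtFrom (w : Pt d) (ys : List (Pt d)) {B : List (Pt d)} (hB : Orthog B) :
    Orthog (gramSchmidtFrom w B ys).val := by
  induction ys generalizing B with
  | nil => simpa [gramSchmidtFrom] using hB
  | cons y ys ih =>
    simp only [gramSchmidtFrom, bind_val, sub_val]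
    exact ih (orthog_residual_cons hB _)

theorem listSpan_gramSchmidtFrom (w : Pt d) (ys B : List (Pt d)) :
    listSpan (gramSchmidtFrom w B ys).val
      = listSpan B ⊔ Submodule.span ℝ ((fun y => y - w) '' {y | y ∈ ys}) := by
  induction ys generalizing B with
  | nil => simp [gramSchmidtFrom]
  | cons y ys ih =>
    simp only [gramSchmidtFrom, bind_val, sub_val]
    rw [ih, listSpan_residual_cons]
    have : {x | x ∈ y :: ys} = {y} ∪ {x | x ∈ ys} := by ext; simp
    rw [this, Set.image_union, Submodule.span_union, Set.image_singleton, ← sup_assoc,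
      sup_comm (listSpan B)]

theorem length_gramSchmidtFrom (w : Pt d) (ys B : List (Pt d)) :
    (gramSchmidtFrom w B ys).val.length = B.length + ys.length := by
  induction ys generalizing B with
  | nil => simp [gramSchmidtFrom]
  | cons y ys ih =>
    simp only [gramSchmidtFrom, bind_val, sub_val]
    rw [ih]; simp; omega

@[simp] theorem gramSchmidtFrom_diagrams (w : Pt d) (ys B : List (Pt d)) :
    (gramSchmidtFrom w B ys).diagrams = 0 := by
  induction ys generalizing B with
  | nil => simp [gramSchmidtFrom]
  | cons y ys ih => simp [gramSchmidtFrom, ih]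

theorem gramSchmidtFrom_steps_le (w : Pt d) (ys B : List (Pt d)) :
    (gramSchmidtFrom w B ys).steps
      ≤ ys.length * (2 * d + (B.length + ys.length) * (6 * d + 2)) := by
  induction ys generalizing B with
  | nil => simp [gramSchmidtFrom]
  | cons y ys ih =>
    simp only [gramSchmidtFrom, bind_steps, sub_steps, residual_steps, sub_val]
    refine (Nat.add_le_add_left (Nat.add_le_add_left (ih _) _) _).trans ?_
    simp only [List.length_cons]
    nlinarith [Nat.zero_le (6 * d + 2), Nat.zero_le ys.length]

end GramSchmidt

/-! ### A unit vector orthogonal to fewer than d vectors -/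

section OrthogonalDirection

@[simp] theorem firstResidual_diagrams (B ys : List (Pt d)) :
    (firstResidual B ys).diagrams = 0 := by
  induction ys with
  | nil => simp [firstResidual]
  | cons y ys ih =>
    simp only [firstResidual, bind_diagrams, residual_diagrams, dot_diagrams, op_diagrams]
    split_ifs <;> simp [ih]

theorem firstResidual_steps_le (B ys : List (Pt d)) :
    (firstResidual B ys).steps
      ≤ ys.length * (3 * d + 1 + B.length * (6 * d + 2)) + (3 * d + 2) := by
  induction ys with
  | nil => simp [firstResidual]
  | cons y ys ih =>
    simp only [firstResidual, bind_steps, residual_steps, dot_steps, op_steps, List.length_cons]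
    split_ifs
    · nlinarith
    · simp only [toUnit_steps]; nlinarith [Nat.zero_le (ys.length * (3 * d + 1 + B.length * (6 * d + 2)))]

theorem norm_toUnit {x : Pt d} (hx : x ≠ 0) : ‖(toUnit x).val‖ = 1 := by
  rw [toUnit_val, norm_smul, norm_inv, norm_norm, inv_mul_cancel₀ (norm_ne_zero_iff.2 hx)]

theorem firstResidual_spec {B : List (Pt d)} (hB : Orthog B) (ys : List (Pt d))
    (h : ∃ y ∈ ys, y ∉ listSpan B) :
    ‖(firstResidual B ys).val‖ = 1 ∧ ∀ x ∈ listSpan B, inner ℝ (firstResidual B ys).val x = 0 := by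
  induction ys with
  | nil => simp at h
  | cons y ys ih =>
    by_cases hz : (residual B y).val = 0
    · have e : (firstResidual B (y :: ys)).val = (firstResidual B ys).val := by
        simp [firstResidual, hz]
      rw [e]
      refine ih ?_
      rw [residual_eq_zero_iff hB] at hz
      obtain ⟨y', hy', hn⟩ := h
      rcases List.mem_cons.1 hy' with rfl | hy'
      · exact absurd hz hn
      · exact ⟨y', hy', hn⟩
    · have e : (firstResidual B (y :: ys)).val = (toUnit (residual B y).val).val := by
        simp [firstResidual, hz]
      rw [e]
      refine ⟨norm_toUnit hz, fun x hx => ?_⟩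
      rw [toUnit_val, inner_smul_left, inner_residual_of_mem_listSpan hB y hx, mul_zero]

theorem finrank_listSpan_le (B : List (Pt d)) : Module.finrank ℝ (listSpan B) ≤ B.length := by
  classical
  have h : {x | x ∈ B} = ((B.toFinset : Finset (Pt d)) : Set (Pt d)) := by ext; simp
  unfold listSpan
  rw [h]
  exact (finrank_span_finset_le_card _).trans B.toFinset_card_le

/-- Fewer than d vectors do not span, so some standard basis vector has a nonzero residual. -/
theorem orthogonalDirection_spec {B : List (Pt d)} (hB : Orthog B) (hd : B.length < d) :
    ‖(orthogonalDirection B).val‖ = 1 ∧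
      ∀ x ∈ listSpan B, inner ℝ (orthogonalDirection B).val x = 0 := by
  refine firstResidual_spec hB _ ?_
  by_contra! hc
  have htop : listSpan B = ⊤ := by
    rw [eq_top_iff, ← (EuclideanSpace.basisFun (Fin d) ℝ).toBasis.span_eq, Submodule.span_le]
    rintro _ ⟨i, rfl⟩
    refine hc _ ?_
    simp only [List.mem_map, List.mem_finRange, true_and]
    exact ⟨i, by simp⟩
  have := finrank_listSpan_le B
  rw [htop, finrank_top, finrank_euclideanSpace_fin] at this
  omega

theorem orthogonalDirection_steps_le (B : List (Pt d)) :
    (orthogonalDirection B).steps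
      ≤ d * (3 * d + 1 + B.length * (6 * d + 2)) + (3 * d + 2) := by
  unfold orthogonalDirection
  refine (firstResidual_steps_le _ _).trans ?_
  simp

@[simp] theorem orthogonalDirection_diagrams (B : List (Pt d)) :
    (orthogonalDirection B).diagrams = 0 := by
  simp [orthogonalDirection]

end OrthogonalDirection

/-! ### Directions with prescribed heights -/

section DirectionAbove

@[simp] theorem raise_diagrams (w : Pt d) (xs B : List (Pt d)) (s : Pt d) :
    (raise w B s xs).diagrams = 0 := by
  induction xs generalizing B s with
  | nil => simp [raise]
  | cons y ys ih => simp [raise, ih]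

theorem raise_steps_le (w : Pt d) (xs B : List (Pt d)) (s : Pt d) :
    (raise w B s xs).steps
      ≤ xs.length * (8 * d + 2 + (B.length + xs.length) * (6 * d + 2)) := by
  induction xs generalizing B s with
  | nil => simp [raise]
  | cons y ys ih =>
    simp only [raise, bind_steps, sub_steps, residual_steps, sub_val, dot_steps, op_steps,
      axpy_steps]
    refine (Nat.add_le_add_left (Nat.add_le_add_left (Nat.add_le_add_left (Nat.add_le_add_left
      (Nat.add_le_add_left (Nat.add_le_add_left (ih _ _) _) _) _) _) _) _).trans ?_
    simp only [List.length_cons]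
    nlinarith [Nat.zero_le (6 * d + 2), Nat.zero_le ys.length]

theorem inner_raise_of_mem (w : Pt d) (xs : List (Pt d)) {B : List (Pt d)} (hB : Orthog B)
    (s : Pt d) {x : Pt d} (hx : x ∈ listSpan B) :
    inner ℝ (raise w B s xs).val x = inner ℝ s x := by
  induction xs generalizing B s with
  | nil => simp [raise]
  | cons y ys ih =>
    simp only [raise, bind_val, sub_val, dot_val, op_val, axpy_val]
    rw [ih (orthog_residual_cons hB _), inner_add_left, inner_smul_left,
      inner_residual_of_mem_listSpan hB _ hx, mul_zero, add_zero]
    rw [listSpan_cons]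
    exact Submodule.mem_sup_right hx

/-- The residual r of z = x - w satisfies ⟨r, z⟩ = ⟨r, r⟩, so the chosen coefficient brings x to
height 1 above w. Later corrections are orthogonal to z. The set S records the points whose
differences span B; independence makes r nonzero. -/
theorem inner_raise_eq_one {w : Pt d} {xs : List (Pt d)} {B : List (Pt d)} (hB : Orthog B)
    (s : Pt d) {S : Set (Pt d)} (hS : listSpan B = Submodule.span ℝ ((fun x => x - w) '' S))
    (hind : LinearIndepOn ℝ (fun x : Pt d => x - w) (S ∪ {x | x ∈ xs}))
    (hnd : xs.Nodup) (hdisj : ∀ x ∈ xs, x ∉ S) :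
    ∀ x ∈ xs, inner ℝ (raise w B s xs).val (x - w) = 1 := by
  induction xs generalizing B s S with
  | nil => simp
  | cons y ys ih =>
    simp only [raise, bind_val, sub_val, dot_val, op_val, axpy_val]
    have hset : S ∪ {x | x ∈ y :: ys} = insert y S ∪ {x | x ∈ ys} := by
      ext; simp only [Set.mem_union, Set.mem_ofPred_eq, List.mem_cons, Set.mem_insert_iff]; tauto
    rw [hset] at hind
    obtain ⟨hy, hnd'⟩ := List.nodup_cons.1 hnd
    have hyS : y - w ∉ listSpan B := by
      rw [hS]
      have h1 : LinearIndepOn ℝ (fun x : Pt d => x - w) (insert y S) :=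
        hind.mono Set.subset_union_left
      exact ((linearIndepOn_insert (hdisj y (by simp))).1 h1).2
    have hr : (residual B (y - w)).val ≠ 0 := by rwa [ne_eq, residual_eq_zero_iff hB]
    have hspan := listSpan_residual_cons B (y - w)
    intro x hx
    rcases List.mem_cons.1 hx with rfl | hx
    · rw [inner_raise_of_mem _ _ (orthog_residual_cons hB _), inner_add_left, inner_smul_left,
        inner_residual_self hB]
      · have : inner ℝ (residual B (x - w)).val (residual B (x - w)).val ≠ 0 := by simpa using hr
        simp only [conj_trivial]
        field_simp
        ring
      · rw [hspan]
        exact Submodule.mem_sup_left (Submodule.mem_span_singleton_self _)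
    · refine ih (orthog_residual_cons hB _) _ (S := insert y S) ?_ hind hnd' ?_ x hx
      · rw [hspan, hS, Set.image_insert_eq, Submodule.span_insert]
      · rintro x' hx' (rfl | hm)
        · exact hy hx'
        · exact hdisj x' (List.mem_cons_of_mem _ hx') hm

/-- The points in the list are affinely independent. -/
abbrev ListAffineIndep (l : List (Pt d)) : Prop :=
  AffineIndependent ℝ ((↑) : {x | x ∈ l} → Pt d)

theorem ListAffineIndep.linearIndepOn {w : Pt d} {l : List (Pt d)} (h : ListAffineIndep (w :: l))
    (hw : w ∉ l) : LinearIndepOn ℝ (fun x : Pt d => x - w) {x | x ∈ l} := by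
  have h1 := (affineIndependent_set_iff_linearIndependent_vsub ℝ
    (s := {x | x ∈ w :: l}) (p₁ := w) (by simp)).1 h
  have h2 : {x | x ∈ w :: l} \ {w} = {x | x ∈ l} := by
    ext x
    simp only [Set.mem_sdiff, Set.mem_ofPred_eq, List.mem_cons, Set.mem_singleton_iff]
    constructor
    · rintro ⟨rfl | h, h'⟩
      · exact absurd rfl h'
      · exact h
    · intro h; exact ⟨Or.inr h, fun e => hw (e ▸ h)⟩
  rw [h2] at h1
  exact (linearIndepOn_iff_image (Function.Injective.injOn (sub_left_injective))).2 h1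

theorem directionAbove_spec {w : Pt d} {ws X : List (Pt d)} (hX : X ≠ [])
    (hnd : (w :: ws ++ X).Nodup) (hind : ListAffineIndep (w :: ws ++ X)) :
    ‖(directionAbove (w :: ws) X).val‖ = 1 ∧
      (∀ x ∈ w :: ws, inner ℝ (directionAbove (w :: ws) X).val x
        = inner ℝ (directionAbove (w :: ws) X).val w) ∧
      (∀ x ∈ X, inner ℝ (directionAbove (w :: ws) X).val w
        < inner ℝ (directionAbove (w :: ws) X).val x) := by
  simp only [directionAbove, bind_val]
  set B := (gramSchmidtFrom w [] ws).val with hBdef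
  have hB : Orthog B := orthog_gramSchmidtFrom w ws List.Pairwise.nil
  have hspan : listSpan B = Submodule.span ℝ ((fun y => y - w) '' {y | y ∈ ws}) := by
    rw [hBdef, listSpan_gramSchmidtFrom, show listSpan ([] : List (Pt d)) = ⊥ by simp [listSpan],
      bot_sup_eq]
  rw [List.cons_append] at hnd hind
  obtain ⟨hw, hnd'⟩ := List.nodup_cons.1 hnd
  rw [List.nodup_append] at hnd'
  have hli := hind.linearIndepOn hw
  have hset : {x | x ∈ ws ++ X} = {x | x ∈ ws} ∪ {x | x ∈ X} := by ext; simp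
  rw [hset] at hli
  have h1 := inner_raise_eq_one hB 0 hspan hli hnd'.2.1
    (fun x hx hx' => hnd'.2.2 x hx' x hx rfl)
  set s := (raise w B 0 X).val with hs
  obtain ⟨x0, hx0⟩ := List.exists_mem_of_ne_nil X hX
  have hs0 : s ≠ 0 := by
    intro h0
    have := h1 x0 hx0
    rw [h0] at this
    simp at this
  refine ⟨norm_toUnit hs0, ?_, ?_⟩
  · intro x hx
    rw [toUnit_val, ← sub_eq_zero, ← inner_sub_right, inner_smul_left]
    rcases List.mem_cons.1 hx with rfl | hx
    · simp
    · have : x - w ∈ listSpan B := by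
        rw [hspan]
        exact Submodule.subset_span ⟨x, hx, rfl⟩
      rw [hs, inner_raise_of_mem _ _ hB _ this]
      simp
  · intro x hx
    rw [toUnit_val, ← sub_pos, ← inner_sub_right, inner_smul_left, h1 x hx]
    simpa using hs0

@[simp] theorem directionAbove_diagrams (W X : List (Pt d)) :
    (directionAbove W X).diagrams = 0 := by
  cases W <;> simp [directionAbove]

theorem directionAbove_steps_le (W X : List (Pt d)) :
    (directionAbove W X).steps
      ≤ (W.length + X.length) * (8 * d + 2 + (W.length + X.length) * (6 * d + 2)) + (3 * d + 2) := by
  cases W with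
  | nil => simp [directionAbove]
  | cons w ws =>
    simp only [directionAbove, bind_steps, toUnit_steps, List.length_cons]
    have h1 := gramSchmidtFrom_steps_le w ws []
    have h2 := raise_steps_le w X (gramSchmidtFrom w [] ws).val 0
    rw [length_gramSchmidtFrom] at h2
    simp only [List.length_nil, zero_add] at h1 h2
    have e1 : ws.length * (2 * d + ws.length * (6 * d + 2))
        ≤ ws.length * (8 * d + 2 + (ws.length + X.length) * (6 * d + 2)) := by
      gcongr <;> omega
    have e2 : (ws.length + X.length) * (8 * d + 2 + (ws.length + X.length) * (6 * d + 2))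
        ≤ (ws.length + 1 + X.length) * (8 * d + 2 + (ws.length + 1 + X.length) * (6 * d + 2)) := by
      gcongr <;> omega
    nlinarith

end DirectionAbove

/-! ### Bounding the spread of heights -/

section Spread

@[simp] theorem radiusSq_steps (w : Pt d) (V : List (Pt d)) :
    (radiusSq w V).steps = V.length * (3 * d + 1) + 1 := by
  induction V with
  | nil => simp [radiusSq]
  | cons q V ih => simp [radiusSq, ih]; ring

@[simp] theorem radiusSq_diagrams (w : Pt d) (V : List (Pt d)) : (radiusSq w V).diagrams = 0 := by
  induction V with
  | nil => simp [radiusSq]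
  | cons q V ih => simp [radiusSq, ih]

theorem norm_sq_le_radiusSq (w : Pt d) {V : List (Pt d)} {q : Pt d} (hq : q ∈ V) :
    ‖q - w‖ ^ 2 ≤ (radiusSq w V).val := by
  induction V with
  | nil => simp at hq
  | cons p V ih =>
    simp only [radiusSq, bind_val, sub_val, dot_val, op_val, real_inner_self_eq_norm_sq]
    rcases List.mem_cons.1 hq with rfl | hq
    · exact le_max_right _ _
    · exact (ih hq).trans (le_max_left _ _)

@[simp] theorem spreadBound_steps (w : Pt d) (V : List (Pt d)) :
    (spreadBound w V).steps = V.length * (3 * d + 1) + 3 := by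
  simp [spreadBound]

@[simp] theorem spreadBound_diagrams (w : Pt d) (V : List (Pt d)) :
    (spreadBound w V).diagrams = 0 := by
  simp [spreadBound]

theorem norm_sub_le_spreadBound (w : Pt d) {V : List (Pt d)} {q : Pt d} (hq : q ∈ V) :
    2 * ‖q - w‖ ≤ (spreadBound w V).val := by
  simp only [spreadBound, bind_val, op_val]
  have := Real.le_sqrt_of_sq_le (norm_sq_le_radiusSq w hq)
  linarith

/-- `D` is a positive upper bound for the spread of the heights of the points of `V`. -/
def IsSpread (V : List (Pt d)) (D : ℝ) : Prop :=
  0 < D ∧ ∀ s : Pt d, ‖s‖ = 1 → ∀ p ∈ V, ∀ q ∈ V, inner ℝ s p - inner ℝ s q ≤ D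

theorem isSpread_spreadBound {w : Pt d} {V : List (Pt d)} (h : ∃ q ∈ V, q ≠ w) :
    IsSpread V (spreadBound w V).val := by
  constructor
  · obtain ⟨q, hq, hne⟩ := h
    have h1 : 0 < ‖q - w‖ := norm_pos_iff.2 (sub_ne_zero.2 hne)
    have h2 := norm_sub_le_spreadBound w hq
    linarith
  · intro s hs p hp q hq
    have h1 := norm_sub_le_spreadBound w hp
    have h2 := norm_sub_le_spreadBound w hq
    have h3 := real_inner_le_norm s (p - q)
    rw [hs, one_mul, inner_sub_right] at h3
    have h4 : ‖p - q‖ ≤ ‖p - w‖ + ‖q - w‖ := by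
      have : p - q = (p - w) - (q - w) := by abel
      rw [this]; exact norm_sub_le _ _
    linarith

@[simp] theorem without_steps (l m : List (Pt d)) :
    (without l m).steps = l.length * (m.length + 1) := rfl

@[simp] theorem without_diagrams (l m : List (Pt d)) : (without l m).diagrams = 0 := rfl

theorem mem_without {l m : List (Pt d)} {x : Pt d} : x ∈ (without l m).val ↔ x ∈ l ∧ x ∉ m := by
  simp [without]

end Spread

/-! ### Merge sort and its cost -/

section Sorting

theorem merge_val_perm (l r : List ℝ) : (merge l r).val.Perm (l ++ r) := by
  induction l, r using merge.induct with
  | case1 l => simp [merge]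
  | case2 l h => cases l <;> simp [merge]
  | case3 a l b r hab ih =>
    rw [merge, if_pos hab]
    simpa using ih
  | case4 a l b r hab ih =>
    rw [merge, if_neg hab]
    simp only [bind_val, op_val]
    refine (List.Perm.cons b ih).trans ?_
    exact List.perm_middle.symm

theorem merge_val_sorted {l r : List ℝ} (hl : l.Pairwise (· ≤ ·)) (hr : r.Pairwise (· ≤ ·)) :
    (merge l r).val.Pairwise (· ≤ ·) := by
  induction l, r using merge.induct with
  | case1 l => simpa [merge] using hr
  | case2 l h => cases l <;> simp_all [merge]
  | case3 a l b r hab ih =>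
    rw [merge, if_pos hab]
    simp only [bind_val, op_val]
    refine List.pairwise_cons.2 ⟨fun x hx => ?_, ih (List.pairwise_cons.1 hl).2 hr⟩
    have hx' := (merge_val_perm _ _).mem_iff.1 hx
    rcases List.mem_append.1 hx' with h | h
    · exact (List.pairwise_cons.1 hl).1 x h
    · rcases List.mem_cons.1 h with rfl | h
      · exact hab
      · exact hab.trans ((List.pairwise_cons.1 hr).1 x h)
  | case4 a l b r hab ih =>
    rw [merge, if_neg hab]
    simp only [bind_val, op_val]
    refine List.pairwise_cons.2 ⟨fun x hx => ?_, ih hl (List.pairwise_cons.1 hr).2⟩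
    have hx' := (merge_val_perm _ _).mem_iff.1 hx
    rcases List.mem_append.1 hx' with h | h
    · rcases List.mem_cons.1 h with rfl | h
      · exact (not_le.1 hab).le
      · exact (not_le.1 hab).le.trans ((List.pairwise_cons.1 hl).1 x h)
    · exact (List.pairwise_cons.1 hr).1 x h

theorem merge_steps_le (l r : List ℝ) : (merge l r).steps ≤ 2 * (l.length + r.length) + 1 := by
  induction l, r using merge.induct with
  | case1 l => simp [merge]
  | case2 l h => cases l <;> simp [merge]
  | case3 a l b r hab ih =>
    rw [merge, if_pos hab]
    simp only [bind_steps, op_steps, List.length_cons] at ih ⊢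
    omega
  | case4 a l b r hab ih =>
    rw [merge, if_neg hab]
    simp only [bind_steps, op_steps, List.length_cons] at ih ⊢
    omega

@[simp] theorem merge_diagrams (l r : List ℝ) : (merge l r).diagrams = 0 := by
  induction l, r using merge.induct with
  | case1 l => simp [merge]
  | case2 l h => cases l <;> simp [merge]
  | case3 a l b r hab ih => rw [merge, if_pos hab]; simpa using ih
  | case4 a l b r hab ih => rw [merge, if_neg hab]; simpa using ih

theorem mergeSort_val_perm (n : ℕ) (l : List ℝ) : (mergeSort n l).val.Perm l := by
  induction n generalizing l with
  | zero => simp [mergeSort]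
  | succ n ih =>
    rw [mergeSort]
    split_ifs with h
    · simp
    · simp only [bind_val, op_val, List.splitAt_eq]
      refine (merge_val_perm _ _).trans (((ih _).append (ih _)).trans ?_)
      rw [List.take_append_drop]

theorem mergeSort_val_sorted {n : ℕ} {l : List ℝ} (hn : l.length ≤ n) :
    (mergeSort n l).val.Pairwise (· ≤ ·) := by
  induction n generalizing l with
  | zero => rw [List.length_eq_zero_iff.1 (Nat.le_zero.1 hn)]; simp [mergeSort]
  | succ n ih =>
    rw [mergeSort]
    split_ifs with h
    · rcases l with _ | ⟨a, _ | ⟨b, l⟩⟩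
      · simp
      · simp
      · simp at h
    · simp only [bind_val, op_val, List.splitAt_eq]
      refine merge_val_sorted (ih ?_) (ih ?_)
      · rw [List.length_take]; omega
      · rw [List.length_drop]; omega

@[simp] theorem mergeSort_diagrams (n : ℕ) (l : List ℝ) : (mergeSort n l).diagrams = 0 := by
  induction n generalizing l with
  | zero => simp [mergeSort]
  | succ n ih =>
    rw [mergeSort]
    split_ifs with h
    · simp
    · simp [ih]

/-- Splitting and merging a list of length m ≥ 2 cost 3m + 2 together, and halving lowers `clog` by
one; the factor 5 leaves room for the additive constants. -/
theorem mergeSort_steps_le (n : ℕ) (l : List ℝ) :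
    (mergeSort n l).steps ≤ 5 * (l.length * Nat.clog 2 l.length) + 1 := by
  induction n generalizing l with
  | zero => simp [mergeSort]
  | succ n ih =>
    rw [mergeSort]
    split_ifs with h
    · simp
    · push Not at h
      simp only [bind_steps, op_steps, op_val, List.splitAt_eq]
      have h1 := ih (l.take (l.length / 2))
      have h2 := ih (l.drop (l.length / 2))
      have h3 := merge_steps_le (mergeSort n (l.take (l.length / 2))).val
        (mergeSort n (l.drop (l.length / 2))).val
      rw [(mergeSort_val_perm n _).length_eq, (mergeSort_val_perm n _).length_eq] at h3
      rw [List.length_take] at h1 h3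
      rw [List.length_drop] at h2 h3
      have hc : Nat.clog 2 l.length = Nat.clog 2 ((l.length + 1) / 2) + 1 := by
        rw [Nat.clog_of_two_le (by norm_num) h]
        rfl
      set m := l.length
      set c := Nat.clog 2 ((m + 1) / 2)
      have ha : Nat.clog 2 (min (m / 2) m) ≤ c := Nat.clog_mono_right 2 (by omega)
      have hb : Nat.clog 2 (m - m / 2) ≤ c := Nat.clog_mono_right 2 (by omega)
      have ha' := Nat.mul_le_mul_left (min (m / 2) m) ha
      have hb' := Nat.mul_le_mul_left (m - m / 2) hb
      have e : min (m / 2) m * c + (m - m / 2) * c = m * c := by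
        rw [← Nat.add_mul]; congr 1; omega
      rw [hc, Nat.mul_add, Nat.mul_one]
      omega

end Sorting

/-! ### The smallest gap between heights -/

section Gaps

theorem smallestGap_pos (l : List ℝ) : 0 < (smallestGap l).val := by
  induction l with
  | nil => simp [smallestGap]
  | cons a l ih =>
    cases l with
    | nil => simp [smallestGap]
    | cons b l =>
      simp only [smallestGap, bind_val, op_val]
      split_ifs with h
      · exact lt_min ih (sub_pos.2 h)
      · exact ih

theorem smallestGap_le {l : List ℝ} (hl : l.Pairwise (· ≤ ·)) {x y : ℝ} (hx : x ∈ l) (hy : y ∈ l)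
    (hxy : x < y) : (smallestGap l).val ≤ y - x := by
  induction l with
  | nil => simp at hx
  | cons a l ih =>
    cases l with
    | nil =>
      simp only [List.mem_singleton] at hx hy
      subst hx; subst hy; exact absurd hxy (lt_irrefl _)
    | cons b l =>
      obtain ⟨h1, h2⟩ := List.pairwise_cons.1 hl
      have hle : (smallestGap (a :: b :: l)).val ≤ (smallestGap (b :: l)).val := by
        simp only [smallestGap, bind_val, op_val]
        split_ifs
        · exact min_le_left _ _
        · exact le_rfl
      have hy' : y ∈ b :: l := by
        rcases List.mem_cons.1 hy with rfl | hy
        · rcases List.mem_cons.1 hx with rfl | hx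
          · exact absurd hxy (lt_irrefl _)
          · exact absurd hxy (not_lt.2 (h1 x hx))
        · exact hy
      rcases List.mem_cons.1 hx with rfl | hx
      · by_cases hab : x < b
        · have hby : b ≤ y := by
            rcases List.mem_cons.1 hy' with rfl | hy'
            · exact le_rfl
            · exact (List.pairwise_cons.1 h2).1 y hy'
          have : (smallestGap (x :: b :: l)).val ≤ b - x := by
            simp only [smallestGap, bind_val, op_val, if_pos hab]
            exact min_le_right _ _
          linarith
        · have hxb : x = b := le_antisymm (h1 b (by simp)) (not_lt.1 hab)
          exact hle.trans (ih h2 (by simp [hxb]) hy')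
      · exact hle.trans (ih h2 hx hy')

theorem smallestGap_steps_le (l : List ℝ) : (smallestGap l).steps ≤ 3 * l.length + 1 := by
  induction l with
  | nil => simp [smallestGap]
  | cons a l ih =>
    cases l with
    | nil => simp [smallestGap]
    | cons b l =>
      simp only [smallestGap, bind_steps, op_steps, List.length_cons] at ih ⊢
      omega

@[simp] theorem smallestGap_diagrams (l : List ℝ) : (smallestGap l).diagrams = 0 := by
  induction l with
  | nil => simp [smallestGap]
  | cons a l ih =>
    cases l with
    | nil => simp [smallestGap]
    | cons b l => simpa [smallestGap] using ih

@[simp] theorem heights_val (s : Pt d) (V : List (Pt d)) :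
    (heights s V).val = V.map fun q => inner ℝ s q := by
  induction V with
  | nil => simp [heights]
  | cons q V ih => simp [heights, ih]

@[simp] theorem heights_steps (s : Pt d) (V : List (Pt d)) :
    (heights s V).steps = V.length * (2 * d + 1) + 1 := by
  induction V with
  | nil => simp [heights]
  | cons q V ih => simp [heights, ih]; ring

@[simp] theorem heights_diagrams (s : Pt d) (V : List (Pt d)) : (heights s V).diagrams = 0 := by
  induction V with
  | nil => simp [heights]
  | cons q V ih => simp [heights, ih]

/-- `g` is a positive lower bound for the distances between distinct heights of points of `V`. -/
def IsGap (s : Pt d) (V : List (Pt d)) (g : ℝ) : Prop :=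
  0 < g ∧ ∀ p ∈ V, ∀ q ∈ V, inner ℝ s p < inner ℝ s q → g ≤ inner ℝ s q - inner ℝ s p

theorem isGap_heightGap (s : Pt d) (V : List (Pt d)) : IsGap s V (heightGap s V).val := by
  simp only [heightGap, bind_val, heights_val]
  refine ⟨smallestGap_pos _, fun p hp q hq h => ?_⟩
  refine smallestGap_le (mergeSort_val_sorted le_rfl) ?_ ?_ h
  · exact (mergeSort_val_perm _ _).mem_iff.2 (List.mem_map.2 ⟨p, hp, rfl⟩)
  · exact (mergeSort_val_perm _ _).mem_iff.2 (List.mem_map.2 ⟨q, hq, rfl⟩)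

theorem heightGap_steps_le (s : Pt d) (V : List (Pt d)) :
    (heightGap s V).steps
      ≤ V.length * (2 * d + 4) + 5 * (V.length * Nat.clog 2 V.length) + 3 := by
  simp only [heightGap, bind_steps, heights_val, heights_steps, List.length_map]
  have h1 := mergeSort_steps_le V.length (V.map fun q => inner ℝ s q)
  have h2 := smallestGap_steps_le (mergeSort V.length (V.map fun q => inner ℝ s q)).val
  rw [(mergeSort_val_perm _ _).length_eq] at h2
  rw [List.length_map] at h1 h2
  nlinarith

@[simp] theorem heightGap_diagrams (s : Pt d) (V : List (Pt d)) :
    (heightGap s V).diagrams = 0 := by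
  simp [heightGap]

end Gaps

/-! ### Tilting a direction -/

section Tilt

/-- `t` orders the points of `V` by their heights in direction `s` and those of the same height by
their heights in direction `s'`. -/
structure IsTilt (V : List (Pt d)) (s s' t : Pt d) : Prop where
  norm_eq : ‖t‖ = 1
  lt_of_lt : ∀ p ∈ V, ∀ q ∈ V, inner ℝ s p < inner ℝ s q → inner ℝ t p < inner ℝ t q
  lt_of_eq : ∀ p q, inner ℝ s p = inner ℝ s q → inner ℝ s' p < inner ℝ s' q →
    inner ℝ t p < inner ℝ t q
  eq_of_eq : ∀ p q, inner ℝ s p = inner ℝ s q → inner ℝ s' p = inner ℝ s' q →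
    inner ℝ t p = inner ℝ t q

@[simp] theorem tilt_steps (g D : ℝ) (s s' : Pt d) : (tilt g D s s').steps = 7 * d + 6 := by
  simp [tilt]; ring

@[simp] theorem tilt_diagrams (g D : ℝ) (s s' : Pt d) : (tilt g D s s').diagrams = 0 := by
  simp [tilt]

/-- Distinct heights differ by at least g in direction s, and s' can work against this by at most D.
Since ε (g + D) = g / 2, the gain (1 - ε) g exceeds the loss ε D, and the order survives. Ties are
decided by s' alone. -/
theorem isTilt_tilt {V : List (Pt d)} {g D : ℝ} {s s' : Pt d} (hg : IsGap s V g)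
    (hD : IsSpread V D) (hs : ‖s‖ = 1) (hs' : ‖s'‖ = 1) :
    IsTilt V s s' (tilt g D s s').val := by
  obtain ⟨hg0, hg⟩ := hg
  obtain ⟨hD0, hD⟩ := hD
  simp only [tilt, bind_val, op_val, axpy_val, zero_add]
  set ε := g / (2 * (g + D)) with hε
  have hε0 : 0 < ε := by positivity
  have hεD : ε * (g + D) = g / 2 := by rw [hε]; field_simp
  have hε1 : ε < 1 / 2 := by
    rw [hε, div_lt_iff₀ (by positivity)]; linarith
  -- The two summands have norms 1 - ε > 1/2 and ε < 1/2, so they cannot cancel.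
  have hne : (1 - ε) • s + ε • s' ≠ 0 := by
    intro h0
    have h1 := congrArg norm (eq_neg_of_add_eq_zero_left h0)
    rw [norm_neg, norm_smul, norm_smul, hs, hs', Real.norm_of_nonneg (by linarith),
      Real.norm_of_nonneg hε0.le] at h1
    linarith
  set x := (1 - ε) • s + ε • s' with hx
  have hxi : ∀ p, inner ℝ (toUnit x).val p
      = ‖x‖⁻¹ * ((1 - ε) * inner ℝ s p + ε * inner ℝ s' p) := by
    intro p
    rw [toUnit_val, inner_smul_left, hx, inner_add_left, inner_smul_left, inner_smul_left]
    simp only [conj_trivial]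
  have hpos : 0 < ‖x‖⁻¹ := inv_pos.2 (norm_pos_iff.2 hne)
  refine ⟨norm_toUnit hne, ?_, ?_, ?_⟩
  · intro p hp q hq h
    rw [hxi, hxi]
    refine mul_lt_mul_of_pos_left ?_ hpos
    have h1 := hg p hp q hq h
    have h2 := hD s' hs' p hp q hq
    nlinarith
  · intro p q h h'
    rw [hxi, hxi, h]
    refine mul_lt_mul_of_pos_left ?_ hpos
    nlinarith
  · intro p q h h'
    rw [hxi, hxi, h, h']

end Tilt

/-! ### Moving vertices off a hyperplane -/

section Separate

theorem gapAt_cons_val (w s q : Pt d) (Q : List (Pt d)) :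
    (gapAt w s (q :: Q)).val = if inner ℝ s (q - w) = 0 then (gapAt w s Q).val
      else min (gapAt w s Q).val |inner ℝ s (q - w)| := rfl

theorem gapAt_pos (w s : Pt d) (Q : List (Pt d)) : 0 < (gapAt w s Q).val := by
  induction Q with
  | nil => simp [gapAt]
  | cons q Q ih =>
    rw [gapAt_cons_val]
    split_ifs with h
    · exact ih
    · exact lt_min ih (abs_pos.2 h)

theorem gapAt_le (w s : Pt d) {Q : List (Pt d)} {q : Pt d} (hq : q ∈ Q)
    (h : inner ℝ s (q - w) ≠ 0) : (gapAt w s Q).val ≤ |inner ℝ s (q - w)| := by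
  induction Q with
  | nil => simp at hq
  | cons p Q ih =>
    rw [gapAt_cons_val]
    rcases List.mem_cons.1 hq with rfl | hq
    · rw [if_neg h]; exact min_le_right _ _
    · split_ifs
      · exact ih hq
      · exact (min_le_left _ _).trans (ih hq)

@[simp] theorem gapAt_steps (w s : Pt d) (Q : List (Pt d)) :
    (gapAt w s Q).steps = Q.length * (3 * d + 3) + 1 := by
  induction Q with
  | nil => simp [gapAt]
  | cons q Q ih => simp [gapAt, ih]; ring

@[simp] theorem gapAt_diagrams (w s : Pt d) (Q : List (Pt d)) : (gapAt w s Q).diagrams = 0 := by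
  induction Q with
  | nil => simp [gapAt]
  | cons q Q ih => simp [gapAt, ih]

theorem separate_cons_of_eq {B : List (Pt d)} {w : Pt d} {D m : ℝ} {s q : Pt d} {Q : List (Pt d)}
    (h : inner ℝ s (q - w) = 0) :
    let r := (residual B (q - w)).val
    let t := separate B w D (min (m / 2) (m / (2 * D ^ 2) * inner ℝ r r))
      (s + (m / (2 * D ^ 2)) • r) Q
    (separate B w D m s (q :: Q)).val = t.val ∧
    (separate B w D m s (q :: Q)).steps = t.steps + (8 * d + 7 + B.length * (6 * d + 2)) ∧
    (separate B w D m s (q :: Q)).diagrams = t.diagrams := by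
  simp [separate, h]
  ring

theorem separate_cons_of_ne {B : List (Pt d)} {w : Pt d} {D m : ℝ} {s q : Pt d} {Q : List (Pt d)}
    (h : inner ℝ s (q - w) ≠ 0) :
    let t := separate B w D (min m |inner ℝ s (q - w)|) s Q
    (separate B w D m s (q :: Q)).val = t.val ∧
    (separate B w D m s (q :: Q)).steps = t.steps + (3 * d + 3) ∧
    (separate B w D m s (q :: Q)).diagrams = t.diagrams := by
  have h' : ¬ inner ℝ s (q - w) = 0 := h
  simp [separate, h']
  ring

@[simp] theorem separate_diagrams (B : List (Pt d)) (w : Pt d) (D m : ℝ) (s : Pt d)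
    (Q : List (Pt d)) : (separate B w D m s Q).diagrams = 0 := by
  induction Q generalizing m s with
  | nil => simp [separate]
  | cons q Q ih =>
    by_cases h : inner ℝ s (q - w) = 0
    · rw [(separate_cons_of_eq h).2.2, ih]
    · rw [(separate_cons_of_ne h).2.2, ih]

theorem inner_separate_of_mem {B : List (Pt d)} (hB : Orthog B) (w : Pt d) (D m : ℝ) (s : Pt d)
    (Q : List (Pt d)) {x : Pt d} (hx : x ∈ listSpan B) :
    inner ℝ (separate B w D m s Q).val x = inner ℝ s x := by
  induction Q generalizing m s with
  | nil => simp [separate]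
  | cons q Q ih =>
    by_cases h : inner ℝ s (q - w) = 0
    · rw [(separate_cons_of_eq h).1, ih, inner_add_left, inner_smul_left,
        inner_residual_of_mem_listSpan hB _ hx, mul_zero, add_zero]
    · rw [(separate_cons_of_ne h).1, ih]

/-- One perturbation step of `separate` keeps the points of `A` away from the height of `w` and
moves `q` away from it. -/
theorem separate_step_bounds {B : List (Pt d)} (hB : Orthog B) {w : Pt d} {D m : ℝ} {s q : Pt d}
    {A : Set (Pt d)} (hD : 0 < D) (hm : 0 < m)
    (hA : ∀ p ∈ A, m ≤ |inner ℝ s (p - w)| ∧ 2 * ‖p - w‖ ≤ D)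
    (hq : 2 * ‖q - w‖ ≤ D) (hqB : q - w ∉ listSpan B) (h : inner ℝ s (q - w) = 0) :
    let r := (residual B (q - w)).val
    let m' := min (m / 2) (m / (2 * D ^ 2) * inner ℝ r r)
    0 < m' ∧ ∀ p ∈ insert q A,
      m' ≤ |inner ℝ (s + (m / (2 * D ^ 2)) • r) (p - w)| ∧ 2 * ‖p - w‖ ≤ D := by
  intro r m'
  have hr : r ≠ 0 := by rwa [ne_eq, residual_eq_zero_iff hB]
  have hn : 0 < inner ℝ r r := by
    rw [real_inner_self_eq_norm_sq]; exact pow_pos (norm_pos_iff.2 hr) 2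
  set δ := m / (2 * D ^ 2) with hδ
  have hδ0 : 0 < δ := by positivity
  refine ⟨lt_min (by positivity) (by positivity), ?_⟩
  intro p hp
  rw [inner_add_left, inner_smul_left]
  simp only [conj_trivial]
  rcases hp with rfl | hp
  · refine ⟨?_, hq⟩
    rw [h, zero_add, inner_residual_self hB]
    exact (min_le_right _ _).trans (le_abs_self _)
  · obtain ⟨h1, h2⟩ := hA p hp
    refine ⟨(min_le_left _ _).trans ?_, h2⟩
    have h3 := abs_real_inner_le_norm r (p - w)
    have h4 : ‖r‖ ≤ D / 2 := (norm_residual_le hB _).trans (by linarith)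
    have h5 : ‖r‖ * ‖p - w‖ ≤ D / 2 * (D / 2) :=
      mul_le_mul h4 (by linarith) (norm_nonneg _) (by positivity)
    have h6 : |δ * inner ℝ r (p - w)| ≤ m / 2 := by
      rw [abs_mul, abs_of_pos hδ0]
      have h7 : δ * |inner ℝ r (p - w)| ≤ δ * (D / 2 * (D / 2)) :=
        mul_le_mul_of_nonneg_left (h3.trans h5) hδ0.le
      -- Both ‖r‖ and ‖p - w‖ are at most D / 2, so heights move by at most m / 8; giving up half of
      -- m is enough.
      have h8 : δ * (D / 2 * (D / 2)) = m / 8 := by rw [hδ]; field_simp; norm_num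
      linarith
    have h9 := abs_sub_abs_le_abs_sub (inner ℝ s (p - w)) (-(δ * inner ℝ r (p - w)))
    rw [abs_neg, sub_neg_eq_add] at h9
    linarith

theorem inner_separate_ne_zero {B : List (Pt d)} (hB : Orthog B) {w : Pt d} {D m : ℝ} {s : Pt d}
    {Q : List (Pt d)} {A : Set (Pt d)} (hD : 0 < D) (hm : 0 < m)
    (hA : ∀ p ∈ A, m ≤ |inner ℝ s (p - w)| ∧ 2 * ‖p - w‖ ≤ D)
    (hQ : ∀ q ∈ Q, 2 * ‖q - w‖ ≤ D ∧ q - w ∉ listSpan B) :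
    ∀ p, p ∈ A ∨ p ∈ Q → inner ℝ (separate B w D m s Q).val (p - w) ≠ 0 := by
  induction Q generalizing m s A with
  | nil =>
    intro p hp h0
    simp only [List.not_mem_nil, or_false] at hp
    simp only [separate, pure_val] at h0
    have := (hA p hp).1
    rw [h0, abs_zero] at this
    linarith
  | cons q Q ih =>
    have hQ' : ∀ p ∈ Q, 2 * ‖p - w‖ ≤ D ∧ p - w ∉ listSpan B :=
      fun p hp => hQ p (List.mem_cons_of_mem _ hp)
    have hq := hQ q (by simp)
    intro p hp
    have hp' : p ∈ insert q A ∨ p ∈ Q := by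
      simp only [List.mem_cons, Set.mem_insert_iff] at hp ⊢; tauto
    by_cases h : inner ℝ s (q - w) = 0
    · rw [(separate_cons_of_eq h).1]
      obtain ⟨h1, h2⟩ := separate_step_bounds hB hD hm hA hq.1 hq.2 h
      exact ih h1 h2 hQ' p hp'
    · rw [(separate_cons_of_ne h).1]
      refine ih (lt_min hm (abs_pos.2 h)) ?_ hQ' p hp'
      rintro p (rfl | hp)
      · exact ⟨min_le_right _ _, hq.1⟩
      · exact ⟨(min_le_left _ _).trans (hA p hp).1, (hA p hp).2⟩

/-- The predicate P covers the vertices that may start at the height of w. All others belong to the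
protected set A and stay off that height, so the expensive branch is entered only for P. -/
theorem separate_steps_le {B : List (Pt d)} (hB : Orthog B) {w : Pt d} {D m : ℝ} {s : Pt d}
    {Q : List (Pt d)} {A : Set (Pt d)} (hD : 0 < D) (hm : 0 < m)
    (hA : ∀ p ∈ A, m ≤ |inner ℝ s (p - w)| ∧ 2 * ‖p - w‖ ≤ D)
    (hQ : ∀ q ∈ Q, 2 * ‖q - w‖ ≤ D ∧ q - w ∉ listSpan B)
    (P : Pt d → Prop) [DecidablePred P] (hP : ∀ q ∈ Q, ¬ P q → q ∈ A) :
    (separate B w D m s Q).steps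
      ≤ Q.length * (3 * d + 3) + Q.countP P * (8 * d + 7 + B.length * (6 * d + 2)) := by
  induction Q generalizing m s A with
  | nil => simp [separate]
  | cons q Q ih =>
    have hQ' : ∀ p ∈ Q, 2 * ‖p - w‖ ≤ D ∧ p - w ∉ listSpan B :=
      fun p hp => hQ p (List.mem_cons_of_mem _ hp)
    have hq := hQ q (by simp)
    have hP' : ∀ p ∈ Q, ¬ P p → p ∈ insert q A :=
      fun p hp hn => Set.mem_insert_of_mem _ (hP p (List.mem_cons_of_mem _ hp) hn)
    by_cases h : inner ℝ s (q - w) = 0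
    · rw [(separate_cons_of_eq h).2.1]
      obtain ⟨h1, h2⟩ := separate_step_bounds hB hD hm hA hq.1 hq.2 h
      have h3 := ih h1 h2 hQ' hP'
      have hPq : P q := by
        by_contra hn
        have := (hA q (hP q (by simp) hn)).1
        rw [h, abs_zero] at this
        linarith
      rw [List.countP_cons_of_pos (by simpa using hPq), List.length_cons]
      nlinarith
    · rw [(separate_cons_of_ne h).2.1]
      have h3 := ih (m := min m |inner ℝ s (q - w)|) (s := s) (A := insert q A)
        (lt_min hm (abs_pos.2 h)) (by
          rintro p (rfl | hp)
          · exact ⟨min_le_right _ _, hq.1⟩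
          · exact ⟨(min_le_left _ _).trans (hA p hp).1, (hA p hp).2⟩) hQ' hP'
      have h4 : Q.countP P ≤ (q :: Q).countP P := by
        rw [List.countP_cons]; omega
      have h5 := Nat.mul_le_mul_right (8 * d + 7 + B.length * (6 * d + 2)) h4
      rw [List.length_cons]
      nlinarith

end Separate

/-! ### General position -/

section GeneralPosition

/-- Every duplicate-free list of at most `d + 1` points of `V` is affinely independent. -/
def ListGeneralPosition (V : List (Pt d)) : Prop :=
  ∀ l : List (Pt d), l.Nodup → (∀ x ∈ l, x ∈ V) → l.length ≤ d + 1 → ListAffineIndep l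

theorem AffineGeneralPosition.list {A : Set (Pt d)} (h : AffineGeneralPosition A)
    {V : List (Pt d)} (hV : ∀ x ∈ V, x ∈ A) : ListGeneralPosition V := by
  classical
  intro l hnd hl hlen
  have h1 := h l.toFinset (fun x hx => hV x (hl x (by simpa using hx)))
    (by rw [List.toFinset_card_of_nodup hnd]; exact hlen)
  exact h1.comp_embedding
    (⟨fun x => ⟨x.1, List.mem_toFinset.2 x.2⟩, fun x y hxy => Subtype.ext (by simpa using hxy)⟩ :
      {x | x ∈ l} ↪ l.toFinset)

/-- With w, any d vertices on the hyperplane through w would be affinely independent. Their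
differences would span the space, and s would be orthogonal to itself. -/
theorem countP_inner_eq_zero_le {V : List (Pt d)} (hgp : ListGeneralPosition V) {w : Pt d}
    (hw : w ∈ V) {s : Pt d} (hs : s ≠ 0) {Q : List (Pt d)} (hQ : Q.Nodup)
    (hQV : ∀ q ∈ Q, q ∈ V ∧ q ≠ w) :
    open Classical in Q.countP (fun q => inner ℝ s (q - w) = 0) ≤ d := by
  classical
  by_contra! hc
  rw [List.countP_eq_length_filter] at hc
  set Z := Q.filter fun q => decide (inner ℝ s (q - w) = 0) with hZ
  have hZ' : ∀ q ∈ Z.take d, q ∈ Q ∧ inner ℝ s (q - w) = 0 := by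
    intro q hq
    simpa [hZ] using List.mem_of_mem_take hq
  have hnd : (Z.take d).Nodup := (hQ.filter _).sublist (List.take_sublist _ _)
  have hw' : w ∉ Z.take d := fun h => (hQV w (hZ' w h).1).2 rfl
  have hlen : (Z.take d).length = d := by rw [List.length_take]; omega
  have hli := (hgp (w :: Z.take d) (List.nodup_cons.2 ⟨hw', hnd⟩)
    (by
      intro x hx
      rcases List.mem_cons.1 hx with rfl | hx
      · exact hw
      · exact (hQV x (hZ' x hx).1).1)
    (by simp [hlen])).linearIndepOn hw'
  have hspan : Submodule.span ℝ ((fun x : Pt d => x - w) '' {x | x ∈ Z.take d}) = ⊤ := by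
    have h1 : Module.finrank ℝ (Submodule.span ℝ
        ((fun x : Pt d => x - w) '' {x | x ∈ Z.take d})) = d := by
      have hset : {x | x ∈ Z.take d} = ((Z.take d).toFinset : Set (Pt d)) := by ext; simp
      have hfin : Fintype {x | x ∈ Z.take d} := by rw [hset]; infer_instance
      have h2 := finrank_span_eq_card hli
      rw [Set.image_eq_range]
      refine h2.trans (Eq.trans ?_ hlen)
      rw [← Set.toFinset_card, ← List.toFinset_card_of_nodup hnd]
      congr 1
      ext; simp
    exact Submodule.eq_top_of_finrank_eq (by rw [h1, finrank_euclideanSpace_fin])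
  apply hs
  rw [← inner_self_eq_zero (𝕜 := ℝ)]
  have hmem : s ∈ Submodule.span ℝ ((fun x : Pt d => x - w) '' {x | x ∈ Z.take d}) := by
    rw [hspan]; trivial
  have hgen : ∀ y ∈ Submodule.span ℝ ((fun x : Pt d => x - w) '' {x | x ∈ Z.take d}),
      inner ℝ s y = 0 := by
    intro y hy
    induction hy using Submodule.span_induction with
    | mem y hy => obtain ⟨x, hx, rfl⟩ := hy; exact (hZ' x hx).2
    | zero => simp
    | add x y _ _ hx hy => rw [inner_add_right, hx, hy, add_zero]
    | smul a x _ hx => rw [inner_smul_right, hx, mul_zero]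
  exact hgen s hmem

end GeneralPosition

/-! ### The separating direction -/

section SeparatingDirection

@[simp] theorem separatingDirection_diagrams (B : List (Pt d)) (w : Pt d) (D : ℝ) (s : Pt d)
    (Q : List (Pt d)) : (separatingDirection B w D s Q).diagrams = 0 := by
  simp [separatingDirection]

theorem separatingDirection_spec {B : List (Pt d)} (hB : Orthog B) {w : Pt d} {D : ℝ} {s : Pt d}
    {Q : List (Pt d)} (hD : 0 < D) (hs : s ≠ 0) (hsB : ∀ x ∈ listSpan B, inner ℝ s x = 0)
    (hQ : ∀ q ∈ Q, 2 * ‖q - w‖ ≤ D ∧ q - w ∉ listSpan B) :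
    ‖(separatingDirection B w D s Q).val‖ = 1 ∧
      (∀ x ∈ listSpan B, inner ℝ (separatingDirection B w D s Q).val x = 0) ∧
      ∀ q ∈ Q, inner ℝ (separatingDirection B w D s Q).val (q - w) ≠ 0 := by
  simp only [separatingDirection, bind_val]
  set t := (separate B w D (gapAt w s Q).val s Q).val with ht
  have h1 : ∀ q ∈ Q, inner ℝ t (q - w) ≠ 0 := fun q hq =>
    inner_separate_ne_zero hB (A := ∅) hD (gapAt_pos w s Q) (by simp) hQ q (Or.inr hq)
  have h2 : t ≠ 0 := by
    -- Without points to separate, the result is s itself; otherwise a nonzero inner product shows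
    -- that it is nonzero.
    rcases Q with _ | ⟨q, Q⟩
    · simpa [ht, separate] using hs
    · intro h0
      exact h1 q (by simp) (by rw [h0]; simp)
  refine ⟨norm_toUnit h2, fun x hx => ?_, fun q hq => ?_⟩
  · rw [toUnit_val, inner_smul_left, ht, inner_separate_of_mem hB _ _ _ _ _ hx, hsB x hx, mul_zero]
  · rw [toUnit_val, inner_smul_left]
    exact mul_ne_zero (by simpa using h2) (h1 q hq)

theorem separatingDirection_steps_le {B : List (Pt d)} (hB : Orthog B) {w : Pt d} {D : ℝ}
    {s : Pt d} {V Q : List (Pt d)} (hD : 0 < D) (hs : s ≠ 0)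
    (hQ : ∀ q ∈ Q, 2 * ‖q - w‖ ≤ D ∧ q - w ∉ listSpan B)
    (hgp : ListGeneralPosition V) (hw : w ∈ V) (hnd : Q.Nodup) (hQV : ∀ q ∈ Q, q ∈ V ∧ q ≠ w) :
    (separatingDirection B w D s Q).steps
      ≤ Q.length * (6 * d + 6) + d * (8 * d + 7 + B.length * (6 * d + 2)) + (3 * d + 3) := by
  classical
  have h1 := separate_steps_le hB (s := s) (A := {q | q ∈ Q ∧ inner ℝ s (q - w) ≠ 0})
    hD (gapAt_pos w s Q) (fun p hp => ⟨gapAt_le w s hp.1 hp.2, (hQ p hp.1).1⟩) hQ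
    (fun q => inner ℝ s (q - w) = 0) (fun q hq hn => ⟨hq, hn⟩)
  have h2 := countP_inner_eq_zero_le hgp hw hs hnd hQV
  have h3 : Q.countP (fun q => inner ℝ s (q - w) = 0) ≤ d := by convert h2
  have h4 := Nat.mul_le_mul_right (8 * d + 7 + B.length * (6 * d + 2)) h3
  simp only [separatingDirection, bind_steps, gapAt_steps, toUnit_steps]
  nlinarith

end SeparatingDirection

/-! ### The two directions that bound the wedge -/

/-- The input of the simplex predicate: `w :: ws` lists the vertices of a simplex and `v` is
another vertex. -/
structure WedgeInput (V : List (Pt d)) (w : Pt d) (ws : List (Pt d)) (v : Pt d) : Prop where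
  nodup : (w :: (ws ++ [v])).Nodup
  mem : ∀ x ∈ w :: (ws ++ [v]), x ∈ V
  length_lt : ws.length + 1 < d
  generalPosition : ListGeneralPosition V
  nodup_vertices : V.Nodup

namespace WedgeInput

variable {V : List (Pt d)} {w : Pt d} {ws : List (Pt d)} {v : Pt d}

theorem isSpread (h : WedgeInput V w ws v) : IsSpread V (spreadBound w V).val := by
  refine isSpread_spreadBound ⟨v, h.mem v (by simp), ?_⟩
  rintro rfl
  have := (List.nodup_cons.1 h.nodup).1
  simp at this

theorem listSpan_basis (w : Pt d) (ws : List (Pt d)) (v : Pt d) :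
    listSpan (gramSchmidtFrom w [] (ws ++ [v])).val
      = Submodule.span ℝ ((fun y => y - w) '' {y | y ∈ ws ++ [v]}) := by
  rw [listSpan_gramSchmidtFrom, show listSpan ([] : List (Pt d)) = ⊥ by simp [listSpan],
    bot_sup_eq]

/-- Together with q there are k + 2 ≤ d + 1 points, hence affinely independent ones; this is where k
< d meets general position. -/
theorem sub_notMem_listSpan (h : WedgeInput V w ws v) {q : Pt d} (hq : q ∈ V)
    (hq' : q ∉ v :: w :: ws) : q - w ∉ listSpan (gramSchmidtFrom w [] (ws ++ [v])).val := by
  rw [listSpan_basis]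
  obtain ⟨h1, h2⟩ := List.nodup_cons.1 h.nodup
  simp only [List.mem_cons, not_or] at hq'
  have hq1 : q ∉ ws ++ [v] := by simp [hq'.1, hq'.2.2]
  have hw : w ∉ q :: (ws ++ [v]) := by
    simp only [List.mem_cons, not_or]; exact ⟨fun e => hq'.2.1 e.symm, h1⟩
  have hli := (h.generalPosition (w :: q :: (ws ++ [v]))
    (List.nodup_cons.2 ⟨hw, List.nodup_cons.2 ⟨hq1, h2⟩⟩)
    (by
      intro x hx
      rcases List.mem_cons.1 hx with rfl | hx
      · exact h.mem x (by simp)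
      · rcases List.mem_cons.1 hx with rfl | hx
        · exact hq
        · exact h.mem x (List.mem_cons_of_mem _ hx))
    (by have := h.length_lt; simp; omega)).linearIndepOn hw
  have hset : {x | x ∈ q :: (ws ++ [v])} = insert q {x | x ∈ ws ++ [v]} := by ext; simp
  rw [hset] at hli
  have hq2 : q ∉ {x | x ∈ ws ++ [v]} := hq1
  exact ((linearIndepOn_insert hq2).1 hli).2

theorem listAffineIndep (h : WedgeInput V w ws v) : ListAffineIndep (w :: ws ++ [v]) := by
  refine h.generalPosition _ (by simpa using h.nodup) (by simpa using h.mem) ?_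
  have := h.length_lt
  simp; omega

end WedgeInput

theorem wedgeDirections_cons_val (V : List (Pt d)) (w : Pt d) (ws : List (Pt d)) (v : Pt d) :
    (wedgeDirections V (w :: ws) v).val =
      let B := (gramSchmidtFrom w [] (ws ++ [v])).val
      let s₁ := (orthogonalDirection B).val
      let D := (spreadBound w V).val
      let s₂ := (separatingDirection B w D s₁ (without V (v :: w :: ws)).val).val
      let s := (tilt (heightGap s₁ V).val D s₁ s₂).val
      let s₃ := (directionAbove (w :: ws) [v]).val
      let g := (heightGap s V).val
      ((tilt g D s s₃).val, (tilt g D s (-s₃)).val) := rfl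

theorem wedgeDirections_cons_steps (V : List (Pt d)) (w : Pt d) (ws : List (Pt d)) (v : Pt d) :
    let B := (gramSchmidtFrom w [] (ws ++ [v])).val
    let s₁ := (orthogonalDirection B).val
    let D := (spreadBound w V).val
    let s₂ := (separatingDirection B w D s₁ (without V (v :: w :: ws)).val).val
    let s := (tilt (heightGap s₁ V).val D s₁ s₂).val
    (wedgeDirections V (w :: ws) v).steps =
      (gramSchmidtFrom w [] (ws ++ [v])).steps + (orthogonalDirection B).steps
        + (V.length * (3 * d + 1) + 3) + V.length * (ws.length + 3)
        + (separatingDirection B w D s₁ (without V (v :: w :: ws)).val).steps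
        + (heightGap s₁ V).steps + (heightGap s V).steps
        + (directionAbove (w :: ws) [v]).steps + (22 * d + 18) := by
  intro B s₁ D s₂ s
  simp only [wedgeDirections, bind_steps, pure_steps, op_steps, tilt_steps, spreadBound_steps,
    without_steps, List.length_cons]
  simp only [B, s₁, D, s₂, s]
  ring

theorem wedgeDirections_diagrams (V σ : List (Pt d)) (v : Pt d) :
    (wedgeDirections V σ v).diagrams = 0 := by
  cases σ <;> simp [wedgeDirections]

/-- The properties of the two directions that bound the wedge. -/
structure IsWedge (V : List (Pt d)) (w : Pt d) (ws : List (Pt d)) (v sL sU : Pt d) : Prop where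
  norm_lower : ‖sL‖ = 1
  norm_upper : ‖sU‖ = 1
  lower_eq : ∀ x ∈ w :: ws, inner ℝ sL x = inner ℝ sL w
  upper_eq : ∀ x ∈ w :: ws, inner ℝ sU x = inner ℝ sU w
  lower_lt : inner ℝ sL w < inner ℝ sL v
  upper_lt : inner ℝ sU v < inner ℝ sU w
  same_side : ∀ q ∈ V, q ∉ w :: ws → q ≠ v →
    (inner ℝ sL q < inner ℝ sL w ∧ inner ℝ sU q < inner ℝ sU w) ∨
    (inner ℝ sL w < inner ℝ sL q ∧ inner ℝ sU w < inner ℝ sU q)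

/-- In direction s exactly the vertices of Σ share a level. The final tilts towards s₃ and -s₃ keep
σ level, push v to opposite sides, and preserve the sides of all other vertices. -/
theorem isWedge_wedgeDirections {V : List (Pt d)} {w : Pt d} {ws : List (Pt d)} {v : Pt d}
    (h : WedgeInput V w ws v) :
    IsWedge V w ws v (wedgeDirections V (w :: ws) v).val.1
      (wedgeDirections V (w :: ws) v).val.2 := by
  have hval := wedgeDirections_cons_val V w ws v
  simp only at hval
  rw [hval]
  set B := (gramSchmidtFrom w [] (ws ++ [v])).val
  set s₁ := (orthogonalDirection B).val
  set D := (spreadBound w V).val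
  set s₂ := (separatingDirection B w D s₁ (without V (v :: w :: ws)).val).val
  set s := (tilt (heightGap s₁ V).val D s₁ s₂).val
  set s₃ := (directionAbove (w :: ws) [v]).val
  set g := (heightGap s V).val
  have hB : Orthog B := orthog_gramSchmidtFrom _ _ List.Pairwise.nil
  have hlen : B.length < d := by
    have := h.length_lt
    simp only [B, length_gramSchmidtFrom]; simp; omega
  obtain ⟨hs₁, hs₁B⟩ := orthogonalDirection_spec hB hlen
  have hD : IsSpread V D := h.isSpread
  have hQ : ∀ q ∈ (without V (v :: w :: ws)).val, 2 * ‖q - w‖ ≤ D ∧ q - w ∉ listSpan B := by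
    intro q hq
    obtain ⟨h1, h2⟩ := mem_without.1 hq
    exact ⟨norm_sub_le_spreadBound w h1, h.sub_notMem_listSpan h1 h2⟩
  obtain ⟨hs₂, hs₂B, hs₂Q⟩ := separatingDirection_spec hB hD.1
    (norm_ne_zero_iff.1 (by rw [hs₁]; exact one_ne_zero)) hs₁B hQ
  have hs : IsTilt V s₁ s₂ s := isTilt_tilt (isGap_heightGap s₁ V) hD hs₁ hs₂
  obtain ⟨hs₃, hs₃eq, hs₃lt⟩ := directionAbove_spec (w := w) (ws := ws) (X := [v]) (by simp)
    (by simpa using h.nodup) h.listAffineIndep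
  have hL : IsTilt V s s₃ (tilt g D s s₃).val :=
    isTilt_tilt (isGap_heightGap s V) hD hs.norm_eq hs₃
  have hU : IsTilt V s (-s₃) (tilt g D s (-s₃)).val :=
    isTilt_tilt (isGap_heightGap s V) hD hs.norm_eq (by rw [norm_neg]; exact hs₃)
  have hsB : ∀ t : Pt d, (∀ x ∈ listSpan B, inner ℝ t x = 0) →
      ∀ x ∈ w :: (ws ++ [v]), inner ℝ t x = inner ℝ t w := by
    intro t ht x hx
    rcases List.mem_cons.1 hx with rfl | hx
    · rfl
    · rw [← sub_eq_zero, ← inner_sub_right]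
      refine ht _ ?_
      rw [WedgeInput.listSpan_basis]
      exact Submodule.subset_span ⟨x, hx, rfl⟩
  have hseq : ∀ x ∈ w :: (ws ++ [v]), inner ℝ s x = inner ℝ s w := fun x hx =>
    hs.eq_of_eq x w (hsB s₁ hs₁B x hx) (hsB s₂ hs₂B x hx)
  have hmem : ∀ x ∈ w :: ws, x ∈ w :: (ws ++ [v]) := by
    intro x hx; simp only [List.mem_cons, List.mem_append] at hx ⊢; tauto
  have hwV : w ∈ V := h.mem w (by simp)
  have hv : inner ℝ s v = inner ℝ s w := hseq v (by simp)
  have hvlt : inner ℝ s₃ w < inner ℝ s₃ v := hs₃lt v (by simp)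
  refine ⟨hL.norm_eq, hU.norm_eq, fun x hx => ?_, fun x hx => ?_, ?_, ?_, fun q hq hqσ hqv => ?_⟩
  · exact hL.eq_of_eq x w (hseq x (hmem x hx)) (hs₃eq x hx)
  · exact hU.eq_of_eq x w (hseq x (hmem x hx)) (by rw [inner_neg_left, inner_neg_left, hs₃eq x hx])
  · exact hL.lt_of_eq w v hv.symm hvlt
  · exact hU.lt_of_eq v w hv (by rw [inner_neg_left, inner_neg_left]; exact neg_lt_neg hvlt)
  -- Either s₁ already separates q from σ and the tilt keeps this, or s₂ breaks the tie.
  · have hqs : inner ℝ s q ≠ inner ℝ s w := by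
      by_cases h1 : inner ℝ s₁ q = inner ℝ s₁ w
      · have h2 : inner ℝ s₂ (q - w) ≠ 0 := hs₂Q q (mem_without.2 ⟨hq, by
          simp only [List.mem_cons, not_or] at hqσ ⊢; exact ⟨hqv, hqσ⟩⟩)
        rw [inner_sub_right, sub_ne_zero] at h2
        rcases lt_or_gt_of_ne h2 with h2 | h2
        · exact (hs.lt_of_eq q w h1 h2).ne
        · exact (hs.lt_of_eq w q h1.symm h2).ne'
      · rcases lt_or_gt_of_ne h1 with h1 | h1
        · exact (hs.lt_of_lt q hq w hwV h1).ne
        · exact (hs.lt_of_lt w hwV q hq h1).ne'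
    rcases lt_or_gt_of_ne hqs with h1 | h1
    · exact Or.inl ⟨hL.lt_of_lt q hq w hwV h1, hU.lt_of_lt q hq w hwV h1⟩
    · exact Or.inr ⟨hL.lt_of_lt w hwV q hq h1, hU.lt_of_lt w hwV q hq h1⟩

/-- The term k d² comes from d residuals against k vectors, both for the orthogonal direction and
for at most d corrections in `separate`. The remaining Gram-Schmidt work is absorbed because k < d.
-/
theorem wedgeDirections_steps_le {V : List (Pt d)} {w : Pt d} {ws : List (Pt d)} {v : Pt d}
    (h : WedgeInput V w ws v) :
    (wedgeDirections V (w :: ws) v).steps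
      ≤ 200 * (d * V.length + (ws.length + 1) * d ^ 2 + V.length * Nat.clog 2 V.length) := by
  have hsteps := wedgeDirections_cons_steps V w ws v
  simp only at hsteps
  rw [hsteps]
  set B := (gramSchmidtFrom w [] (ws ++ [v])).val with hBdef
  set s₁ := (orthogonalDirection B).val with hs₁def
  set D := (spreadBound w V).val
  set Q := (without V (v :: w :: ws)).val with hQdef
  have hB : Orthog B := orthog_gramSchmidtFrom _ _ List.Pairwise.nil
  have hkd := h.length_lt
  have hlenB : B.length = ws.length + 1 := by
    rw [hBdef, length_gramSchmidtFrom]; simp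
  have hs₁ := (orthogonalDirection_spec hB (by omega)).1
  have hD : IsSpread V D := h.isSpread
  have hQ : ∀ q ∈ Q, 2 * ‖q - w‖ ≤ D ∧ q - w ∉ listSpan B := by
    intro q hq
    obtain ⟨h1, h2⟩ := mem_without.1 hq
    exact ⟨norm_sub_le_spreadBound w h1, h.sub_notMem_listSpan h1 h2⟩
  have hQlen : Q.length ≤ V.length := by
    rw [hQdef]; simp only [without, op_val]; exact List.length_filter_le _ _
  have hQnd : Q.Nodup := by
    rw [hQdef]; simp only [without, op_val]; exact h.nodup_vertices.filter _
  have h1 := gramSchmidtFrom_steps_le w (ws ++ [v]) []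
  have h2 := orthogonalDirection_steps_le B
  have h3 := separatingDirection_steps_le hB hD.1
    (norm_ne_zero_iff.1 (by rw [hs₁]; exact one_ne_zero)) hQ h.generalPosition (h.mem w (by simp))
    hQnd (fun q hq => ⟨(mem_without.1 hq).1, fun e => (mem_without.1 hq).2 (by simp [e])⟩)
  have h4 := heightGap_steps_le s₁ V
  have h5 := heightGap_steps_le
    (tilt (heightGap s₁ V).val D s₁ (separatingDirection B w D s₁ Q).val).val V
  have h6 := directionAbove_steps_le (w :: ws) [v]
  have hn : 1 ≤ V.length := List.length_pos_of_mem (h.mem w (by simp))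
  rw [hlenB] at h2 h3
  simp only [List.length_append, List.length_cons, List.length_nil, zero_add] at h1 h6
  have h3' : Q.length * (6 * d + 6) ≤ V.length * (6 * d + 6) := Nat.mul_le_mul_right _ hQlen
  generalize Q.length = lq at *
  generalize V.length * Nat.clog 2 V.length = M at *
  generalize V.length = n at *
  generalize hk : ws.length + 1 = k at *
  have hws : ws.length = k - 1 := by omega
  have hk1 : 1 ≤ k := by omega
  have hd1 : 1 ≤ d := by omega
  have e1 : n * ws.length ≤ n * d := Nat.mul_le_mul_left _ (by omega)
  have e2 : n ≤ n * d := Nat.le_mul_of_pos_right _ hd1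
  have e3 : k * k * d ≤ k * d ^ 2 := by
    rw [pow_two, mul_assoc]; exact Nat.mul_le_mul_left _ (Nat.mul_le_mul_right _ hkd.le)
  have e4 : k * k ≤ k * d ^ 2 := by
    rw [pow_two]; exact Nat.mul_le_mul_left _ (hkd.le.trans (Nat.le_mul_of_pos_right _ hd1))
  have e5 : k * d ≤ k * d ^ 2 := by
    rw [pow_two]; exact Nat.mul_le_mul_left _ (Nat.le_mul_of_pos_right _ hd1)
  have e6 : d ^ 2 ≤ k * d ^ 2 := Nat.le_mul_of_pos_left _ hk1
  have e7 : d ≤ d ^ 2 := by rw [pow_two]; exact Nat.le_mul_of_pos_right _ hd1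
  have e8 : k ≤ k * d ^ 2 := Nat.le_mul_of_pos_right _ (by positivity)
  have e9 : d * (k * d) = k * d ^ 2 := by ring
  linarith

/-! ### Enumerating the proper faces -/

section ProperFaces

theorem mem_properFaces {σ ρ : List (Pt d)} :
    ρ ∈ properFaces σ ↔ ρ.Sublist σ ∧ 1 ≤ ρ.length ∧ ρ.length < σ.length := by
  simp only [properFaces, List.mem_flatMap, List.mem_range'_1, List.mem_sublistsLen]
  constructor
  · rintro ⟨m, hm, hs, rfl⟩
    exact ⟨hs, by omega, by omega⟩
  · rintro ⟨hs, h1, h2⟩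
    exact ⟨_, by omega, hs, rfl⟩

theorem nodup_properFaces {σ : List (Pt d)} (h : σ.Nodup) : (properFaces σ).Nodup := by
  rw [properFaces, List.nodup_flatMap]
  refine ⟨fun m _ => List.nodup_sublistsLen m h, ?_⟩
  refine (List.nodup_range' (s := 1) (n := σ.length - 1)).imp fun {a b} hab x hxa hxb => hab ?_
  rw [← (List.mem_sublistsLen.1 hxa).2, (List.mem_sublistsLen.1 hxb).2]

theorem pairwise_length_properFaces (σ : List (Pt d)) :
    (properFaces σ).Pairwise fun ρ τ => ρ.length ≤ τ.length := by
  rw [properFaces, List.pairwise_flatMap]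
  constructor
  · intro m _
    refine List.Pairwise.imp_of_mem (R := fun _ _ => True) ?_ (List.pairwise_of_forall (by simp))
    intro a b ha hb _
    rw [(List.mem_sublistsLen.1 ha).2, (List.mem_sublistsLen.1 hb).2]
  · refine (List.pairwise_lt_range' (s := 1) (n := σ.length - 1)).imp ?_
    intro m m' hm x hx y hy
    rw [(List.mem_sublistsLen.1 hx).2, (List.mem_sublistsLen.1 hy).2]
    exact hm.le

theorem length_properFaces {σ : List (Pt d)} (h : σ ≠ []) :
    (properFaces σ).length + 2 = 2 ^ σ.length := by
  have hpos : 0 < σ.length := List.length_pos_iff.2 h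
  obtain ⟨k, hk⟩ : ∃ k, σ.length = k + 1 := ⟨σ.length - 1, by omega⟩
  rw [properFaces, List.length_flatMap]
  simp only [List.length_sublistsLen, hk, Nat.add_sub_cancel]
  -- The row sum of binomial coefficients without its two ends, the empty face and σ itself.
  rw [← Nat.sum_range_choose, Finset.sum_range_succ, Finset.sum_range_succ',
    List.range'_eq_map_range, List.map_map]
  rw [Nat.choose_self, Nat.choose_zero_right, add_assoc]
  congr 1
  simp only [Finset.sum_range, ← List.sum_ofFn, List.ofFn_eq_map, Function.comp_def, add_comm 1]
  rw [← List.map_coe_finRange_eq_range, List.map_map]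
  rfl

end ProperFaces

/-! ### Reading a diagram -/

section CountPoints

@[simp] theorem countPoints_val (p : ℝ × EReal → Prop) [DecidablePred p] (l : List (ℝ × EReal)) :
    (countPoints p l).val = (l.countP fun a => decide (p a) : ℕ) := by
  induction l with
  | nil => simp [countPoints]
  | cons a l ih =>
    simp only [countPoints, bind_val, op_val, ih, List.countP_cons]
    by_cases h : p a <;> simp [h]

@[simp] theorem countPoints_steps (p : ℝ × EReal → Prop) [DecidablePred p]
    (l : List (ℝ × EReal)) : (countPoints p l).steps = 2 * l.length + 1 := by
  induction l with
  | nil => simp [countPoints]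
  | cons a l ih => simp [countPoints, ih]; ring

@[simp] theorem countPoints_diagrams (p : ℝ × EReal → Prop) [DecidablePred p]
    (l : List (ℝ × EReal)) : (countPoints p l).diagrams = 0 := by
  induction l with
  | nil => simp [countPoints]
  | cons a l ih => simp [countPoints, ih]

variable {𝔽 : Type u} [Field 𝔽] {K : Geometry.SimplicialComplex ℝ (Pt d)} {O : Pt d → Diagram}

theorem IsOracle.length_le (hO : IsOracle 𝔽 K O) {s : Pt d} (hs : ‖s‖ = 1) (k : ℕ) :
    (O s k).length ≤ simplexCount K k := by
  obtain ⟨e, he⟩ := hO s hs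
  have := e.card_apd_le 𝔽 k
  rwa [← he k, Multiset.coe_card] at this

theorem IsOracle.count_add_count (hO : IsOracle 𝔽 K O) {s : Pt d} (hs : ‖s‖ = 1) {k : ℕ}
    (hk : 1 ≤ k) (c : ℝ) [DecidablePred fun q : ℝ × EReal => q.2 = (c : EReal)]
    [DecidablePred fun q : ℝ × EReal => q.1 = c] :
    (countPoints (fun q => q.2 = (c : EReal)) (O s (k - 1))).val
        + (countPoints (fun q => q.1 = c) (O s k)).val
      = {t | t ∈ K.faces ∧ t.card = k + 1 ∧ height s t = c}.ncard := by
  obtain ⟨e, he⟩ := hO s hs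
  obtain ⟨j, rfl⟩ : ∃ j, k = j + 1 := ⟨k - 1, by omega⟩
  have := e.countP_death_add_countP_birth 𝔽 j c
  rw [← he, ← he, Multiset.coe_countP, Multiset.coe_countP] at this
  rw [countPoints_val, countPoints_val, ← this]
  simp only [Nat.add_sub_cancel]
  congr!

end CountPoints

/-! ### Heights of simplices -/

section Height

theorem height_eq_iff {s : Pt d} {t : Finset (Pt d)} (ht : t.Nonempty) {c : ℝ} :
    height s t = c ↔ (∃ x ∈ t, inner ℝ s x = c) ∧ ∀ x ∈ t, inner ℝ s x ≤ c := by
  unfold height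
  rw [dif_pos ht]
  constructor
  · rintro rfl
    obtain ⟨x, hx, he⟩ := Finset.exists_mem_eq_sup' ht (fun x => inner ℝ s x)
    exact ⟨⟨x, hx, he.symm⟩, fun y hy => Finset.le_sup' (fun x => inner ℝ s x) hy⟩
  · rintro ⟨⟨x, hx, rfl⟩, h⟩
    exact le_antisymm (Finset.sup'_le ht _ h) (Finset.le_sup' (fun x => inner ℝ s x) hx)

end Height

/-! ### Sorting the simplices at one height by their intersection with σ -/

section FaceCount

variable {K : Geometry.SimplicialComplex ℝ (Pt d)} {V σ τ : List (Pt d)} {P : Pt d → Prop}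

/-- The direction `s` is orthogonal to the face `τ` of `σ`; the other vertices of `σ` are above
`τ`, and the points of `V` outside `σ` are below or above `τ`, depending on whether they
satisfy `P`. -/
structure IsAdapted (V σ : List (Pt d)) (P : Pt d → Prop) (τ : List (Pt d)) (s : Pt d) :
    Prop where
  norm_eq : ‖s‖ = 1
  sublist : τ.Sublist σ
  level : ∀ x ∈ τ, inner ℝ s x = inner ℝ s (τ.headD 0)
  above : ∀ x ∈ σ, x ∉ τ → inner ℝ s (τ.headD 0) < inner ℝ s x
  below : ∀ x ∈ V, x ∉ σ → P x → inner ℝ s x < inner ℝ s (τ.headD 0)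
  not_below : ∀ x ∈ V, x ∉ σ → ¬ P x → inner ℝ s (τ.headD 0) < inner ℝ s x

/-- The number of `k`-simplices that meet `σ` in `ρ` and whose other vertices satisfy `P`. -/
noncomputable def faceCount (K : Geometry.SimplicialComplex ℝ (Pt d)) (k : ℕ) (σ : List (Pt d))
    (P : Pt d → Prop) (ρ : List (Pt d)) : ℕ :=
  open Classical in
  {t | t ∈ K.faces ∧ t.card = k + 1 ∧ (σ.filter fun x => x ∈ t) = ρ ∧
    ∀ x ∈ t, x ∉ σ → P x}.ncard

theorem mem_of_mem_face (hV : ∀ x, x ∈ V ↔ x ∈ K.vertices) {t : Finset (Pt d)} (ht : t ∈ K.faces)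
    {x : Pt d} (hx : x ∈ t) : x ∈ V :=
  (hV x).2 (K.down_closed ht (Finset.singleton_subset_iff.2 hx) (Finset.singleton_nonempty x))

/-- In an adapted direction the only vertices at the level of τ are those of τ, and those allowed
below it are the vertices outside σ that satisfy P. -/
theorem IsAdapted.height_eq_iff {s : Pt d} (h : IsAdapted V σ P τ s)
    (hV : ∀ x, x ∈ V ↔ x ∈ K.vertices) {t : Finset (Pt d)} (ht : t ∈ K.faces) :
    height s t = inner ℝ s (τ.headD 0) ↔
      (∃ x ∈ t, x ∈ τ) ∧ (∀ x ∈ t, x ∈ σ → x ∈ τ) ∧ ∀ x ∈ t, x ∉ σ → P x := by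
  rw [SimplexPredicate.height_eq_iff (K.nonempty_of_mem_faces ht)]
  constructor
  · rintro ⟨⟨x, hx, hxe⟩, hle⟩
    refine ⟨⟨x, hx, ?_⟩, ?_, ?_⟩
    · by_contra hn
      by_cases hσ : x ∈ σ
      · exact (h.above x hσ hn).ne' hxe
      · by_cases hP : P x
        · exact (h.below x (mem_of_mem_face hV ht hx) hσ hP).ne hxe
        · exact (h.not_below x (mem_of_mem_face hV ht hx) hσ hP).ne' hxe
    · intro y hy hσ
      by_contra hn
      exact absurd (hle y hy) (not_le.2 (h.above y hσ hn))
    · intro y hy hσ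
      by_contra hn
      exact absurd (hle y hy) (not_le.2 (h.not_below y (mem_of_mem_face hV ht hy) hσ hn))
  · rintro ⟨⟨x, hx, hxτ⟩, h1, h2⟩
    refine ⟨⟨x, hx, h.level x hxτ⟩, fun y hy => ?_⟩
    by_cases hσ : y ∈ σ
    · exact (h.level y (h1 y hy hσ)).le
    · exact (h.below y (mem_of_mem_face hV ht hy) hσ (h2 y hy hσ)).le

theorem filter_mem_eq_of_sublist {α : Type*} [DecidableEq α] {ρ l : List α} (h : ρ.Sublist l)
    (hl : l.Nodup) : (l.filter fun x => x ∈ ρ) = ρ := by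
  have h1 : ρ.Sublist (l.filter fun x => decide (x ∈ ρ)) := by
    have := h.filter fun x => decide (x ∈ ρ)
    rwa [List.filter_eq_self.2 (by simp)] at this
  refine (h1.eq_of_length_le ?_).symm
  · have hnd : (l.filter fun x => decide (x ∈ ρ)).Nodup := hl.filter _
    exact (hnd.subperm (fun x hx => by simpa using (List.mem_filter.1 hx).2)).length_le

/-- The map t ↦ t ∩ σ sends the simplices at the height of τ to the nonempty faces of τ, and its
fibres no longer refer to the direction. This is the triangular system that `indegree` solves. -/
theorem IsAdapted.ncard_level {s : Pt d} (h : IsAdapted V σ P τ s) (hK : K.faces.Finite)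
    (hV : ∀ x, x ∈ V ↔ x ∈ K.vertices) (hσ : σ.Nodup) (hτ : τ ≠ []) (k : ℕ) :
    {t | t ∈ K.faces ∧ t.card = k + 1 ∧ height s t = inner ℝ s (τ.headD 0)}.ncard
      = faceCount K k σ P τ + ((properFaces τ).map (faceCount K k σ P)).sum := by
  classical
  have hτnd : τ.Nodup := hσ.sublist h.sublist
  set S := {t | t ∈ K.faces ∧ t.card = k + 1 ∧ height s t = inner ℝ s (τ.headD 0)} with hS
  have hfin : S.Finite := hK.subset fun _ ht => ht.1
  have hnotmem : τ ∉ properFaces τ := fun hm => lt_irrefl _ (mem_properFaces.1 hm).2.2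
  have hmem : ∀ ρ, ρ ∈ (τ :: properFaces τ).toFinset ↔ ρ.Sublist τ ∧ ρ ≠ [] := by
    intro ρ
    rw [List.mem_toFinset, List.mem_cons, mem_properFaces]
    constructor
    · rintro (rfl | ⟨h1, h2, -⟩)
      · exact ⟨List.Sublist.refl _, hτ⟩
      · exact ⟨h1, List.length_pos_iff.1 h2⟩
    · rintro ⟨h1, h2⟩
      rcases h1.length_le.lt_or_eq with h3 | h3
      · exact Or.inr ⟨h1, List.length_pos_iff.2 h2, h3⟩
      · exact Or.inl (h1.eq_of_length h3)
  have key := Finset.card_eq_sum_card_fiberwise (s := hfin.toFinset)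
    (t := (τ :: properFaces τ).toFinset)
    (f := fun t : Finset (Pt d) => σ.filter fun x => x ∈ t) (by
      intro t ht
      rw [Set.Finite.coe_toFinset] at ht
      obtain ⟨⟨x, hx, hxτ⟩, h1, -⟩ := (h.height_eq_iff hV ht.1).1 ht.2.2
      rw [Finset.mem_coe, hmem]
      constructor
      -- Since t ∩ σ lies in τ, filtering σ or τ by t gives the same list, so the fibres are indexed
      -- by sublists of τ, which are also the keys of the table.
      · have e1 := filter_mem_eq_of_sublist h.sublist hσ
        have e2 : (σ.filter fun x => decide (x ∈ t)) = τ.filter fun x => decide (x ∈ t) := by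
          conv_rhs => rw [← e1]
          rw [List.filter_filter]
          refine List.filter_congr fun y hy => ?_
          by_cases hyt : y ∈ t
          · simp [hyt, h1 y hyt hy]
          · simp [hyt]
        change (σ.filter fun x => decide (x ∈ t)).Sublist τ
        rw [e2]
        exact List.filter_sublist
      · intro he
        have : x ∈ σ.filter fun x => decide (x ∈ t) := by
          rw [List.mem_filter]; exact ⟨h.sublist.subset hxτ, by simpa using hx⟩
        rw [show (σ.filter fun x => decide (x ∈ t)) = [] from he] at this
        simp at this)
  rw [Set.ncard_eq_toFinset_card S hfin, key, List.sum_toFinset _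
    (List.nodup_cons.2 ⟨hnotmem, nodup_properFaces hτnd⟩)]
  have hfib : ∀ ρ ∈ τ :: properFaces τ,
      (hfin.toFinset.filter fun t => (σ.filter fun x => decide (x ∈ t)) = ρ).card
        = faceCount K k σ P ρ := by
    intro ρ hρ
    obtain ⟨h1, h2⟩ := (hmem ρ).1 (List.mem_toFinset.2 hρ)
    unfold faceCount
    rw [← Set.ncard_coe_finset]
    congr 1
    ext t
    simp only [Finset.coe_filter, Set.Finite.mem_toFinset, hS, Set.mem_ofPred_eq]
    constructor
    · rintro ⟨⟨h3, h4, h5⟩, h6⟩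
      exact ⟨h3, h4, h6, ((h.height_eq_iff hV h3).1 h5).2.2⟩
    · rintro ⟨h3, h4, h5, h6⟩
      refine ⟨⟨h3, h4, (h.height_eq_iff hV h3).2 ⟨?_, ?_, h6⟩⟩, h5⟩
      · obtain ⟨x, hx⟩ := List.exists_mem_of_ne_nil ρ h2
        have hx' := hx
        rw [← h5, List.mem_filter] at hx'
        exact ⟨x, by simpa using hx'.2, h1.subset hx⟩
      · intro x hx hxσ
        refine h1.subset ?_
        rw [← h5, List.mem_filter]
        exact ⟨hxσ, by simpa using hx⟩
  rw [List.map_congr_left hfib, List.map_cons, List.sum_cons]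

theorem IsAdapted.kIndegree_eq {s : Pt d} (h : IsAdapted V σ P σ s)
    (hV : ∀ x, x ∈ V ↔ x ∈ K.vertices) (hσ : σ ≠ []) (k : ℕ) :
    kIndegree K k (vertexSet σ) s = faceCount K k σ P σ := by
  classical
  have hmem : ∀ x, x ∈ vertexSet σ ↔ x ∈ σ := by intro x; simp [vertexSet]
  have hne : (vertexSet σ).Nonempty := by
    obtain ⟨x, hx⟩ := List.exists_mem_of_ne_nil σ hσ
    exact ⟨x, (hmem x).2 hx⟩
  have hh : height s (vertexSet σ) = inner ℝ s (σ.headD 0) := by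
    rw [SimplexPredicate.height_eq_iff hne]
    obtain ⟨x, hx⟩ := hne
    exact ⟨⟨x, hx, h.level x ((hmem x).1 hx)⟩, fun y hy => (h.level y ((hmem y).1 hy)).le⟩
  unfold kIndegree faceCount
  rw [hh]
  congr 1
  ext t
  simp only [Set.mem_ofPred_eq]
  constructor
  · rintro ⟨h1, h2, h3, h4⟩
    refine ⟨h1, h2, ?_, ((h.height_eq_iff hV h1).1 h4).2.2⟩
    rw [List.filter_eq_self]
    intro x hx
    simpa using h3 ((hmem x).2 hx)
  · rintro ⟨h1, h2, h3, h4⟩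
    rw [List.filter_eq_self] at h3
    have h3' : ∀ x ∈ σ, x ∈ t := fun x hx => by simpa using h3 x hx
    refine ⟨h1, h2, fun x hx => h3' x ((hmem x).1 hx), (h.height_eq_iff hV h1).2 ⟨?_, ?_, h4⟩⟩
    · obtain ⟨x, hx⟩ := List.exists_mem_of_ne_nil σ hσ
      exact ⟨x, h3' x hx, hx⟩
    · exact fun x _ hx => hx

end FaceCount

/-! ### Unfolding one call of the recursion -/

section Unfolding

/-- The treatment of one proper face `τ` of `σ` in the loop of `indegree`. -/
noncomputable def faceStep (O : Pt d → Diagram) (V : List (Pt d)) (D : ℝ) (k depth : ℕ)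
    (σ : List (Pt d)) (dir : Pt d) (g : ℝ) (acc : ℤ × Table d) (τ : List (Pt d)) :
    Cost (ℤ × Table d) := do
  let T' ← match acc.2 τ with
    | some _ => op 1 acc.2
    | none => do
      let rest ← without σ τ
      let dir' ← directionAbove τ rest
      let dirT ← tilt g D dir dir'
      let r ← indegree O V D k depth τ dirT acc.2
      store r.2 τ r.1
  op 2 (acc.1 + (T' τ).getD 0, T')

/-- The number of deaths in dimension `k - 1` and births in dimension `k` at the height of `σ`. -/
noncomputable def levelCount (O : Pt d → Diagram) (k : ℕ) (σ : List (Pt d)) (dir : Pt d) : ℤ :=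
  open Classical in
  (countPoints (fun p => p.2 = ((inner ℝ dir (σ.headD 0) : ℝ) : EReal)) (O dir (k - 1))).val
    + (countPoints (fun p => p.1 = inner ℝ dir (σ.headD 0)) (O dir k)).val

variable {O : Pt d → Diagram} {V : List (Pt d)} {D : ℝ} {k depth : ℕ} {σ : List (Pt d)}
  {dir : Pt d} {T : Table d}

/-- The gap used for the tilts in the loop of `indegree`. -/
noncomputable def loopGap (V σ : List (Pt d)) (dir : Pt d) (T : Table d) : Cost ℝ :=
  if (properFaces σ).any fun τ => (T τ).isNone then heightGap dir V else pure 1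

theorem indegree_succ_spec :
    let L := (properFaces σ).foldlM
      (faceStep O V D k depth σ dir (loopGap V σ dir T).val) (0, T)
    (indegree O V D k (depth + 1) σ dir T).val = (levelCount O k σ dir - L.val.1, L.val.2) ∧
    (indegree O V D k (depth + 1) σ dir T).steps
      = 3 * d + 2 * ((O dir (k - 1)).length + (O dir k).length) + 2 * 2 ^ σ.length + 4
        + (loopGap V σ dir T).steps + L.steps ∧
    (indegree O V D k (depth + 1) σ dir T).diagrams
      = 1 + (loopGap V σ dir T).diagrams + L.diagrams := by
  intro L
  have e : indegree O V D k (depth + 1) σ dir T = (do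
    let dgm ← query O dir
    let c ← dot dir (σ.headD 0)
    let numDeaths ← countPoints (fun p => p.2 = (c : EReal)) (dgm (k - 1))
    let numBirths ← countPoints (fun p => p.1 = c) (dgm k)
    let faces ← op (2 ^ σ.length) (properFaces σ)
    let missing ← op (2 ^ σ.length) (faces.any fun τ => (T τ).isNone)
    let g ← if missing then heightGap dir V else pure 1
    let out ← faces.foldlM (faceStep O V D k depth σ dir g) (0, T)
    op 2 (numDeaths + numBirths - out.1, out.2)) := rfl
  by_cases hm : ((properFaces σ).any fun τ => (T τ).isNone) = true
  · have hg : loopGap V σ dir T = heightGap dir V := if_pos hm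
    have hm' : (op (2 ^ σ.length)
        ((op (2 ^ σ.length) (properFaces σ)).val.any fun τ => (T τ).isNone)).val = true := hm
    rw [e]
    simp only [bind_val, bind_steps, bind_diagrams, if_pos hm', L, hg, levelCount]
    simp only [op_val, op_steps, op_diagrams, query_val, query_steps, query_diagrams, dot_steps,
      dot_diagrams, countPoints_val, countPoints_steps, countPoints_diagrams]
    refine ⟨?_, by ring, by ring⟩
    congr!
  · have hg : loopGap V σ dir T = pure 1 := if_neg hm
    have hm' : ¬ (op (2 ^ σ.length)
        ((op (2 ^ σ.length) (properFaces σ)).val.any fun τ => (T τ).isNone)).val = true := hm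
    rw [e]
    simp only [bind_val, bind_steps, bind_diagrams, if_neg hm', L, hg, levelCount]
    simp only [op_val, op_steps, op_diagrams, query_val, query_steps, query_diagrams, dot_steps,
      dot_diagrams, countPoints_val, countPoints_steps, countPoints_diagrams]
    refine ⟨?_, by ring, by ring⟩
    congr!

theorem faceStep_of_some {g : ℝ} {a n : ℤ} {τ : List (Pt d)} (h : T τ = some n) :
    faceStep O V D k depth σ dir g (a, T) τ = op 3 (a + n, T) := by
  unfold faceStep
  simp only [h]
  change (⟨_, _, _⟩ : Cost (ℤ × Table d)) = _
  simp [op, h]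

theorem faceStep_of_none {g : ℝ} {a : ℤ} {τ : List (Pt d)} (h : T τ = none) :
    let dir' := (directionAbove τ (without σ τ).val).val
    let r := indegree O V D k depth τ (tilt g D dir dir').val T
    (faceStep O V D k depth σ dir g (a, T) τ).val
      = (a + r.val.1, (store r.val.2 τ r.val.1).val) ∧
    (faceStep O V D k depth σ dir g (a, T) τ).steps
      = σ.length * (τ.length + 1) + (directionAbove τ (without σ τ).val).steps + (7 * d + 9)
        + r.steps ∧
    (faceStep O V D k depth σ dir g (a, T) τ).diagrams = r.diagrams := by
  intro dir' r
  refine ⟨?_, ?_, ?_⟩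
  · unfold faceStep
    simp only [h, bind_val, op_val]
    simp [store, r, dir']
  · unfold faceStep
    simp only [h, bind_steps, op_steps, tilt_steps, without_steps, store]
    simp only [r, dir']
    ring
  · unfold faceStep
    simp only [h, bind_diagrams, op_diagrams, tilt_diagrams, without_diagrams, store,
      directionAbove_diagrams]
    simp only [r, dir']
    ring

theorem store_val_self (τ : List (Pt d)) (n : ℤ) : (store T τ n).val τ = some n := by
  simp [store]

theorem store_val_of_ne {τ ρ : List (Pt d)} (n : ℤ) (h : ρ ≠ τ) : (store T τ n).val ρ = T ρ := by
  simp [store, h]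

end Unfolding

/-! ### Calls whose faces are all in the table -/

section Known

variable {O : Pt d → Diagram} {V : List (Pt d)} {D : ℝ} {k depth : ℕ} {σ : List (Pt d)}
  {dir : Pt d} {T : Table d}

theorem foldlM_faceStep_of_known {g : ℝ} {N : List (Pt d) → ℕ} {R : List (List (Pt d))}
    (h : ∀ ρ ∈ R, T ρ = some (N ρ : ℤ)) (a : ℤ) :
    R.foldlM (faceStep O V D k depth σ dir g) (a, T)
      = op (3 * R.length) (a + ((R.map N).sum : ℕ), T) := by
  induction R generalizing a with
  | nil => simp; rfl
  | cons ρ R ih =>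
    rw [List.foldlM_cons, faceStep_of_some (h ρ (by simp))]
    change (⟨_, _, _⟩ : Cost (ℤ × Table d)) = _
    simp only [op_val, op_steps, op_diagrams]
    rw [ih fun ρ' hρ' => h ρ' (List.mem_cons_of_mem _ hρ')]
    simp only [op, List.map_cons, List.sum_cons, List.length_cons]
    congr 1
    · push_cast; rw [add_assoc]
    · ring

/-- With every face known no tilt is needed, so recursive calls avoid sorting the heights. -/
theorem loopGap_of_known (h : ∀ ρ ∈ properFaces σ, (T ρ).isSome) :
    loopGap V σ dir T = pure 1 := by
  unfold loopGap
  rw [if_neg]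
  simp only [List.any_eq_true, not_exists, not_and]
  intro ρ hρ
  have := h ρ hρ
  cases hT : T ρ <;> simp_all

end Known

/-! ### Correctness and cost of the indegree computation -/

section Correctness

variable {𝔽 : Type u} [Field 𝔽] {K : Geometry.SimplicialComplex ℝ (Pt d)} {O : Pt d → Diagram}
  {V σ τ : List (Pt d)} {P : Pt d → Prop} {D : ℝ} {k depth : ℕ} {dir : Pt d} {T : Table d}

theorem levelCount_eq (hO : IsOracle 𝔽 K O) (hK : K.faces.Finite)
    (hV : ∀ x, x ∈ V ↔ x ∈ K.vertices) (hσ : σ.Nodup) (hτ : τ ≠ []) (hk : 1 ≤ k)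
    (h : IsAdapted V σ P τ dir) :
    levelCount O k τ dir
      = faceCount K k σ P τ + (((properFaces τ).map (faceCount K k σ P)).sum : ℕ) := by
  classical
  have h1 := hO.count_add_count h.norm_eq hk (inner ℝ dir (τ.headD 0))
  rw [h.ncard_level hK hV hσ hτ] at h1
  rw [levelCount]
  push_cast at h1 ⊢
  rw [← h1]

/-- Subtracting the known proper faces from the level count leaves the term of τ. Listing and
checking the faces costs two powers of two; three steps per face account for the rest of the factor
5. -/
theorem indegree_of_known (hO : IsOracle 𝔽 K O) (hK : K.faces.Finite)
    (hV : ∀ x, x ∈ V ↔ x ∈ K.vertices) (hσ : σ.Nodup) (hτ : τ ≠ []) (hk : 1 ≤ k)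
    (h : IsAdapted V σ P τ dir)
    (hT : ∀ ρ ∈ properFaces τ, T ρ = some (faceCount K k σ P ρ : ℤ)) :
    (indegree O V D k (depth + 1) τ dir T).val = ((faceCount K k σ P τ : ℤ), T) ∧
    (indegree O V D k (depth + 1) τ dir T).steps
      ≤ 3 * d + 2 * (simplexCount K (k - 1) + simplexCount K k) + 5 * 2 ^ τ.length + 4 ∧
    (indegree O V D k (depth + 1) τ dir T).diagrams = 1 := by
  have hs := indegree_succ_spec (O := O) (V := V) (D := D) (k := k) (depth := depth) (σ := τ)
    (dir := dir) (T := T)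
  simp only at hs
  rw [loopGap_of_known (fun ρ hρ => by rw [hT ρ hρ]; rfl), foldlM_faceStep_of_known hT] at hs
  simp only [op_val, op_steps, op_diagrams, pure_steps, pure_diagrams] at hs
  obtain ⟨h1, h2, h3⟩ := hs
  refine ⟨?_, ?_, h3⟩
  · rw [h1, levelCount_eq hO hK hV hσ hτ hk h]
    congr 1
    ring
  · rw [h2]
    have e1 := hO.length_le h.norm_eq (k - 1)
    have e2 := hO.length_le h.norm_eq k
    have e3 := length_properFaces hτ
    omega

/-- The number of steps that `indegree` spends on one missing face. -/
noncomputable def faceSteps (K : Geometry.SimplicialComplex ℝ (Pt d)) (k m : ℕ) : ℕ :=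
  m * (m + 1) + (m * (8 * d + 2 + m * (6 * d + 2)) + (3 * d + 2)) + (7 * d + 9)
    + (3 * d + 2 * (simplexCount K (k - 1) + simplexCount K k) + 5 * 2 ^ m + 4)

/-- Vertices outside σ are strictly above or below σ, so the tilt keeps their sides and P is
unchanged. The vertices of σ are tied, and the new direction lifts those outside τ. -/
theorem IsAdapted.tilt (h : IsAdapted V σ P σ dir) (hσV : ∀ x ∈ σ, x ∈ V) (hσ : σ.Nodup)
    (hgp : ListGeneralPosition V) (hlen : σ.length ≤ d + 1) (hD : IsSpread V D) {g : ℝ}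
    (hg : IsGap dir V g) (hτ : τ ∈ properFaces σ) :
    IsAdapted V σ P τ
      (tilt g D dir (directionAbove τ (without σ τ).val).val).val := by
  obtain ⟨hsub, hpos, hlt⟩ := mem_properFaces.1 hτ
  obtain ⟨w, ws, rfl⟩ := List.exists_cons_of_ne_nil (List.length_pos_iff.1 hpos)
  set X := (without σ (w :: ws)).val with hX
  have hmemX : ∀ x, x ∈ X ↔ x ∈ σ ∧ x ∉ w :: ws := fun x => mem_without
  have hτnd : (w :: ws).Nodup := hσ.sublist hsub
  have hXnd : X.Nodup := by
    rw [hX]; simp only [without, op_val]; exact hσ.filter _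
  have hXne : X ≠ [] := by
    intro he
    have hsubset : σ ⊆ w :: ws := by
      intro x hx
      by_contra hn
      have := (hmemX x).2 ⟨hx, hn⟩
      rw [he] at this
      simp at this
    have := (hσ.subperm hsubset).length_le
    omega
  have hnd : (w :: ws ++ X).Nodup := by
    rw [List.nodup_append]
    refine ⟨hτnd, hXnd, ?_⟩
    rintro x hx y hy rfl
    exact ((hmemX x).1 hy).2 hx
  have hsubset : w :: ws ++ X ⊆ σ := by
    intro x hx
    rcases List.mem_append.1 hx with hx | hx
    · exact hsub.subset hx
    · exact ((hmemX x).1 hx).1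
  have hind : ListAffineIndep (w :: ws ++ X) :=
    hgp _ hnd (fun x hx => hσV x (hsubset hx)) ((hnd.subperm hsubset).length_le.trans hlen)
  obtain ⟨h1, h2, h3⟩ := directionAbove_spec hXne hnd hind
  have ht := isTilt_tilt hg hD h.norm_eq h1
  have hwσ : w ∈ σ := hsub.subset (by simp)
  have hw := h.level w hwσ
  refine ⟨ht.norm_eq, hsub, ?_, ?_, ?_, ?_⟩
  · intro x hx
    exact ht.eq_of_eq x w ((h.level x (hsub.subset hx)).trans hw.symm) (h2 x hx)
  · intro x hx hn
    exact ht.lt_of_eq w x (hw.trans (h.level x hx).symm) (h3 x ((hmemX x).2 ⟨hx, hn⟩))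
  · intro x hx hn hP
    refine ht.lt_of_lt x hx w (hσV w hwσ) ?_
    rw [hw]; exact h.below x hx hn hP
  · intro x hx hn hP
    refine ht.lt_of_lt w (hσV w hwσ) x hx ?_
    rw [hw]; exact h.not_below x hx hn hP

theorem length_without_le (hσ : σ.Nodup) (hsub : τ.Sublist σ) :
    τ.length + (without σ τ).val.length ≤ σ.length := by
  have hnd : (τ ++ (without σ τ).val).Nodup := by
    rw [List.nodup_append]
    refine ⟨hσ.sublist hsub, ?_, ?_⟩
    · simp only [without, op_val]; exact hσ.filter _
    · rintro x hx y hy rfl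
      exact (mem_without.1 hy).2 hx
  rw [← List.length_append]
  refine (hnd.subperm fun x hx => ?_).length_le
  rcases List.mem_append.1 hx with hx | hx
  · exact hsub.subset hx
  · exact (mem_without.1 hx).1

/-- Invariant of the loop: the treated faces Q have their counts in the table and the remaining
faces R are blank. Each face of R then costs one diagram. -/
theorem foldlM_faceStep_of_missing (hO : IsOracle 𝔽 K O) (hK : K.faces.Finite)
    (hV : ∀ x, x ∈ V ↔ x ∈ K.vertices) (hσ : σ.Nodup) (hk : 1 ≤ k)
    (h : IsAdapted V σ P σ dir) (hσV : ∀ x ∈ σ, x ∈ V)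
    (hgp : ListGeneralPosition V) (hlen : σ.length ≤ d + 1) (hD : IsSpread V D) {g : ℝ}
    (hg : IsGap dir V g) (R : List (List (Pt d))) :
    ∀ (Q : List (List (Pt d))) (a : ℤ) (T : Table d), properFaces σ = Q ++ R →
      (∀ ρ ∈ Q, T ρ = some (faceCount K k σ P ρ : ℤ)) → (∀ ρ ∈ R, T ρ = none) →
      let L := R.foldlM (faceStep O V D k (depth + 1) σ dir g) (a, T)
      L.val.1 = a + ((R.map (faceCount K k σ P)).sum : ℕ) ∧
      L.steps ≤ R.length * faceSteps K k σ.length ∧ L.diagrams = R.length := by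
  induction R with
  | nil => intro Q a T _ _ _; simp
  | cons τ R ih =>
    intro Q a T hQR hQ hR
    have hτ : τ ∈ properFaces σ := by rw [hQR]; simp
    obtain ⟨hsub, hpos, hlt⟩ := mem_properFaces.1 hτ
    have hτne : τ ≠ [] := List.length_pos_iff.1 hpos
    have hnd := nodup_properFaces hσ
    have hpw := pairwise_length_properFaces σ
    rw [hQR] at hnd hpw
    -- A proper face of τ is shorter than τ, so by the ordering it cannot be among the remaining
    -- faces.
    have hknown : ∀ ρ ∈ properFaces τ, T ρ = some (faceCount K k σ P ρ : ℤ) := by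
      intro ρ hρ
      obtain ⟨h1, h2, h3⟩ := mem_properFaces.1 hρ
      have hρσ : ρ ∈ properFaces σ := mem_properFaces.2 ⟨h1.trans hsub, h2, h3.trans hlt⟩
      rw [hQR, List.mem_append, List.mem_cons] at hρσ
      rcases hρσ with h4 | rfl | h4
      · exact hQ ρ h4
      · exact absurd h3 (lt_irrefl _)
      · have := (List.pairwise_cons.1 (List.pairwise_append.1 hpw).2.1).1 ρ h4
        omega
    have hadapt := h.tilt hσV hσ hgp hlen hD hg hτ
    obtain ⟨hv, hst, hdg⟩ := indegree_of_known (D := D) (depth := depth) hO hK hV hσ hτne hk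
      hadapt hknown
    have hstep := faceStep_of_none (O := O) (V := V) (D := D) (k := k) (depth := depth + 1)
      (σ := σ) (dir := dir) (g := g) (a := a) (hR τ (by simp))
    simp only at hstep
    rw [hv] at hstep
    obtain ⟨s1, s2, s3⟩ := hstep
    obtain ⟨hτR, hRnd⟩ := List.nodup_cons.1 (List.nodup_append.1 hnd).2.1
    have hdisj := (List.nodup_append.1 hnd).2.2
    have hrec := ih (Q ++ [τ]) (a + (faceCount K k σ P τ : ℤ))
      (store T τ (faceCount K k σ P τ : ℤ)).val (by rw [hQR]; simp)
      (by
        intro ρ hρ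
        rcases List.mem_append.1 hρ with hρ | hρ
        · rw [store_val_of_ne _ (hdisj ρ hρ τ (by simp))]; exact hQ ρ hρ
        · rw [List.mem_singleton.1 hρ, store_val_self])
      (by
        intro ρ hρ
        rw [store_val_of_ne _ (fun e : ρ = τ => hτR (by rw [← e]; exact hρ))]
        exact hR ρ (List.mem_cons_of_mem _ hρ))
    simp only at hrec ⊢
    rw [List.foldlM_cons]
    simp only [bind_val, bind_steps, bind_diagrams, s1, s2, s3, hdg]
    obtain ⟨r1, r2, r3⟩ := hrec
    refine ⟨?_, ?_, ?_⟩
    · rw [r1, List.map_cons, List.sum_cons]; push_cast; ring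
    · have e1 := directionAbove_steps_le τ (without σ τ).val
      have e2 := length_without_le hσ hsub
      have e3 : (τ.length + (without σ τ).val.length) * (8 * d + 2
          + (τ.length + (without σ τ).val.length) * (6 * d + 2))
          ≤ σ.length * (8 * d + 2 + σ.length * (6 * d + 2)) := by gcongr
      have e4 : σ.length * (τ.length + 1) ≤ σ.length * (σ.length + 1) := by gcongr
      have e5 : 2 ^ τ.length ≤ 2 ^ σ.length := Nat.pow_le_pow_right (by norm_num) hlt.le
      have e6 : σ.length * (τ.length + 1) + (directionAbove τ (without σ τ).val).steps
          + (7 * d + 9) + (indegree O V D k (depth + 1) τ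
            (SimplexPredicate.tilt g D dir (directionAbove τ (without σ τ).val).val).val T).steps
          ≤ faceSteps K k σ.length := by
        unfold faceSteps
        omega
      rw [List.length_cons, Nat.add_mul, one_mul]
      omega
    · rw [r3, List.length_cons, add_comm]

theorem indegree_of_empty (hO : IsOracle 𝔽 K O) (hK : K.faces.Finite)
    (hV : ∀ x, x ∈ V ↔ x ∈ K.vertices) (hσ : σ.Nodup) (hne : σ ≠ []) (hk : 1 ≤ k)
    (h : IsAdapted V σ P σ dir) (hσV : ∀ x ∈ σ, x ∈ V)
    (hgp : ListGeneralPosition V) (hlen : σ.length ≤ d + 1) (hD : IsSpread V D) :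
    (indegree O V D k σ.length σ dir (fun _ => none)).val.1 = faceCount K k σ P σ ∧
    (indegree O V D k σ.length σ dir (fun _ => none)).steps
      ≤ (heightGap dir V).steps + 2 ^ σ.length * faceSteps K k σ.length ∧
    (indegree O V D k σ.length σ dir (fun _ => none)).diagrams = 2 ^ σ.length - 1 := by
  have hlp := length_properFaces hne
  have hpos := List.length_pos_iff.2 hne
  -- For a vertex there is no loop. Otherwise the depth is at least two, and only one level of
  -- recursion is used.
  by_cases h1 : σ.length = 1
  · have hnil : properFaces σ = [] := by
      rw [h1] at hlp
      exact List.length_eq_zero_iff.1 (by omega)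
    have := indegree_of_known (D := D) (depth := 0) (T := fun _ => none) hO hK hV hσ hne hk h
      (by simp [hnil])
    rw [h1] at this ⊢
    obtain ⟨h2, h3, h4⟩ := this
    refine ⟨by rw [h2], ?_, by rw [h4]; norm_num⟩
    refine h3.trans ?_
    unfold faceSteps
    omega
  · obtain ⟨m, hm⟩ : ∃ m, σ.length = m + 2 := ⟨σ.length - 2, by omega⟩
    have hs := indegree_succ_spec (O := O) (V := V) (D := D) (k := k) (depth := m + 1) (σ := σ)
      (dir := dir) (T := fun _ => none)
    have hgap : loopGap V σ dir (fun _ => none) = heightGap dir V := by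
      unfold loopGap
      rw [if_pos]
      have hp : properFaces σ ≠ [] := by
        have : 2 ^ 2 ≤ 2 ^ σ.length := Nat.pow_le_pow_right (by norm_num) (by omega)
        exact List.length_pos_iff.1 (by omega)
      obtain ⟨ρ, hρ⟩ := List.exists_mem_of_ne_nil _ hp
      simp only [List.any_eq_true]
      exact ⟨ρ, hρ, rfl⟩
    simp only [hgap] at hs
    have hf := foldlM_faceStep_of_missing (depth := m) hO hK hV hσ hk h hσV hgp hlen hD
      (isGap_heightGap dir V) (properFaces σ) [] 0 (fun _ => none) rfl (by simp) (fun _ _ => rfl)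
    simp only at hf
    rw [show m + 1 + 1 = σ.length by omega] at hs
    obtain ⟨h2, h3, h4⟩ := hs
    obtain ⟨f1, f2, f3⟩ := hf
    refine ⟨?_, ?_, ?_⟩
    · rw [h2]
      simp only
      rw [f1, levelCount_eq hO hK hV hσ hne hk h]
      ring
    · rw [h3]
      have e1 := hO.length_le h.norm_eq (k - 1)
      have e2 := hO.length_le h.norm_eq k
      have e3 : 3 * d + 2 * ((O dir (k - 1)).length + (O dir k).length) + 2 * 2 ^ σ.length + 4
          ≤ faceSteps K k σ.length := by
        unfold faceSteps
        omega
      -- The empty face and σ are not in the loop; their unused share of the bound pays for the call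
      -- on σ itself.
      have e4 : (properFaces σ).length * faceSteps K k σ.length + 2 * faceSteps K k σ.length
          = 2 ^ σ.length * faceSteps K k σ.length := by rw [← Nat.add_mul, hlp]
      omega
    · rw [h4, f3, heightGap_diagrams]
      omega

theorem computeIndegree_spec (hO : IsOracle 𝔽 K O) (hK : K.faces.Finite)
    (hV : ∀ x, x ∈ V ↔ x ∈ K.vertices) (hσ : σ.Nodup) (hne : σ ≠ []) (hk : 1 ≤ k)
    (h : IsAdapted V σ P σ dir) (hσV : ∀ x ∈ σ, x ∈ V)
    (hgp : ListGeneralPosition V) (hlen : σ.length ≤ d + 1) (hV2 : ∃ q ∈ V, q ≠ σ.headD 0) :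
    (computeIndegree O V k σ dir).val = kIndegree K k (vertexSet σ) dir ∧
    (computeIndegree O V k σ dir).steps
      ≤ V.length * (5 * d + 5) + 5 * (V.length * Nat.clog 2 V.length) + 6
        + 2 ^ σ.length * faceSteps K k σ.length ∧
    (computeIndegree O V k σ dir).diagrams = 2 ^ σ.length - 1 := by
  obtain ⟨h1, h2, h3⟩ := indegree_of_empty hO hK hV hσ hne hk h hσV hgp hlen
    (isSpread_spreadBound hV2)
  simp only [computeIndegree, bind_val, bind_steps, bind_diagrams, pure_val, pure_steps,
    pure_diagrams, spreadBound_steps, spreadBound_diagrams, h3]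
  refine ⟨?_, ?_, ?_⟩
  · rw [h1, h.kIndegree_eq hV hne]
  · have := heightGap_steps_le dir V
    have e : V.length * (3 * d + 1) + V.length * (2 * d + 4) = V.length * (5 * d + 5) := by ring
    omega
  · omega

end Correctness

/-! ### Numbers of simplices -/

section Counts

variable {K : Geometry.SimplicialComplex ℝ (Pt d)}

theorem simplexCount_zero_eq {V : List (Pt d)} (hV : ∀ x, x ∈ V ↔ x ∈ K.vertices)
    (hnd : V.Nodup) : simplexCount K 0 = V.length := by
  classical
  have h : {s | s ∈ K.faces ∧ s.card = 0 + 1}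
      = ((V.toFinset.image fun x => ({x} : Finset (Pt d)) : Finset (Finset (Pt d))) :
        Set (Finset (Pt d))) := by
    ext s
    simp only [Set.mem_ofPred_eq, Finset.coe_image, Set.mem_image, Finset.mem_coe,
      List.mem_toFinset, zero_add, Finset.card_eq_one]
    constructor
    · rintro ⟨h1, x, rfl⟩
      exact ⟨x, (hV x).2 h1, rfl⟩
    · rintro ⟨x, hx, rfl⟩
      exact ⟨(hV x).1 hx, x, rfl⟩
  rw [simplexCount, h, Set.ncard_coe_finset,
    Finset.card_image_of_injective _ Finset.singleton_injective, List.toFinset_card_of_nodup hnd]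

/-- Every k-simplex is the union of a vertex and a facet. This removes n_k from the time bound. -/
theorem simplexCount_le_mul (hK : K.faces.Finite) {k : ℕ} (hk : 1 ≤ k) :
    simplexCount K k ≤ simplexCount K 0 * simplexCount K (k - 1) := by
  classical
  unfold simplexCount
  rw [← Set.ncard_prod]
  have hfin : ∀ j, {s | s ∈ K.faces ∧ s.card = j + 1}.Finite := fun j => hK.subset fun _ h => h.1
  refine (Set.ncard_le_ncard (t := (fun p : Finset (Pt d) × Finset (Pt d) => p.1 ∪ p.2) ''
    ({s | s ∈ K.faces ∧ s.card = 0 + 1} ×ˢ {s | s ∈ K.faces ∧ s.card = k - 1 + 1})) ?_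
    (((hfin 0).prod (hfin (k - 1))).image _)).trans
    (Set.ncard_image_le ((hfin 0).prod (hfin (k - 1))))
  rintro t ⟨ht, hcard⟩
  obtain ⟨x, hx⟩ := K.nonempty_of_mem_faces ht
  refine ⟨({x}, t.erase x), ⟨⟨?_, by simp⟩, ?_, ?_⟩, ?_⟩
  · exact K.down_closed ht (Finset.singleton_subset_iff.2 hx) (Finset.singleton_nonempty x)
  · refine K.down_closed ht (Finset.erase_subset _ _) ?_
    rw [← Finset.card_pos, Finset.card_erase_of_mem hx]; omega
  · change (t.erase x).card = k - 1 + 1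
    rw [Finset.card_erase_of_mem hx]; omega
  · change {x} ∪ t.erase x = t
    rw [← Finset.insert_eq, Finset.insert_erase hx]

end Counts

/-! ### Absorbing the costs into the stated bound -/

section Bounds

/-- Used with d k² ≤ k⁴ + d² to absorb the Gram-Schmidt cost of one face. -/
theorem pow_four_le_two_pow (k : ℕ) : k ^ 4 ≤ 32 * 2 ^ k := by
  rcases lt_or_ge k 6 with h | h
  · interval_cases k <;> norm_num
  · induction k, h using Nat.le_induction with
    | base => norm_num
    | succ k hk ih =>
      have h1 : (k + 1) ^ 4 ≤ 2 * k ^ 4 := by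
        have e : (k + 1) ^ 4 = k ^ 4 + (4 * k ^ 3 + 6 * k ^ 2 + 4 * k + 1) := by ring
        have e1 : k ^ 2 * 36 ≤ k ^ 4 := by nlinarith [Nat.mul_le_mul hk hk, sq_nonneg (k ^ 2)]
        have e2 : 6 * k ^ 3 ≤ k ^ 4 := by
          rw [pow_succ k 3, mul_comm]; exact Nat.mul_le_mul_left _ hk
        have e3 : 6 * k ≤ k ^ 2 := by rw [pow_two]; exact Nat.mul_le_mul_right _ hk
        rw [e]
        omega
      calc (k + 1) ^ 4 ≤ 2 * k ^ 4 := h1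
        _ ≤ 2 * (32 * 2 ^ k) := Nat.mul_le_mul_left _ ih
        _ = 32 * 2 ^ (k + 1) := by ring

/-- For n ≥ 2, `clog` is at most 1 + log₂ n ≤ 2 log₂ n, and 2 / log 2 < 3. -/
theorem clog_two_le_log {n : ℕ} (hn : 2 ≤ n) : (Nat.clog 2 n : ℝ) ≤ 3 * Real.log n := by
  have h1 : 2 ^ (Nat.clog 2 n - 1) < n := Nat.pow_pred_clog_lt_self (by norm_num) (by omega)
  have hc : 1 ≤ Nat.clog 2 n := Nat.clog_pos (by norm_num) hn
  have h2 : ((Nat.clog 2 n - 1 : ℕ) : ℝ) * Real.log 2 ≤ Real.log n := by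
    rw [← Real.log_pow]
    refine Real.log_le_log (by positivity) ?_
    exact_mod_cast h1.le
  have h3 : Real.log 2 ≤ Real.log n := Real.log_le_log (by norm_num) (by exact_mod_cast hn)
  have h4 := Real.log_two_gt_d9
  push_cast [Nat.cast_sub hc] at h2
  have h5 : (0 : ℝ) ≤ Nat.clog 2 n := Nat.cast_nonneg _
  nlinarith

theorem time_le_of_steps_le {n a k S : ℕ} {Θ : ℝ} (hn : 2 ≤ n)
    (hS : S ≤ 220 * (d * n) + 2 ^ k * (210 * (n * Nat.clog 2 n) + 8 * (n * a) + 312 * d ^ 2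
      + 800 * 2 ^ (k - 1))) (hΘ : 0 ≤ Θ) :
    (S : ℝ) + Θ * (2 * 2 ^ k) ≤ 1000 * ((d : ℝ) * n + 2 ^ k *
      ((n : ℝ) * a + n * Real.log n + (d : ℝ) ^ 2 + 2 ^ (k - 1) + Θ)) := by
  have hS' : (S : ℝ) ≤ 220 * ((d : ℝ) * n) + 2 ^ k * (210 * ((n : ℝ) * Nat.clog 2 n)
      + 8 * ((n : ℝ) * a) + 312 * (d : ℝ) ^ 2 + 800 * 2 ^ (k - 1)) := by exact_mod_cast hS
  have hl : (n : ℝ) * Nat.clog 2 n ≤ 3 * (n * Real.log n) := by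
    have := mul_le_mul_of_nonneg_left (clog_two_le_log hn) (Nat.cast_nonneg (α := ℝ) n)
    linarith
  have hlog : 0 ≤ (n : ℝ) * Real.log n :=
    mul_nonneg (Nat.cast_nonneg n) (Real.log_natCast_nonneg n)
  have hA : 0 ≤ (n : ℝ) * a := by positivity
  have hD : 0 ≤ (d : ℝ) ^ 2 := by positivity
  have hH : (0 : ℝ) ≤ 2 ^ (k - 1) := by positivity
  have hdn : 0 ≤ (d : ℝ) * n := by positivity
  have hinner : (2 : ℝ) ^ k * (210 * ((n : ℝ) * Nat.clog 2 n) + 8 * ((n : ℝ) * a)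
        + 312 * (d : ℝ) ^ 2 + 800 * 2 ^ (k - 1) + 2 * Θ)
      ≤ 2 ^ k * (1000 * ((n : ℝ) * a + n * Real.log n + (d : ℝ) ^ 2 + 2 ^ (k - 1) + Θ)) :=
    mul_le_mul_of_nonneg_left (by linarith) (by positivity)
  linarith

/-- The coefficient 48 is 3 + 3 + 8 + 6 + 13 + 15, from the terms of lower order; 6 k⁴ contributes
384 and 5 · 2^k contributes 10 to the coefficient 400 of 2^(k-1). -/
theorem faceSteps_le {K : Geometry.SimplicialComplex ℝ (Pt d)} (hK : K.faces.Finite) {k : ℕ}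
    (hk : 1 ≤ k) (hkd : k < d) (hn : 1 ≤ simplexCount K 0) :
    faceSteps K k k ≤ 4 * (simplexCount K 0 * simplexCount K (k - 1)) + 48 * d ^ 2
      + 400 * 2 ^ (k - 1) := by
  have h1 := simplexCount_le_mul hK hk
  have h2 : simplexCount K (k - 1) ≤ simplexCount K 0 * simplexCount K (k - 1) :=
    Nat.le_mul_of_pos_left _ hn
  have h3 := pow_four_le_two_pow k
  have h4 : 2 ^ k = 2 * 2 ^ (k - 1) := by rw [← pow_succ']; congr 1; omega
  have h5 : d * k ^ 2 ≤ k ^ 4 + d ^ 2 := by nlinarith [sq_nonneg ((d : ℤ) - k ^ 2)]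
  have h6 : d * k ≤ d ^ 2 := by rw [pow_two]; exact Nat.mul_le_mul_left _ hkd.le
  have h7 : k ^ 2 ≤ d ^ 2 := Nat.pow_le_pow_left hkd.le 2
  have h8 : d ≤ d ^ 2 := by rw [pow_two]; exact Nat.le_mul_of_pos_right _ (by omega)
  have e : faceSteps K k k = 3 * k ^ 2 + 3 * k + 8 * (d * k) + 6 * (d * k ^ 2) + 13 * d + 15
      + 2 * (simplexCount K (k - 1) + simplexCount K k) + 5 * 2 ^ k := by
    unfold faceSteps; ring
  rw [e]
  omega

end Bounds

theorem mem_lowerHalfSpace {s : Pt d} {c : ℝ} {x : Pt d} :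
    x ∈ lowerHalfSpace s c ↔ inner ℝ s x ≤ c := Iff.rfl

/-! ### The wedge detects the simplex -/

namespace IsWedge

variable {V ws : List (Pt d)} {w v sL sU : Pt d}

/-- P can be taken to mean below σ, because no vertex outside σ lies at its level. -/
theorem isAdapted_lower (h : IsWedge V w ws v sL sU) :
    IsAdapted V (w :: ws) (fun x => inner ℝ sL x < inner ℝ sL w) (w :: ws) sL where
  norm_eq := h.norm_lower
  sublist := List.Sublist.refl _
  level := h.lower_eq
  above x hx hn := absurd hx hn
  below x _ _ hP := hP
  not_below x hx hn hP := by
    by_cases hv : x = v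
    · rw [hv]; exact h.lower_lt
    · rcases h.same_side x hx hn hv with h1 | h1
      · exact absurd h1.1 hP
      · exact h1.1

theorem isAdapted_upper (h : IsWedge V w ws v sL sU) :
    IsAdapted V (w :: ws) (fun x => inner ℝ sU x < inner ℝ sU w) (w :: ws) sU where
  norm_eq := h.norm_upper
  sublist := List.Sublist.refl _
  level := h.upper_eq
  above x hx hn := absurd hx hn
  below x _ _ hP := hP
  not_below x hx hn hP := by
    by_cases hv : x = v
    · rw [hv] at hP; exact absurd h.upper_lt hP
    · rcases h.same_side x hx hn hv with h1 | h1
      · exact absurd h1.2 hP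
      · exact h1.2

/-- A vertex other than v is strictly on the same side for both directions, hence has a
neighbourhood that misses the symmetric difference. The vertex v lies in the symmetric difference
itself. -/
theorem inter_wedge_eq (h : IsWedge V w ws v sL sU) {A : Set (Pt d)} (hV : ∀ x, x ∈ V ↔ x ∈ A)
    (hv : v ∈ A) (hvσ : v ∉ w :: ws) :
    {q | q ∈ A ∧ q ∉ w :: ws} ∩ wedge sL (inner ℝ sL w) sU (inner ℝ sU w) = {v} := by
  have hcont : ∀ s : Pt d, Continuous fun x : Pt d => inner ℝ s x := fun s => by fun_prop
  ext q
  simp only [Set.mem_inter_iff, Set.mem_ofPred_eq, Set.mem_singleton_iff]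
  constructor
  · rintro ⟨⟨hq, hqσ⟩, hw⟩
    by_contra hne
    rw [wedge, mem_closure_iff] at hw
    rcases h.same_side q ((hV q).2 hq) hqσ hne with h1 | h1
    · obtain ⟨x, ⟨hx1, hx2⟩, hx⟩ := hw
        ({x | inner ℝ sL x < inner ℝ sL w} ∩ {x | inner ℝ sU x < inner ℝ sU w})
        ((isOpen_lt (hcont sL) continuous_const).inter (isOpen_lt (hcont sU) continuous_const)) h1
      rcases Set.mem_symmDiff.1 hx with h2 | h2
      · exact h2.2 (mem_lowerHalfSpace.2 (le_of_lt hx2))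
      · exact h2.2 (mem_lowerHalfSpace.2 (le_of_lt hx1))
    · obtain ⟨x, ⟨hx1, hx2⟩, hx⟩ := hw
        ({x | inner ℝ sL w < inner ℝ sL x} ∩ {x | inner ℝ sU w < inner ℝ sU x})
        ((isOpen_lt continuous_const (hcont sL)).inter (isOpen_lt continuous_const (hcont sU))) h1
      rcases Set.mem_symmDiff.1 hx with h2 | h2
      · exact absurd (mem_lowerHalfSpace.1 h2.1) (not_le.2 hx1)
      · exact absurd (mem_lowerHalfSpace.1 h2.1) (not_le.2 hx2)
  · rintro rfl
    refine ⟨⟨hv, hvσ⟩, subset_closure (Set.mem_symmDiff.2 (Or.inr ⟨?_, ?_⟩))⟩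
    · exact le_of_lt h.upper_lt
    · exact not_le.2 h.lower_lt

/-- The simplices counted for sL are those counted for sU that avoid v. One that contains both σ and
v has no room for another vertex. -/
theorem abs_kIndegree_sub_eq_one_iff (h : IsWedge V w ws v sL sU)
    {K : Geometry.SimplicialComplex ℝ (Pt d)} (hK : K.faces.Finite)
    (hV : ∀ x, x ∈ V ↔ x ∈ K.vertices) (hnd : (w :: ws).Nodup) (hvσ : v ∉ w :: ws) :
    |(kIndegree K (w :: ws).length (vertexSet (w :: ws)) sU : ℤ)
        - kIndegree K (w :: ws).length (vertexSet (w :: ws)) sL| = 1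
      ↔ vertexSet (v :: w :: ws) ∈ K.faces := by
  classical
  set σ := w :: ws with hσdef
  have hmem : ∀ (l : List (Pt d)) x, x ∈ vertexSet l ↔ x ∈ l := by intro l x; simp [vertexSet]
  have hcardσ : (vertexSet σ).card = σ.length := by
    simp only [vertexSet]; exact List.toFinset_card_of_nodup hnd
  have hins : vertexSet (v :: σ) = insert v (vertexSet σ) := by ext; simp [hmem]
  have hvσ' : v ∉ vertexSet σ := fun hv => hvσ ((hmem _ _).1 hv)
  have hheight : ∀ {s : Pt d} {P : Pt d → Prop}, IsAdapted V σ P σ s → ∀ {t}, t ∈ K.faces →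
      vertexSet σ ⊆ t → (height s t = height s (vertexSet σ) ↔ ∀ x ∈ t, x ∉ σ → P x) := by
    intro s P ha t ht hsub
    have hne : (vertexSet σ).Nonempty := ⟨w, (hmem _ _).2 (by simp [hσdef])⟩
    have hface : vertexSet σ ∈ K.faces := K.down_closed ht hsub hne
    have e : height s (vertexSet σ) = inner ℝ s (σ.headD 0) :=
      (ha.height_eq_iff hV hface).2 ⟨⟨w, (hmem _ _).2 (by simp [hσdef]), by simp [hσdef]⟩,
        fun x _ hx => hx, fun x hx hn => absurd ((hmem _ _).1 hx) hn⟩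
    rw [e, ha.height_eq_iff hV ht]
    refine ⟨fun h => h.2.2, fun h => ⟨⟨w, hsub ((hmem _ _).2 (by simp [hσdef])),
      by simp [hσdef]⟩, fun x _ hx => hx, h⟩⟩
  unfold kIndegree
  set AL := {t | t ∈ K.faces ∧ t.card = σ.length + 1 ∧ vertexSet σ ⊆ t ∧
    height sL t = height sL (vertexSet σ)} with hAL
  set AU := {t | t ∈ K.faces ∧ t.card = σ.length + 1 ∧ vertexSet σ ⊆ t ∧
    height sU t = height sU (vertexSet σ)} with hAU
  have hiff : ∀ t, t ∈ AL ↔ t ∈ AU ∧ v ∉ t := by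
    intro t
    simp only [hAL, hAU, Set.mem_ofPred_eq]
    constructor
    · rintro ⟨h1, h2, h3, h4⟩
      rw [hheight h.isAdapted_lower h1 h3] at h4
      have hvt : v ∉ t := fun hv => lt_asymm h.lower_lt (h4 v hv hvσ)
      refine ⟨⟨h1, h2, h3, (hheight h.isAdapted_upper h1 h3).2 fun x hx hn => ?_⟩, hvt⟩
      rcases h.same_side x (mem_of_mem_face hV h1 hx) hn (fun e => hvt (e ▸ hx)) with h5 | h5
      · exact h5.2
      · exact absurd (h4 x hx hn) (lt_asymm h5.1)
    · rintro ⟨⟨h1, h2, h3, h4⟩, hvt⟩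
      rw [hheight h.isAdapted_upper h1 h3] at h4
      refine ⟨h1, h2, h3, (hheight h.isAdapted_lower h1 h3).2 fun x hx hn => ?_⟩
      rcases h.same_side x (mem_of_mem_face hV h1 hx) hn (fun e => hvt (e ▸ hx)) with h5 | h5
      · exact h5.1
      · exact absurd (h4 x hx hn) (lt_asymm h5.2)
  have hAUv : ∀ t, t ∈ AU ∧ v ∈ t ↔ t = vertexSet (v :: σ) ∧ vertexSet (v :: σ) ∈ K.faces := by
    intro t
    simp only [hAU, Set.mem_ofPred_eq]
    constructor
    · rintro ⟨⟨h1, h2, h3, -⟩, hvt⟩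
      have e : vertexSet (v :: σ) = t := by
        rw [hins]
        refine Finset.eq_of_subset_of_card_le (Finset.insert_subset hvt h3) ?_
        rw [Finset.card_insert_of_notMem hvσ', hcardσ, h2]
      exact ⟨e.symm, e ▸ h1⟩
    · rintro ⟨rfl, h1⟩
      have hsub : vertexSet σ ⊆ vertexSet (v :: σ) := by rw [hins]; exact Finset.subset_insert _ _
      refine ⟨⟨h1, by rw [hins, Finset.card_insert_of_notMem hvσ', hcardσ], hsub,
        (hheight h.isAdapted_upper h1 hsub).2 fun x hx hn => ?_⟩, (hmem _ _).2 (by simp)⟩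
      rcases List.mem_cons.1 ((hmem _ _).1 hx) with rfl | hx
      · exact h.upper_lt
      · exact absurd hx hn
  have hfin : AL.Finite := hK.subset fun _ ht => ht.1
  by_cases hf : vertexSet (v :: σ) ∈ K.faces
  · have e : AU = insert (vertexSet (v :: σ)) AL := by
      ext t
      rw [Set.mem_insert_iff, hiff]
      have := hAUv t
      tauto
    have hn : vertexSet (v :: σ) ∉ AL := fun hm => ((hiff _).1 hm).2 ((hmem _ _).2 (by simp))
    rw [e, Set.ncard_insert_of_notMem hn hfin]
    simp [hf]
  · have e : AU = AL := by
      ext t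
      rw [hiff]
      have := hAUv t
      tauto
    rw [e]
    simp [hf]

end IsWedge

theorem isSimplex_val (O : Pt d → Diagram) (V σ : List (Pt d)) (v : Pt d) :
    (isSimplex O V σ v).val
      = decide (|(computeIndegree O V σ.length σ (wedgeDirections V σ v).val.2).val
        - (computeIndegree O V σ.length σ (wedgeDirections V σ v).val.1).val| = 1) := rfl

theorem isSimplex_steps (O : Pt d → Diagram) (V σ : List (Pt d)) (v : Pt d) :
    (isSimplex O V σ v).steps
      = (wedgeDirections V σ v).steps
        + (computeIndegree O V σ.length σ (wedgeDirections V σ v).val.2).steps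
        + (computeIndegree O V σ.length σ (wedgeDirections V σ v).val.1).steps + 4 := by
  simp only [isSimplex, bind_steps, op_steps, op_val]
  ring

theorem isSimplex_diagrams (O : Pt d → Diagram) (V σ : List (Pt d)) (v : Pt d) :
    (isSimplex O V σ v).diagrams
      = (computeIndegree O V σ.length σ (wedgeDirections V σ v).val.2).diagrams
        + (computeIndegree O V σ.length σ (wedgeDirections V σ v).val.1).diagrams := by
  simp only [isSimplex, bind_diagrams, op_diagrams, op_val, wedgeDirections_diagrams]
  ring

end SimplexPredicate

/-! ### The main theorem -/

theorem mainTheorem3 :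
    ∃ C : ℝ, ∀ (𝔽 : Type u) [Field 𝔽] (d : ℕ) (K : Geometry.SimplicialComplex ℝ (Pt d))
      (_ : K.faces.Finite) (_ : AffineGeneralPosition K.vertices)
      (O : Pt d → Diagram) (_ : IsOracle 𝔽 K O)
      (V : List (Pt d)) (_ : V.Nodup) (_ : ∀ x, x ∈ V ↔ x ∈ K.vertices)
      (k : ℕ) (_ : k < d)
      (σ : List (Pt d)) (_ : σ.Nodup) (_ : σ.length = k) (_ : vertexSet σ ∈ K.faces)
      (v : Pt d) (_ : v ∈ K.vertices) (_ : v ∉ σ)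
      (queryTime : ℝ) (_ : 0 ≤ queryTime),
      -- correctness
      ((isSimplex O V σ v).val = true ↔ vertexSet (v :: σ) ∈ K.faces) ∧
      -- number of diagrams
      (isSimplex O V σ v).diagrams = 2 * (2 ^ k - 1) ∧
      -- running time
      (isSimplex O V σ v).time queryTime ≤
        C * ((d : ℝ) * simplexCount K 0 + 2 ^ k *
          ((simplexCount K 0 : ℝ) * simplexCount K (k - 1)
            + simplexCount K 0 * Real.log (simplexCount K 0)
            + (d : ℝ) ^ 2 + 2 ^ (k - 1) + queryTime)) ∧
      -- the two numbers that the test compares are the `k`-indegrees of `σ` in two directions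
      -- orthogonal to `σ`, which bound a wedge that contains no vertex outside `σ` except `v`
      ∃ sL sU : Pt d, ∃ cL cU : ℝ,
        (wedgeDirections V σ v).val = (sL, sU) ∧ ‖sL‖ = 1 ∧ ‖sU‖ = 1 ∧
        (∀ w ∈ σ, inner ℝ sL w = cL ∧ inner ℝ sU w = cU) ∧
        {q | q ∈ K.vertices ∧ q ∉ σ} ∩ wedge sL cL sU cU = {v} ∧
        (computeIndegree O V k σ sL).val = kIndegree K k (vertexSet σ) sL ∧
        (computeIndegree O V k σ sU).val = kIndegree K k (vertexSet σ) sU := by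
  refine ⟨1000, ?_⟩
  intro 𝔽 _ d K hK hgp O hO V hVnd hV k hkd σ hσ hlen hface v hv hvσ Θ hΘ
  subst hlen
  obtain ⟨w, ws, rfl⟩ : ∃ w ws, σ = w :: ws := by
    cases σ with
    | nil => exact absurd hface (by simpa [vertexSet] using K.empty_notMem)
    | cons w ws => exact ⟨w, ws, rfl⟩
  have hσV : ∀ x ∈ w :: ws, x ∈ V := fun x hx =>
    mem_of_mem_face hV hface (by simpa [vertexSet] using hx)
  have hvV : v ∈ V := (hV v).2 hv
  have hgpV : ListGeneralPosition V := AffineGeneralPosition.list hgp fun x hx => (hV x).1 hx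
  have hperm : (w :: (ws ++ [v])).Perm (v :: w :: ws) :=
    (List.perm_append_singleton v (w :: ws) : (w :: ws ++ [v]).Perm (v :: w :: ws))
  have hnd : (v :: w :: ws).Nodup := List.nodup_cons.2 ⟨hvσ, hσ⟩
  have hin : WedgeInput V w ws v :=
    { nodup := hperm.nodup_iff.2 hnd
      mem := fun x hx => by
        rcases List.mem_cons.1 (hperm.mem_iff.1 hx) with rfl | hx
        · exact hvV
        · exact hσV x hx
      length_lt := by simpa using hkd
      generalPosition := hgpV
      nodup_vertices := hVnd }
  have hwedge := isWedge_wedgeDirections hin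
  have hwsteps := wedgeDirections_steps_le hin
  set sL := (wedgeDirections V (w :: ws) v).val.1 with hsL
  set sU := (wedgeDirections V (w :: ws) v).val.2 with hsU
  set k := (w :: ws).length with hk
  -- The bound k ≥ 1 comes for free: a face of the complex is nonempty.
  have hk1 : 1 ≤ k := by simp [hk]
  have hV2 : ∃ q ∈ V, q ≠ (w :: ws).headD 0 :=
    ⟨v, hvV, fun e => hvσ (by rw [e]; simp)⟩
  obtain ⟨l1, l2, l3⟩ := computeIndegree_spec hO hK hV hσ (by simp) hk1 hwedge.isAdapted_lower hσV
    hgpV (by omega) hV2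
  obtain ⟨u1, u2, u3⟩ := computeIndegree_spec hO hK hV hσ (by simp) hk1 hwedge.isAdapted_upper hσV
    hgpV (by omega) hV2
  rw [← hk] at l2 l3 u2 u3
  have hdiag : (isSimplex O V (w :: ws) v).diagrams = 2 * (2 ^ k - 1) := by
    rw [isSimplex_diagrams, ← hsU, ← hsL, ← hk, l3, u3]; ring
  refine ⟨?_, hdiag, ?_, sL, sU, inner ℝ sL w, inner ℝ sU w, rfl, hwedge.norm_lower,
    hwedge.norm_upper, fun x hx => ⟨hwedge.lower_eq x hx, hwedge.upper_eq x hx⟩,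
    hwedge.inter_wedge_eq hV hv hvσ, l1, u1⟩
  · rw [isSimplex_val, ← hsU, ← hsL, ← hk, l1, u1, decide_eq_true_eq]
    exact hwedge.abs_kIndegree_sub_eq_one_iff hK hV hσ hvσ
  · have hn0 := simplexCount_zero_eq hV hVnd
    have hn2 : 2 ≤ V.length := by
      have := (hnd.subperm (l₂ := V) fun x hx => by
        rcases List.mem_cons.1 hx with rfl | hx
        · exact hvV
        · exact hσV x hx).length_le
      simp only [List.length_cons] at this
      omega
    have hfs := faceSteps_le hK hk1 hkd (by omega)
    have hsteps := isSimplex_steps O V (w :: ws) v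
    rw [← hsU, ← hsL, ← hk] at hsteps
    rw [show ws.length + 1 = k from rfl] at hwsteps
    rw [hn0] at hfs ⊢
    have hE1 : k + 1 ≤ 2 ^ k := Nat.lt_two_pow_self
    have hd2 : 1 ≤ d ^ 2 := Nat.one_le_pow _ _ (by omega)
    have h1 : k * d ^ 2 ≤ 2 ^ k * d ^ 2 := Nat.mul_le_mul_right _ (by omega)
    have h2 : V.length ≤ d * V.length := Nat.le_mul_of_pos_left _ (by omega)
    have h3 := Nat.mul_le_mul_left (2 ^ k) hfs
    have h4 : 1 ≤ 2 ^ k * d ^ 2 := Nat.mul_pos (Nat.two_pow_pos k) hd2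
    have h5 : V.length * Nat.clog 2 V.length ≤ 2 ^ k * (V.length * Nat.clog 2 V.length) :=
      Nat.le_mul_of_pos_left _ (Nat.two_pow_pos k)
    -- The wedge directions contribute 200 to the coefficients of d n, d² and n clog n; the two
    -- indegrees add 20, 96 and 10. The remaining 16 in 312 are the additive constants.
    have hnat : (isSimplex O V (w :: ws) v).steps ≤ 220 * (d * V.length)
        + 2 ^ k * (210 * (V.length * Nat.clog 2 V.length)
          + 8 * (V.length * simplexCount K (k - 1)) + 312 * d ^ 2 + 800 * 2 ^ (k - 1)) := by
      rw [hsteps]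
      linarith
    refine (add_le_add_right (mul_le_mul_of_nonneg_left ?_ hΘ) _).trans
      (time_le_of_steps_le hn2 hnat hΘ)
    rw [hdiag]
    have : 2 * (2 ^ k - 1) ≤ 2 * 2 ^ k := by omega
    exact_mod_cast this
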